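/- Let $\mathbb{G}$ be a compact quantum group, i.e. a unital $\mathrm{C}^*$-algebra $\mathrm{C}(\mathbb{G})$ with a coassociative unital $*$-homomorphism $\Delta\colon \mathrm{C}(\mathbb{G})\to \mathrm{C}(\mathbb{G})\otimes \mathrm{C}(\mathbb{G})$ (minimal tensor product) such that the linear spans of $(\mathrm{C}(\mathbb{G})\otimes 1)\Delta(\mathrm{C}(\mathbb{G}))$ and of $(1\otimes \mathrm{C}(\mathbb{G}))\Delta(\mathrm{C}(\mathbb{G}))$ are dense. Let $\mathcal{T}\subset \mathrm{B}(\ell_2(\mathbb{Z}_+))$ be the Toeplitz algebra, i.e. the $\mathrm{C}^*$-algebra generated by the unilateral shift $e_n\mapsto e_{n+1}$, and assume that there is a $*$-isomorphism $\pi_\bullet\colon \mathrm{C}(\mathbb{G})\to\mathcal{T}$. Let $U^\alpha$ be an irreducible unitary representation of $\mathbb{G}$ on a Hilbert space $\mathsf{H}_\alpha$ of finite dimension $n_\alpha$, and let $\rho_\alpha$ be its modular operator: the unique positive invertible operator on $\mathsf{H}_\alpha$ that intertwines $U^\alpha$ with its double contragredient representation and satisfies $\operatorname{Tr}\rho_\alpha=\operatorname{Tr}\rho_\alpha^{-1}$.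 Fix an orthonormal basis of $\mathsf{H}_\alpha$ in which the matrix of $\rho_\alpha$ is diagonal, and let $U^\alpha_{i,j}\in \mathrm{C}(\mathbb{G})$ be the matrix elements of $U^\alpha$ in this basis. Then for all $i,j\in\{1,\dots,n_\alpha\}$ the operator $\pi_\bullet(U^\alpha_{i,j})$ on $\ell_2(\mathbb{Z}_+)$ is compact if and only if $i\neq j$. Moreover, for every $i$ the operator $\pi_\bullet(U^\alpha_{i,i})$ is a Fredholm operator. -/

import Mathlib

noncomputable section

namespace CQG

open scoped TensorProduct InnerProductSpace ComplexOrder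

/-- The Hilbert space tensor product of `H` and `K`: the completion of the algebraic tensor
product for the inner product `⟪ξ ⊗ η, ξ' ⊗ η'⟫ = ⟪ξ, ξ'⟫ ⟪η, η'⟫`. -/
def HilbertTensor (H : Type*) (K : Type*) [NormedAddCommGroup H] [InnerProductSpace ℂ H]
    [NormedAddCommGroup K] [InnerProductSpace ℂ K] : Type _ :=
  UniformSpace.Completion (H ⊗[ℂ] K)

section
variable {H : Type*} {K : Type*} [NormedAddCommGroup H] [InnerProductSpace ℂ H]
  [NormedAddCommGroup K] [InnerProductSpace ℂ K]

instance HilbertTensor.instNormedAddCommGroup : NormedAddCommGroup (HilbertTensor H K) :=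
  inferInstanceAs (NormedAddCommGroup (UniformSpace.Completion (H ⊗[ℂ] K)))

instance HilbertTensor.instInnerProductSpace : InnerProductSpace ℂ (HilbertTensor H K) :=
  inferInstanceAs (InnerProductSpace ℂ (UniformSpace.Completion (H ⊗[ℂ] K)))

instance HilbertTensor.instCompleteSpace : CompleteSpace (HilbertTensor H K) :=
  inferInstanceAs (CompleteSpace (UniformSpace.Completion (H ⊗[ℂ] K)))

/-- The dense embedding of the algebraic tensor product. -/
def HilbertTensor.of : H ⊗[ℂ] K →ₗᵢ[ℂ] HilbertTensor H K :=
  (UniformSpace.Completion.toComplₗᵢ : H ⊗[ℂ] K →ₗᵢ[ℂ] UniformSpace.Completion (H ⊗[ℂ] K))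

open HilbertTensor (of)

theorem HilbertTensor.denseRange_of : DenseRange (of : H ⊗[ℂ] K →ₗᵢ[ℂ] HilbertTensor H K) :=
  UniformSpace.Completion.denseRange_coe

/-- The simple tensor `ξ ⊗ η`. -/
def pureTensor (ξ : H) (η : K) : HilbertTensor H K := of (ξ ⊗ₜ[ℂ] η)

/-- The bounded operator `S ⊗ T` on the Hilbert space tensor product. -/
def opTensor (S : H →L[ℂ] H) (T : K →L[ℂ] K) : HilbertTensor H K →L[ℂ] HilbertTensor H K :=
  ((TensorProduct.mapL S T).completion :
    UniformSpace.Completion (H ⊗[ℂ] K) →L[ℂ] UniformSpace.Completion (H ⊗[ℂ] K))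

theorem opTensor_ext {X Y : HilbertTensor H K →L[ℂ] HilbertTensor H K}
    (h : ∀ z : H ⊗[ℂ] K, X (of z) = Y (of z)) : X = Y :=
  ContinuousLinearMap.ext fun z =>
    HilbertTensor.denseRange_of.induction_on z (isClosed_eq X.continuous Y.continuous) h

theorem opTensor_of (S : H →L[ℂ] H) (T : K →L[ℂ] K) (z : H ⊗[ℂ] K) :
    opTensor S T (of z) = of (TensorProduct.mapL S T z) :=
  ContinuousLinearMap.completion_apply_coe _ _

theorem opTensor_pure (S : H →L[ℂ] H) (T : K →L[ℂ] K) (ξ : H) (η : K) :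
    opTensor S T (pureTensor ξ η) = pureTensor (S ξ) (T η) := by
  rw [pureTensor, opTensor_of, TensorProduct.mapL_tmul, pureTensor]

theorem opTensor_add_left (S S' : H →L[ℂ] H) (T : K →L[ℂ] K) :
    opTensor (S + S') T = opTensor S T + opTensor S' T :=
  opTensor_ext fun z => by
    rw [add_apply, opTensor_of, opTensor_of, opTensor_of,
      TensorProduct.mapL_add_left, add_apply, map_add]

theorem opTensor_add_right (S : H →L[ℂ] H) (T T' : K →L[ℂ] K) :
    opTensor S (T + T') = opTensor S T + opTensor S T' :=
  opTensor_ext fun z => by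
    rw [add_apply, opTensor_of, opTensor_of, opTensor_of,
      TensorProduct.mapL_add_right, add_apply, map_add]

theorem opTensor_smul_left (c : ℂ) (S : H →L[ℂ] H) (T : K →L[ℂ] K) :
    opTensor (c • S) T = c • opTensor S T :=
  opTensor_ext fun z => by
    rw [smul_apply, opTensor_of, opTensor_of,
      TensorProduct.mapL_smul_left, smul_apply, map_smul]

theorem opTensor_smul_right (c : ℂ) (S : H →L[ℂ] H) (T : K →L[ℂ] K) :
    opTensor S (c • T) = c • opTensor S T :=
  opTensor_ext fun z => by
    rw [smul_apply, opTensor_of, opTensor_of,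
      TensorProduct.mapL_smul_right, smul_apply, map_smul]

theorem opTensor_mul (S S' : H →L[ℂ] H) (T T' : K →L[ℂ] K) :
    opTensor S T * opTensor S' T' = opTensor (S * S') (T * T') :=
  opTensor_ext fun z => by
    rw [mul_apply_eq_comp, opTensor_of, opTensor_of, opTensor_of,
      TensorProduct.mapL_mul, mul_apply_eq_comp]

theorem opTensor_one : opTensor (1 : H →L[ℂ] H) (1 : K →L[ℂ] K) = 1 :=
  opTensor_ext fun z => by
    rw [opTensor_of]
    exact congrArg of (DFunLike.congr_fun (TensorProduct.mapL_id_id (𝕜 := ℂ)) z)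

theorem opTensor_star [CompleteSpace H] [CompleteSpace K] (S : H →L[ℂ] H) (T : K →L[ℂ] K) :
    star (opTensor S T) = opTensor (star S) (star T) := by
  rw [ContinuousLinearMap.star_eq_adjoint]
  symm
  rw [ContinuousLinearMap.eq_adjoint_iff]
  intro x y
  refine HilbertTensor.denseRange_of.induction_on₂ (by apply isClosed_eq <;> fun_prop)
    (fun x y => ?_) x y
  · rw [opTensor_of, opTensor_of, LinearIsometry.inner_map_map, LinearIsometry.inner_map_map]
    induction x using TensorProduct.induction_on with
    | zero => simp
    | add x x' hx hx' => rw [map_add, inner_add_left, inner_add_left, hx, hx']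
    | tmul a b =>
      induction y using TensorProduct.induction_on with
      | zero => simp
      | add x x' hx hx' => rw [map_add, inner_add_right, inner_add_right, hx, hx']
      | tmul a b => simp [ContinuousLinearMap.star_eq_adjoint, ContinuousLinearMap.adjoint_inner_left]

theorem norm_opTensor_le (S : H →L[ℂ] H) (T : K →L[ℂ] K) : ‖opTensor S T‖ ≤ ‖S‖ * ‖T‖ := by
  refine ContinuousLinearMap.opNorm_le_bound _ (by positivity) fun z => ?_
  refine HilbertTensor.denseRange_of.induction_on z (isClosed_le (by fun_prop) (by fun_prop))
    fun z => ?_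
  · rw [opTensor_of, LinearIsometry.norm_map, LinearIsometry.norm_map]
    exact ((TensorProduct.mapL S T).le_opNorm z).trans
      (by gcongr; exact TensorProduct.norm_mapL_le S T)

variable {A B : Type*} [CStarAlgebra A] [CStarAlgebra B] [CompleteSpace H] [CompleteSpace K]

/-- The representation `a ⊗ b ↦ π a ⊗ σ b` of the algebraic tensor product `A ⊗ B` on the Hilbert
space tensor product. -/
def tensorRep (π : A →⋆ₐ[ℂ] (H →L[ℂ] H)) (σ : B →⋆ₐ[ℂ] (K →L[ℂ] K)) :
    A ⊗[ℂ] B →ₗ[ℂ] (HilbertTensor H K →L[ℂ] HilbertTensor H K) :=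
  TensorProduct.lift (LinearMap.mk₂ ℂ (fun a b => opTensor (π a) (σ b))
    (fun a a' b => by rw [map_add, opTensor_add_left])
    (fun c a b => by rw [map_smul, opTensor_smul_left])
    (fun a b b' => by rw [map_add, opTensor_add_right])
    (fun c a b => by rw [map_smul, opTensor_smul_right]))

theorem tensorRep_tmul (π : A →⋆ₐ[ℂ] (H →L[ℂ] H)) (σ : B →⋆ₐ[ℂ] (K →L[ℂ] K)) (a : A) (b : B) :
    tensorRep π σ (a ⊗ₜ b) = opTensor (π a) (σ b) := by
  simp [tensorRep]

/-- The minimal (spatial) tensor product of `A` and `B`, formed in faithful representations `π` and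
`σ`: the norm closure of the operators `∑ π aᵢ ⊗ σ bᵢ`. -/
def spatialTensor (π : A →⋆ₐ[ℂ] (H →L[ℂ] H)) (σ : B →⋆ₐ[ℂ] (K →L[ℂ] K)) :
    Submodule ℂ (HilbertTensor H K →L[ℂ] HilbertTensor H K) :=
  (LinearMap.range (tensorRep π σ)).topologicalClosure

/-- The embedding of the algebraic tensor product into the spatial one. -/
def toSpatialTensor (π : A →⋆ₐ[ℂ] (H →L[ℂ] H)) (σ : B →⋆ₐ[ℂ] (K →L[ℂ] K)) :
    A ⊗[ℂ] B →ₗ[ℂ] spatialTensor π σ :=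
  (tensorRep π σ).codRestrict _ fun x =>
    Submodule.le_topologicalClosure _ (LinearMap.mem_range_self _ x)

theorem toSpatialTensor_dense (π : A →⋆ₐ[ℂ] (H →L[ℂ] H)) (σ : B →⋆ₐ[ℂ] (K →L[ℂ] K)) :
    DenseRange (toSpatialTensor π σ) := by
  intro y
  rw [closure_subtype]
  have hy : (y : HilbertTensor H K →L[ℂ] HilbertTensor H K) ∈
      closure (LinearMap.range (tensorRep π σ) : Set _) := y.2
  convert hy
  ext z
  simp only [Set.mem_image, Set.mem_range, exists_exists_eq_and]
  rfl
end

section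
open HilbertTensor (of)
variable {H K H' K' : Type*} [NormedAddCommGroup H] [InnerProductSpace ℂ H] [CompleteSpace H]
  [NormedAddCommGroup K] [InnerProductSpace ℂ K] [CompleteSpace K]
  [NormedAddCommGroup H'] [InnerProductSpace ℂ H'] [CompleteSpace H']
  [NormedAddCommGroup K'] [InnerProductSpace ℂ K'] [CompleteSpace K']
  {A B : Type*} [CStarAlgebra A] [CStarAlgebra B]


open InnerProductSpace in
theorem rankOne_mul_rankOne {n : ℕ} {f : Fin n → K} (hf : Orthonormal ℂ f) (i j k l : Fin n) :
    rankOne ℂ (f i) (f j) * rankOne ℂ (f k) (f l) =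
      (if j = k then (1 : ℂ) else 0) • rankOne ℂ (f i) (f l) := by
  ext x
  rw [mul_apply_eq_comp, smul_apply, rankOne_apply, rankOne_apply, rankOne_apply, inner_smul_right,
    orthonormal_iff_ite.mp hf, smul_smul, mul_comm]

theorem star_sum_sum {R : Type*} [AddCommMonoid R] [StarAddMonoid R] {n : ℕ}
    (g : Fin n → Fin n → R) : star (∑ i, ∑ j, g i j) = ∑ i, ∑ j, star (g j i) := by
  rw [Finset.sum_comm]
  simp_rw [star_sum]

open InnerProductSpace in
/-- `M ↦ ∑ π (M i j) ⊗ |f i⟩⟨f j|`. -/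
def matrixRep (π : A →⋆ₐ[ℂ] (H →L[ℂ] H)) {n : ℕ} (f : Fin n → K) (hf : Orthonormal ℂ f) :
    CStarMatrix (Fin n) (Fin n) A →⋆ₙₐ[ℂ] (HilbertTensor H K →L[ℂ] HilbertTensor H K) where
  toFun M := ∑ i, ∑ j, opTensor (π (M i j)) (rankOne ℂ (f i) (f j))
  map_zero' := by
    refine Finset.sum_eq_zero fun i _ => Finset.sum_eq_zero fun j _ => ?_
    rw [CStarMatrix.zero_apply, map_zero, ← zero_smul ℂ (0 : H →L[ℂ] H), opTensor_smul_left,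
      zero_smul]
  map_add' M N := by
    simp only [CStarMatrix.add_apply, map_add, opTensor_add_left, Finset.sum_add_distrib]
  map_smul' c M := by
    simp only [CStarMatrix.smul_apply, map_smul, opTensor_smul_left, Finset.smul_sum]
    rfl
  map_mul' M N := by
    have hl : ∀ (s : Finset (Fin n)) (g : Fin n → (H →L[ℂ] H)) (T : K →L[ℂ] K),
        opTensor (∑ k ∈ s, g k) T = ∑ k ∈ s, opTensor (g k) T := fun s g T =>
      map_sum (AddMonoidHom.mk' (fun S : H →L[ℂ] H => opTensor S T)
        fun S S' => opTensor_add_left S S' T) g s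
    have hz : ∀ (g : H →L[ℂ] H), opTensor g (0 : K →L[ℂ] K) = 0 := fun g => by
      rw [← zero_smul ℂ (0 : K →L[ℂ] K), opTensor_smul_right, zero_smul]
    have hL : ∀ i l, opTensor (π ((M * N) i l)) (rankOne ℂ (f i) (f l)) =
        ∑ j, opTensor (π (M i j) * π (N j l)) (rankOne ℂ (f i) (f l)) := fun i l => by
      rw [CStarMatrix.mul_apply, map_sum, hl]
      exact Finset.sum_congr rfl fun j _ => by rw [map_mul]
    have hR : ∀ i j k l, opTensor (π (M i j)) (rankOne ℂ (f i) (f j)) *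
        opTensor (π (N k l)) (rankOne ℂ (f k) (f l)) =
        if j = k then opTensor (π (M i j) * π (N k l)) (rankOne ℂ (f i) (f l)) else 0 := by
      intro i j k l
      rw [opTensor_mul, rankOne_mul_rankOne hf]
      split_ifs
      · rw [one_smul]
      · rw [zero_smul, hz]
    simp_rw [hL, Finset.sum_mul, Finset.mul_sum, hR]
    refine Finset.sum_congr rfl fun i _ => ?_
    rw [Finset.sum_comm]
    refine Finset.sum_congr rfl fun j _ => ?_
    rw [Finset.sum_comm]
    exact Finset.sum_congr rfl fun l _ => by simp
  map_star' M := by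
    have h : ∀ i j, opTensor (π (star (M j i))) (rankOne ℂ (f i) (f j)) =
        star (opTensor (π (M j i)) (rankOne ℂ (f j) (f i))) := fun i j => by
      rw [opTensor_star, map_star,
        ContinuousLinearMap.star_eq_adjoint (rankOne ℂ (f j) (f i)), adjoint_rankOne]
    refine Eq.trans ?_ (star_sum_sum fun i j => opTensor (π (M i j)) (rankOne ℂ (f i) (f j))).symm
    exact Finset.sum_congr rfl fun i _ => Finset.sum_congr rfl fun j _ => h i j

open InnerProductSpace in
theorem matrixRep_injective (π : A →⋆ₐ[ℂ] (H →L[ℂ] H)) (hπ : Function.Injective π)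
    {n : ℕ} (f : Fin n → K) (hf : Orthonormal ℂ f) : Function.Injective (matrixRep π f hf) := by
  refine (injective_iff_map_eq_zero _).mpr fun M hM => ?_
  ext i j
  rw [CStarMatrix.zero_apply]
  apply hπ
  rw [map_zero]
  ext ξ
  apply ext_inner_left ℂ
  intro ζ
  have h := congrArg (fun X : HilbertTensor H K →L[ℂ] HilbertTensor H K =>
    inner ℂ (pureTensor ζ (f i)) (X (pureTensor ξ (f j)))) hM
  change inner ℂ (pureTensor ζ (f i)) ((∑ k, ∑ l, opTensor (π (M k l))
    (rankOne ℂ (f k) (f l))) (pureTensor ξ (f j))) = inner ℂ (pureTensor ζ (f i)) 0 at h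
  simp only [sum_apply, inner_sum, opTensor_pure, rankOne_apply, orthonormal_iff_ite.mp hf] at h
  simp only [pureTensor, LinearIsometry.inner_map_map, TensorProduct.inner_tmul,
    inner_smul_right, orthonormal_iff_ite.mp hf, inner_zero_right] at h
  simpa using h


/-- `a ⊗ b ↦ ⟪η, σ b ζ⟫ a`. -/
def compressEntry (σ : B →⋆ₐ[ℂ] (K →L[ℂ] K)) (η ζ : K) : A ⊗[ℂ] B →ₗ[ℂ] A :=
  TensorProduct.lift (LinearMap.mk₂ ℂ
    (fun (a : A) (b : B) => (inner ℂ η (σ b ζ) : ℂ) • a)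
    (fun a a' b => smul_add _ _ _) (fun c a b => smul_comm _ _ _)
    (fun a b b' => by rw [map_add, add_apply, inner_add_right, add_smul])
    (fun c a b => by rw [map_smul, smul_apply, inner_smul_right, mul_smul]))

/-- The matrix with entries `⟪f i, σ b (f j)⟫ a` for `x = a ⊗ b`. -/
def compressMatrix (σ : B →⋆ₐ[ℂ] (K →L[ℂ] K)) {n : ℕ} (f : Fin n → K) (x : A ⊗[ℂ] B) :
    CStarMatrix (Fin n) (Fin n) A :=
  CStarMatrix.ofMatrix fun i j => compressEntry σ (f i) (f j) x

open InnerProductSpace in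
theorem compress_eq_matrixRep (π : A →⋆ₐ[ℂ] (H →L[ℂ] H)) (σ : B →⋆ₐ[ℂ] (K →L[ℂ] K))
    (x : A ⊗[ℂ] B) {n : ℕ} (f : Fin n → K) (hf : Orthonormal ℂ f) :
    opTensor 1 (∑ i, rankOne ℂ (f i) (f i)) * tensorRep π σ x *
        opTensor 1 (∑ i, rankOne ℂ (f i) (f i)) = matrixRep π f hf (compressMatrix σ f x) := by
  induction x using TensorProduct.induction_on with
  | zero =>
    have : compressMatrix (A := A) σ f 0 = 0 := by
      ext i j
      exact map_zero (compressEntry σ (f i) (f j))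
    rw [this, map_zero, map_zero, mul_zero, zero_mul]
  | add x y hx hy =>
    have : compressMatrix σ f (x + y) = compressMatrix σ f x + compressMatrix σ f y := by
      ext i j
      exact map_add (compressEntry σ (f i) (f j)) x y
    rw [this, map_add, map_add, mul_add, add_mul, hx, hy]
  | tmul a b =>
    have hr : ∀ (s : Finset (Fin n)) (S : H →L[ℂ] H) (g : Fin n → (K →L[ℂ] K)),
        opTensor S (∑ k ∈ s, g k) = ∑ k ∈ s, opTensor S (g k) := fun s S g =>
      map_sum (AddMonoidHom.mk' (fun T : K →L[ℂ] K => opTensor S T)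
        fun T T' => opTensor_add_right S T T') g s
    have hT : (∑ i, rankOne ℂ (f i) (f i)) * σ b * (∑ j, rankOne ℂ (f j) (f j)) =
        ∑ i, ∑ j, inner ℂ (f i) (σ b (f j)) • rankOne ℂ (f i) (f j) := by
      rw [Finset.sum_mul, Finset.sum_mul_sum]
      refine Finset.sum_congr rfl fun i _ => Finset.sum_congr rfl fun j _ => ?_
      ext ζ
      simp [mul_apply_eq_comp, rankOne_apply, smul_smul, mul_comm]
    rw [tensorRep_tmul, opTensor_mul, opTensor_mul, one_mul, mul_one, hT, hr]
    change _ = ∑ i, ∑ j, opTensor (π (inner ℂ (f i) (σ b (f j)) • a)) (rankOne ℂ (f i) (f j))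
    refine Finset.sum_congr rfl fun i _ => ?_
    rw [hr]
    exact Finset.sum_congr rfl fun j _ => by
      rw [map_smul, opTensor_smul_left, opTensor_smul_right]

theorem norm_le_of_inner_le
    (X : HilbertTensor H K →L[ℂ] HilbertTensor H K) {C : ℝ} (hC : 0 ≤ C)
    (h : ∀ v w : H ⊗[ℂ] K, ‖inner ℂ (of w) (X (of v))‖ ≤ C * ‖w‖ * ‖v‖) :
    ‖X‖ ≤ C := by
  have h' : ∀ v w : HilbertTensor H K, ‖inner ℂ w (X v)‖ ≤ C * ‖w‖ * ‖v‖ := fun v w =>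
    HilbertTensor.denseRange_of.induction_on₂ (isClosed_le (by fun_prop) (by fun_prop))
      (fun v w => by simpa using h v w) v w
  refine X.opNorm_le_bound hC fun v => ?_
  rcases eq_or_ne (X v) 0 with h0 | h0
  · rw [h0, norm_zero]; positivity
  · have := h' v (X v)
    rw [inner_self_eq_norm_sq_to_K] at this
    have hp : 0 < ‖X v‖ := norm_pos_iff.mpr h0
    simp only [norm_pow, RCLike.norm_ofReal, abs_norm] at this
    nlinarith

theorem norm_matrixRep_le_matrixRep (π : A →⋆ₐ[ℂ] (H →L[ℂ] H)) (hπ : Function.Injective π)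
    (π' : A →⋆ₐ[ℂ] (H' →L[ℂ] H')) {n : ℕ} (f : Fin n → K) (hf : Orthonormal ℂ f)
    (M : CStarMatrix (Fin n) (Fin n) A) : ‖matrixRep π' f hf M‖ ≤ ‖matrixRep π f hf M‖ := by
  let _ := CStarAlgebra.spectralOrder A
  have _ := CStarAlgebra.spectralOrderedRing A
  have h1 : ‖matrixRep π' f hf M‖ ≤ ‖M‖ := NonUnitalStarAlgHom.norm_apply_le (matrixRep π' f hf) M
  have h2 : ‖matrixRep π f hf M‖ = ‖M‖ :=
    NonUnitalStarAlgHom.norm_map (matrixRep π f hf) (matrixRep_injective π hπ f hf) M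
  exact h1.trans h2.ge

theorem norm_compress_le {V : Type*} [NormedAddCommGroup V] [NormedSpace ℂ V]
    {P : V →L[ℂ] V} (hP : ‖P‖ ≤ 1) (X : V →L[ℂ] V) : ‖P * X * P‖ ≤ ‖X‖ := by
  calc ‖P * X * P‖ ≤ ‖P‖ * ‖X‖ * ‖P‖ := norm_mul₃_le
    _ ≤ 1 * ‖X‖ * 1 := by gcongr
    _ = ‖X‖ := by ring

open InnerProductSpace in
theorem norm_tensorRep_le_left (π : A →⋆ₐ[ℂ] (H →L[ℂ] H)) (hπ : Function.Injective π)
    (π' : A →⋆ₐ[ℂ] (H' →L[ℂ] H')) (σ : B →⋆ₐ[ℂ] (K →L[ℂ] K)) (x : A ⊗[ℂ] B) :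
    ‖tensorRep π' σ x‖ ≤ ‖tensorRep π σ x‖ := by
  refine norm_le_of_inner_le _ (ContinuousLinearMap.opNorm_nonneg _) fun v w => ?_
  obtain ⟨N, hN, hs⟩ := TensorProduct.exists_finite_submodule_right_of_setFinite
    ({v, w} : Set (H' ⊗[ℂ] K)) (Set.toFinite _)
  have : FiniteDimensional ℂ N := hN
  let e := stdOrthonormalBasis ℂ N
  let f : Fin (Module.finrank ℂ N) → K := fun i => (e i : K)
  have hf : Orthonormal ℂ f := e.orthonormal.comp_linearIsometry N.subtypeₗᵢ
  let P : K →L[ℂ] K := ∑ i, rankOne ℂ (f i) (f i)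
  have hPN : ∀ y : N, P y = y := fun y => by
    have := congrArg (Subtype.val) (e.sum_repr' y)
    simp only [P, sum_apply, rankOne_apply]
    simpa [f] using this
  have hPs : star P = P := by
    simp only [P, star_sum, ContinuousLinearMap.star_eq_adjoint, adjoint_rankOne]
  have hP1 : ‖P‖ ≤ 1 := by
    have : P = N.starProjection := by
      rw [e.starProjection_eq_sum_rankOne]
    rw [this]
    exact N.starProjection_norm_le
  have hfix : ∀ z ∈ ({v, w} : Set (H' ⊗[ℂ] K)),
      opTensor (1 : H' →L[ℂ] H') P (of z) = of z := by
    intro z hz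
    obtain ⟨y, rfl⟩ := hs hz
    rw [opTensor_of]
    congr 1
    clear hz
    induction y using TensorProduct.induction_on with
    | zero => simp
    | add y y' hy hy' => rw [map_add, map_add, hy, hy']
    | tmul a b => simp [hPN]
  have hs' : star (opTensor (1 : H' →L[ℂ] H') P) = opTensor (1 : H' →L[ℂ] H') P := by
    rw [opTensor_star, hPs, star_one]
  have key : inner ℂ (of w) (tensorRep π' σ x (of v)) =
      inner ℂ (of w) (opTensor 1 P (tensorRep π' σ x (opTensor 1 P (of v)))) := by
    rw [hfix v (by simp), ← hs',
      ContinuousLinearMap.star_eq_adjoint, ContinuousLinearMap.adjoint_inner_right,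
      hfix w (by simp)]
  have hPP : ‖opTensor (1 : H →L[ℂ] H) P‖ ≤ 1 :=
    (norm_opTensor_le _ _).trans
      (mul_le_one₀ ContinuousLinearMap.norm_id_le (ContinuousLinearMap.opNorm_nonneg _) hP1)
  have hM : ‖opTensor (1 : H' →L[ℂ] H') P * tensorRep π' σ x * opTensor (1 : H' →L[ℂ] H') P‖ ≤
      ‖tensorRep π σ x‖ := by
    rw [compress_eq_matrixRep π' σ x f hf]
    refine (norm_matrixRep_le_matrixRep π hπ π' f hf _).trans ?_
    rw [← compress_eq_matrixRep π σ x f hf]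
    exact norm_compress_le hPP _
  rw [key]
  have h1 : ‖opTensor 1 P (tensorRep π' σ x (opTensor 1 P (of v)))‖ ≤
      ‖tensorRep π σ x‖ * ‖v‖ := by
    rw [← (of : H' ⊗[ℂ] K →ₗᵢ[ℂ] _).norm_map v]
    exact ContinuousLinearMap.le_of_opNorm_le _ hM _
  calc _ ≤ ‖(of w)‖ * ‖opTensor 1 P (tensorRep π' σ x (opTensor 1 P
        (of v)))‖ := norm_inner_le_norm _ _
    _ ≤ ‖w‖ * (‖tensorRep π σ x‖ * ‖v‖) := by
        rw [LinearIsometry.norm_map]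
        exact mul_le_mul_of_nonneg_left h1 (norm_nonneg _)
    _ = _ := by ring


/-- The flip `ξ ⊗ η ↦ η ⊗ ξ`. -/
def flipTensor (H K : Type*) [NormedAddCommGroup H] [InnerProductSpace ℂ H]
    [NormedAddCommGroup K] [InnerProductSpace ℂ K] : HilbertTensor H K →L[ℂ] HilbertTensor K H :=
  ((TensorProduct.commIsometry ℂ H K).toContinuousLinearEquiv.toContinuousLinearMap.completion :
    UniformSpace.Completion (H ⊗[ℂ] K) →L[ℂ] UniformSpace.Completion (K ⊗[ℂ] H))

theorem flipTensor_of (z : H ⊗[ℂ] K) :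
    flipTensor H K (of z) = of (TensorProduct.comm ℂ H K z) :=
  ContinuousLinearMap.completion_apply_coe _ _

theorem norm_flipTensor_apply (z : HilbertTensor H K) : ‖flipTensor H K z‖ = ‖z‖ := by
  refine HilbertTensor.denseRange_of.induction_on z (isClosed_eq (by fun_prop) (by fun_prop))
    fun z => ?_
  rw [flipTensor_of, LinearIsometry.norm_map, LinearIsometry.norm_map, TensorProduct.norm_comm]

theorem tensorRep_comm (π : A →⋆ₐ[ℂ] (H →L[ℂ] H)) (σ : B →⋆ₐ[ℂ] (K →L[ℂ] K)) (x : A ⊗[ℂ] B)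
    (z : HilbertTensor H K) :
    tensorRep σ π (TensorProduct.comm ℂ A B x) (flipTensor H K z) =
      flipTensor H K (tensorRep π σ x z) := by
  refine HilbertTensor.denseRange_of.induction_on z (isClosed_eq (by fun_prop) (by fun_prop))
    fun z => ?_
  · induction x using TensorProduct.induction_on with
    | zero => simp only [map_zero, zero_apply]
    | add x y hx hy => simp only [map_add, add_apply, hx, hy]
    | tmul a b =>
      rw [TensorProduct.comm_tmul, tensorRep_tmul, tensorRep_tmul, flipTensor_of, opTensor_of,
        opTensor_of, flipTensor_of]
      congr 1
      induction z using TensorProduct.induction_on with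
      | zero => simp
      | add z y hz hy => rw [map_add, map_add, hz, hy, map_add, map_add]
      | tmul ξ η => simp

theorem norm_tensorRep_comm_le (π : A →⋆ₐ[ℂ] (H →L[ℂ] H)) (σ : B →⋆ₐ[ℂ] (K →L[ℂ] K))
    (x : A ⊗[ℂ] B) :
    ‖tensorRep π σ x‖ ≤ ‖tensorRep σ π (TensorProduct.comm ℂ A B x)‖ := by
  refine ContinuousLinearMap.opNorm_le_bound _ (ContinuousLinearMap.opNorm_nonneg _) fun z => ?_
  rw [← norm_flipTensor_apply, ← tensorRep_comm, ← norm_flipTensor_apply z]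
  exact ContinuousLinearMap.le_opNorm _ _

theorem norm_tensorRep_le (π : A →⋆ₐ[ℂ] (H →L[ℂ] H)) (hπ : Function.Injective π)
    (σ : B →⋆ₐ[ℂ] (K →L[ℂ] K)) (hσ : Function.Injective σ)
    (π' : A →⋆ₐ[ℂ] (H' →L[ℂ] H')) (σ' : B →⋆ₐ[ℂ] (K' →L[ℂ] K')) (x : A ⊗[ℂ] B) :
    ‖tensorRep π' σ' x‖ ≤ ‖tensorRep π σ x‖ := by
  refine (norm_tensorRep_comm_le π' σ' x).trans ?_
  refine (norm_tensorRep_le_left σ hσ σ' π' _).trans ?_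
  refine (norm_tensorRep_comm_le σ π' _).trans ?_
  have h : TensorProduct.comm ℂ B A (TensorProduct.comm ℂ A B x) = x :=
    (TensorProduct.comm ℂ A B).symm_apply_apply x
  rw [h]
  exact norm_tensorRep_le_left π hπ π' σ x

/-- The homomorphism from the spatial tensor product of `A` and `B` (formed in the representations
`π`, `σ`) that extends `π a ⊗ σ b ↦ π' a ⊗ σ' b` by continuity. -/
def spatialMap (π : A →⋆ₐ[ℂ] (H →L[ℂ] H)) (σ : B →⋆ₐ[ℂ] (K →L[ℂ] K))
    (π' : A →⋆ₐ[ℂ] (H' →L[ℂ] H')) (σ' : B →⋆ₐ[ℂ] (K' →L[ℂ] K')) :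
    spatialTensor π σ →L[ℂ] (HilbertTensor H' K' →L[ℂ] HilbertTensor H' K') :=
  (tensorRep π' σ').extendOfNorm (toSpatialTensor π σ)

/-- For faithful `π` and `σ` the norm bound that `spatialMap` needs always holds, so that
`spatialMap` is what its description says. -/
theorem spatialMap_toSpatialTensor (π : A →⋆ₐ[ℂ] (H →L[ℂ] H)) (hπ : Function.Injective π)
    (σ : B →⋆ₐ[ℂ] (K →L[ℂ] K)) (hσ : Function.Injective σ)
    (π' : A →⋆ₐ[ℂ] (H' →L[ℂ] H')) (σ' : B →⋆ₐ[ℂ] (K' →L[ℂ] K')) (x : A ⊗[ℂ] B) :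
    spatialMap π σ π' σ' (toSpatialTensor π σ x) = tensorRep π' σ' x :=
  LinearMap.extendOfNorm_eq (toSpatialTensor_dense π σ)
    ⟨1, fun x => by rw [one_mul]; exact norm_tensorRep_le π hπ σ hσ π' σ' x⟩ x

end

section QuantumGroup

/-- A compact quantum group `𝔾` with `C(𝔾) = A`: a unital C*-algebra `A` with a coassociative
unital *-homomorphism `Δ : A → A ⊗ A` into the minimal tensor product that satisfies the
cancellation (density) conditions. The tensor product is formed in a faithful representation
`rep` of `A` on a Hilbert space `H`; up to isomorphism it does not depend on that choice. -/
structure CompactQuantumGroup (A : Type*) [CStarAlgebra A] (H : Type*) [NormedAddCommGroup H]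
    [InnerProductSpace ℂ H] [CompleteSpace H] where
  rep : A →⋆ₐ[ℂ] (H →L[ℂ] H)
  rep_injective : Function.Injective rep
  /-- The comultiplication `Δ`. -/
  comul : A →⋆ₐ[ℂ] (HilbertTensor H H →L[ℂ] HilbertTensor H H)
  comul_mem : ∀ a, comul a ∈ spatialTensor rep rep
  /-- `(Δ ⊗ id) Δ = (id ⊗ Δ) Δ`, as an equality of operators on `(H ⊗ H) ⊗ H = H ⊗ (H ⊗ H)`,
  expressed by their matrix coefficients between simple tensors. -/
  coassoc : ∀ (a : A) (ξ₁ ξ₂ ξ₃ η₁ η₂ η₃ : H),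
    inner ℂ (pureTensor (pureTensor ξ₁ ξ₂) ξ₃)
      (spatialMap rep rep comul rep ⟨comul a, comul_mem a⟩
        (pureTensor (pureTensor η₁ η₂) η₃)) =
    inner ℂ (pureTensor ξ₁ (pureTensor ξ₂ ξ₃))
      (spatialMap rep rep rep comul ⟨comul a, comul_mem a⟩
        (pureTensor η₁ (pureTensor η₂ η₃)))
  /-- The span of `(A ⊗ 1) Δ(A)` is dense in `A ⊗ A`. -/
  cancel_left : (Submodule.span ℂ (Set.range fun p : A × A =>
    opTensor (rep p.1) 1 * comul p.2)).topologicalClosure = spatialTensor rep rep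
  /-- The span of `(1 ⊗ A) Δ(A)` is dense in `A ⊗ A`. -/
  cancel_right : (Submodule.span ℂ (Set.range fun p : A × A =>
    opTensor 1 (rep p.1) * comul p.2)).topologicalClosure = spatialTensor rep rep

variable {A : Type*} [CStarAlgebra A] {H : Type*} [NormedAddCommGroup H]
  [InnerProductSpace ℂ H] [CompleteSpace H]

/-- A scalar matrix viewed as a matrix over `A` (that is, `T ⊗ 1`). -/
def scalarMatrix (A : Type*) [CStarAlgebra A] {n : ℕ} (T : Matrix (Fin n) (Fin n) ℂ) :
    Matrix (Fin n) (Fin n) A :=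
  T.map (algebraMap ℂ A)

/-- `u ∈ Mₙ(A)` is an irreducible unitary representation of `𝔾` on `ℂⁿ`: it is unitary,
`Δ(u i j) = ∑ₖ u i k ⊗ u k j`, and only the scalar matrices intertwine `u` with itself. -/
structure CompactQuantumGroup.IsIrreducibleUnitaryRep (G : CompactQuantumGroup A H) {n : ℕ}
    (u : Matrix (Fin n) (Fin n) A) : Prop where
  comul_apply : ∀ i j, G.comul (u i j) = ∑ k, opTensor (G.rep (u i k)) (G.rep (u k j))
  unitary : u ∈ unitary (Matrix (Fin n) (Fin n) A)
  dim_pos : 0 < n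
  schur : ∀ T : Matrix (Fin n) (Fin n) ℂ,
    scalarMatrix A T * u = u * scalarMatrix A T → ∃ c : ℂ, T = c • 1

/-- The contragredient `uᶜ` of an invertible representation `u`: the transpose of `u⁻¹`
(for unitary `u` its entries are `(u i j)*`). -/
def contragredient {n : ℕ} (u : Matrix (Fin n) (Fin n) A) : Matrix (Fin n) (Fin n) A :=
  (Ring.inverse u).transpose

/-- `ρ` is the modular operator of the irreducible unitary representation `u`: the positive
invertible intertwiner from `u` to `uᶜᶜ` normalised by `Tr ρ = Tr ρ⁻¹`. It exists, is unique, and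
is the matrix in the orthogonality relations `h(u i j (u k l)*) = δᵢₖ ρ l j / Tr ρ` of the Haar
state `h`. -/
structure IsModularOperator {n : ℕ} (u : Matrix (Fin n) (Fin n) A)
    (ρ : Matrix (Fin n) (Fin n) ℂ) : Prop where
  posDef : ρ.PosDef
  trace_eq : ρ.trace = ρ⁻¹.trace
  intertwines : scalarMatrix A ρ * u = contragredient (contragredient u) * scalarMatrix A ρ

/-- The matrix element `⟨bᵢ, u bⱼ⟩ ∈ A` of a representation `u` on `ℂⁿ` with respect to an
orthonormal basis `b` of `ℂⁿ`. -/
def matrixElement {n : ℕ} (u : Matrix (Fin n) (Fin n) A)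
    (b : OrthonormalBasis (Fin n) ℂ (EuclideanSpace ℂ (Fin n))) (i j : Fin n) : A :=
  ∑ k, ∑ l, (star (b i k) * b j l) • u k l

end QuantumGroup

section Toeplitz

/-- The Hilbert space `ℓ₂(ℤ₊)`. -/
abbrev EllTwo : Type := lp (fun _ : ℕ => ℂ) 2

/-- The coordinates of the shifted sequence `(0, x 0, x 1, …)`. -/
def shiftSeq (x : ℕ → ℂ) : ℕ → ℂ
  | 0 => 0
  | n + 1 => x n

theorem hasSum_shiftSeq (x : EllTwo) :
    HasSum (fun n => ‖shiftSeq x n‖ ^ (2 : ENNReal).toReal) (‖x‖ ^ (2 : ENNReal).toReal) := by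
  rw [← hasSum_nat_add_iff' 1]
  simpa [shiftSeq] using lp.hasSum_norm (by norm_num) x

/-- The unilateral shift on `ℓ₂(ℤ₊)`. -/
def shift : EllTwo →ₗᵢ[ℂ] EllTwo where
  toFun x := ⟨shiftSeq x, memℓp_gen (hasSum_shiftSeq x).summable⟩
  map_add' x y := by
    ext n
    change shiftSeq (x + y : EllTwo) n = shiftSeq x n + shiftSeq y n
    cases n <;> simp [shiftSeq]
  map_smul' c x := by
    ext n
    cases n <;> simp [shiftSeq]
  norm_map' x := by
    have h : (0 : ℝ) < (2 : ENNReal).toReal := by norm_num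
    rw [lp.norm_eq_tsum_rpow h, lp.norm_eq_tsum_rpow h, (lp.hasSum_norm h x).tsum_eq]
    congr 1
    exact (hasSum_shiftSeq x).tsum_eq

theorem shift_single (n : ℕ) :
    shift (lp.single 2 n (1 : ℂ)) = lp.single 2 (n + 1) (1 : ℂ) := by
  ext m
  cases m with
  | zero => simp [shift, shiftSeq]
  | succ m => simp [shift, shiftSeq, Pi.single_apply]

/-- The Toeplitz algebra: the C*-algebra of operators on `ℓ₂(ℤ₊)` generated by the shift. -/
def toeplitzAlgebra : StarSubalgebra ℂ (EllTwo →L[ℂ] EllTwo) :=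
  StarAlgebra.elemental ℂ shift.toContinuousLinearMap

end Toeplitz

end CQG

end

/-!
Identify `C(𝔾)` with the Toeplitz algebra `𝒯` and write `S` for the shift. The quotient of `𝒯` by
the compact operators is commutative, with the circle of characters of `𝒯` as its spectrum; the
values of an element at the characters are its symbol. An element with zero symbol is compact
(`isCompactOperator_of_forall_character`), and an element with unimodular symbol is unitary modulo
the compact operators, hence Fredholm (`isFredholm_of_isCompactOperator`). So the theorem says that,
in an orthonormal eigenbasis of the modular operator `ρ`, the matrix of symbols of the
representation is diagonal: being unitary, it then has unimodular diagonal entries.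

Under convolution the characters form a compact group `Γ` (`SliceSystem.CharGroup`), which is
homeomorphic to the circle, hence connected, and commutative (`mul_comm_of_injective_circle`).
The restriction of the representation to `Γ` consists of commuting unitary matrices that also
commute with `ρ`, so there is a basis of joint eigenvectors
(`span_jointEigenvector_eq_top`), and what has to be shown is that `Γ` acts by scalars on each
eigenspace of `ρ` (`SliceSystem.IsDiagRep.eq_of_isJointEigenvector`).

This is where the index of Toeplitz operators enters. The Haar state `h`
(`SliceSystem.exists_haar`) is faithful (`SliceSystem.IsHaar.eq_zero_of_mem_nullSpace`): if the
co-unit, which is the identity of `Γ`, vanishes on the null space of `h`, then that space is zero,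
because it is invariant under translations; if not, then no character vanishes on it, so it contains
a finite rank perturbation of `1`, and then `𝒯` would have finite dimension. On matrix elements `h`
satisfies the modular relation `h (w_ij b) = κ r_i r_j h (b w_ij)`, with `r_i` the eigenvalues of
`ρ` and `κ` a constant; it follows directly from the orthogonality relations
(`SliceSystem.IsDiagRep.haar_mul`). On finite rank operators `h` is given by a density operator `D`,
which is compact, selfadjoint and, by faithfulness, injective; the modular relation becomes
`D w_ij = κ r_i r_j w_ij D` (`SliceSystem.IsHaar.density_mul`).

Let now `ξ` and `η` be joint eigenvectors in one eigenspace of `ρ`, on which `Γ` acts through the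
characters `f` and `g`, and let `x` and `y` be the diagonal coefficients of the representation at
`ξ` and `η`. They satisfy the same modular relation with `D`, so `x* y` commutes with `D` and
preserves its eigenspaces, which have finite dimension. Replacing it by the identity on a large
finite sum of these eigenspaces makes it invertible. It therefore has index zero, and its symbol,
which is a multiple of `f̄ g`, has winding number zero, that is, a continuous logarithm
(`exists_log_symbol_of_commute`). A character of a compact connected group that has a continuous
logarithm is trivial (`eq_one_of_eq_exp`), so `f = g`.

The minimal tensor product enters only through its slice maps, which are collected in
`SliceSystem`.
-/


noncomputable section

namespace CQG

open scoped TensorProduct InnerProductSpace ComplexOrder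
open Filter Topology

section

/-! ### Compact quantum groups through slice maps -/

/-- Positivity of a bounded functional on a C*-algebra. -/
def IsPos {A : Type*} [CStarAlgebra A] (f : A →L[ℂ] ℂ) : Prop := ∀ a, 0 ≤ f (star a * a)

/-- The slice-map description of a compact quantum group: `B` plays the role of the minimal tensor
product `A ⊗ A`, with `inl a = a ⊗ 1`, `inr a = 1 ⊗ a`, and every bounded functional `f` on `A` can
be applied to the second leg (`sliceR f = id ⊗ f`) or to the first one (`sliceL f = f ⊗ id`). The
fields are those properties of the tensor product and of the comultiplication that enter the theory
of the Haar state and of the characters. -/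
structure SliceSystem (A B : Type*) [CStarAlgebra A] [CStarAlgebra B] where
  inl : A →⋆ₐ[ℂ] B
  inr : A →⋆ₐ[ℂ] B
  comul : A →⋆ₐ[ℂ] B
  sliceR : (A →L[ℂ] ℂ) → B →L[ℂ] A
  sliceL : (A →L[ℂ] ℂ) → B →L[ℂ] A
  comm : ∀ a b, Commute (inl a) (inr b)
  sliceR_mul : ∀ f a b, sliceR f (inl a * inr b) = f b • a
  sliceL_mul : ∀ f a b, sliceL f (inl a * inr b) = f a • b
  norm_sliceR_le : ∀ f X, ‖sliceR f X‖ ≤ ‖f‖ * ‖X‖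
  norm_sliceL_le : ∀ f X, ‖sliceL f X‖ ≤ ‖f‖ * ‖X‖
  dense : (Submodule.span ℂ (Set.range fun p : A × A => inl p.1 * inr p.2)).topologicalClosure = ⊤
  cancel_left :
    (Submodule.span ℂ (Set.range fun p : A × A => inl p.1 * comul p.2)).topologicalClosure = ⊤
  cancel_right :
    (Submodule.span ℂ (Set.range fun p : A × A => inr p.1 * comul p.2)).topologicalClosure = ⊤
  pos : ∀ f g, IsPos f → IsPos g → ∀ X, 0 ≤ f (sliceR g (star X * X))
  coassoc : ∀ f g a, sliceL f (comul (sliceR g (comul a))) = sliceR g (comul (sliceL f (comul a)))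

theorem clm_ext_of_span {B V : Type*} [NormedAddCommGroup B] [NormedSpace ℂ B]
    [NormedAddCommGroup V] [NormedSpace ℂ V] {ι : Type*} {s : ι → B}
    (hs : (Submodule.span ℂ (Set.range s)).topologicalClosure = ⊤) {f g : B →L[ℂ] V}
    (h : ∀ i, f (s i) = g (s i)) : f = g := by
  refine ContinuousLinearMap.ext_on (s := Set.range s) ?_ ?_
  · rw [← Submodule.dense_iff_topologicalClosure_eq_top] at hs
    exact hs
  · rintro _ ⟨i, rfl⟩
    exact h i

theorem eq_of_forall_functional {A : Type*} [CStarAlgebra A] {a b : A}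
    (h : ∀ f : A →L[ℂ] ℂ, f a = f b) : a = b :=
  (SeparatingDual.eq_iff_forall_dual_eq (R := ℂ)).2 h

/-- The functional `a ↦ f (c * a)`. -/
def mulL {A : Type*} [CStarAlgebra A] (f : A →L[ℂ] ℂ) (c : A) : A →L[ℂ] ℂ :=
  f.comp (ContinuousLinearMap.mul ℂ A c)

/-- The functional `a ↦ f (a * c)`. -/
def mulR {A : Type*} [CStarAlgebra A] (f : A →L[ℂ] ℂ) (c : A) : A →L[ℂ] ℂ :=
  f.comp ((ContinuousLinearMap.mul ℂ A).flip c)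

@[simp] theorem mulL_apply {A : Type*} [CStarAlgebra A] (f : A →L[ℂ] ℂ) (c a : A) :
    mulL f c a = f (c * a) := rfl

@[simp] theorem mulR_apply {A : Type*} [CStarAlgebra A] (f : A →L[ℂ] ℂ) (c a : A) :
    mulR f c a = f (a * c) := rfl

/-- The map `a ↦ (T (a*))*`. -/
def conjMap {A V : Type*} [CStarAlgebra A] [CStarAlgebra V] (T : A →L[ℂ] V) : A →L[ℂ] V :=
  LinearMap.mkContinuous
    { toFun := fun a => star (T (star a))
      map_add' := fun a b => by simp
      map_smul' := fun c a => by simp } ‖T‖ fun a => by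
    simpa using T.le_opNorm (star a)

@[simp] theorem conjMap_apply {A V : Type*} [CStarAlgebra A] [CStarAlgebra V] (T : A →L[ℂ] V)
    (a : A) : conjMap T a = star (T (star a)) := rfl

/-- Cauchy–Schwarz for a positive functional, in the degenerate case. -/
theorem eq_zero_of_pos {B : Type*} [CStarAlgebra B] (Ψ : B →ₗ[ℂ] ℂ)
    (hΨ : ∀ X, 0 ≤ Ψ (star X * X)) {X : B} (hX : Ψ (star X * X) = 0) (Y : B) :
    Ψ (Y * X) = 0 := by
  set α := Ψ (Y * X) with hα
  set β := Ψ (star X * star Y) with hβ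
  set c := Ψ (Y * star Y) with hc
  have hexp : ∀ t : ℂ, 0 ≤ c + t * α + star t * β := fun t => by
    have := hΨ (star Y + t • X)
    rw [star_add, star_star, star_smul, add_mul, mul_add, mul_add, smul_mul_smul_comm] at this
    simp only [map_add, map_smul, hX, smul_eq_mul, mul_zero, add_zero, mul_smul_comm,
      smul_mul_assoc] at this
    rw [← hα, ← hβ, ← hc] at this
    exact this
  have hc0 : 0 ≤ c := by simpa using hexp 0
  obtain ⟨hcr, hci⟩ := Complex.nonneg_iff.1 hc0
  have hβα : β = star α := by
    have h1 := (Complex.nonneg_iff.1 (hexp 1)).2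
    have h2 := (Complex.nonneg_iff.1 (hexp Complex.I)).2
    apply Complex.ext <;> simp [← hci] at h1 h2 ⊢ <;> linarith
  by_contra hne
  have hpos : 0 < Complex.normSq α := Complex.normSq_pos.2 hne
  -- the value at this `t` is negative
  have h3 := (Complex.nonneg_iff.1 (hexp (-(((c.re + 1) / Complex.normSq α : ℝ) : ℂ) * star α))).1
  rw [hβα] at h3
  have h4 : -(((c.re + 1) / Complex.normSq α : ℝ) : ℂ) * star α * α = ((-(c.re + 1) : ℝ) : ℂ) := by
    have : star α * α = (Complex.normSq α : ℂ) := Complex.normSq_eq_conj_mul_self.symm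
    rw [mul_assoc, this, ← Complex.ofReal_neg, ← Complex.ofReal_mul]
    congr 1
    field_simp
  have h5 : star (-(((c.re + 1) / Complex.normSq α : ℝ) : ℂ) * star α) * star α =
      ((-(c.re + 1) : ℝ) : ℂ) := by
    rw [← star_mul', h4]; exact Complex.conj_ofReal _
  rw [h4, h5] at h3
  simp at h3
  linarith

theorem IsPos.star_eq {A : Type*} [CStarAlgebra A] {f : A →L[ℂ] ℂ} (hf : IsPos f) :
    conjMap f = f := by
  ext a
  rw [conjMap_apply]
  have h : ∀ t : ℂ, 0 ≤ f (star (1 + t • a) * (1 + t • a)) := fun t => hf _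
  have h0 := (Complex.nonneg_iff.1 (by simpa using hf 1)).2
  have ha := (Complex.nonneg_iff.1 (hf a)).2
  have h1 := (Complex.nonneg_iff.1 (h 1)).2
  have h2 := (Complex.nonneg_iff.1 (h Complex.I)).2
  simp only [star_add, star_one, star_smul, add_mul, mul_add, one_mul, mul_one, map_add,
    smul_mul_smul_comm, map_smul, smul_eq_mul] at h1 h2
  apply Complex.ext <;> simp [← h0, ← ha] at h1 h2 ⊢ <;> linarith

namespace SliceSystem

variable {A B : Type*} [CStarAlgebra A] [CStarAlgebra B] (Q : SliceSystem A B)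

/-- Interchanging the two legs of the tensor product. -/
def swap (hpos : ∀ (f g : A →L[ℂ] ℂ) (X : B), f (Q.sliceR g X) = g (Q.sliceL f X)) :
    SliceSystem A B where
  inl := Q.inr
  inr := Q.inl
  comul := Q.comul
  sliceR := Q.sliceL
  sliceL := Q.sliceR
  comm a b := (Q.comm b a).symm
  sliceR_mul f a b := by rw [← (Q.comm b a).eq, Q.sliceL_mul]
  sliceL_mul f a b := by rw [← (Q.comm b a).eq, Q.sliceR_mul]
  norm_sliceR_le := Q.norm_sliceL_le
  norm_sliceL_le := Q.norm_sliceR_le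
  dense := by
    rw [← Q.dense, ← (Equiv.prodComm A A).surjective.range_comp]
    congr 3
    ext p
    simp [(Q.comm p.1 p.2).eq]
  cancel_left := Q.cancel_right
  cancel_right := Q.cancel_left
  pos f g hf hg X := by rw [← hpos]; exact Q.pos g f hg hf X
  coassoc f g a := (Q.coassoc g f a).symm

/-- The comultiplication as a bounded linear map. -/
def comulL : A →L[ℂ] B :=
  LinearMap.mkContinuous Q.comul.toAlgHom.toLinearMap 1 fun a => by
    rw [one_mul]; exact NonUnitalStarAlgHom.norm_apply_le Q.comul a

@[simp] theorem comulL_apply (a : A) : Q.comulL a = Q.comul a := rfl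

theorem norm_comul_le (a : A) : ‖Q.comul a‖ ≤ ‖a‖ := NonUnitalStarAlgHom.norm_apply_le Q.comul a

theorem ext_dense {V : Type*} [NormedAddCommGroup V] [NormedSpace ℂ V] {f g : B →L[ℂ] V}
    (h : ∀ a b, f (Q.inl a * Q.inr b) = g (Q.inl a * Q.inr b)) : f = g :=
  clm_ext_of_span Q.dense fun p => h p.1 p.2

theorem ext_cancel_left {V : Type*} [NormedAddCommGroup V] [NormedSpace ℂ V] {f g : B →L[ℂ] V}
    (h : ∀ a b, f (Q.inl a * Q.comul b) = g (Q.inl a * Q.comul b)) : f = g :=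
  clm_ext_of_span Q.cancel_left fun p => h p.1 p.2

theorem apply_sliceR (f g : A →L[ℂ] ℂ) (X : B) : f (Q.sliceR g X) = g (Q.sliceL f X) := by
  have : f.comp (Q.sliceR g) = g.comp (Q.sliceL f) := Q.ext_dense fun a b => by
    simp [Q.sliceR_mul, Q.sliceL_mul, mul_comm]
  exact DFunLike.congr_fun this X

/-- The slice system of the opposite quantum group. -/
def op : SliceSystem A B := Q.swap Q.apply_sliceR

theorem sliceR_inl_mul (f : A →L[ℂ] ℂ) (c : A) (X : B) :
    Q.sliceR f (Q.inl c * X) = c * Q.sliceR f X := by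
  have : (Q.sliceR f).comp (ContinuousLinearMap.mul ℂ B (Q.inl c)) =
      (ContinuousLinearMap.mul ℂ A c).comp (Q.sliceR f) := Q.ext_dense fun a b => by
    simp [← mul_assoc, ← map_mul, Q.sliceR_mul]
  exact DFunLike.congr_fun this X

theorem sliceR_mul_inl (f : A →L[ℂ] ℂ) (c : A) (X : B) :
    Q.sliceR f (X * Q.inl c) = Q.sliceR f X * c := by
  have : (Q.sliceR f).comp ((ContinuousLinearMap.mul ℂ B).flip (Q.inl c)) =
      ((ContinuousLinearMap.mul ℂ A).flip c).comp (Q.sliceR f) := Q.ext_dense fun a b => by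
    simp [mul_assoc, ← (Q.comm c b).eq]
    simp [← mul_assoc, ← map_mul, Q.sliceR_mul]
  exact DFunLike.congr_fun this X

theorem sliceR_inr_mul (f : A →L[ℂ] ℂ) (c : A) (X : B) :
    Q.sliceR f (Q.inr c * X) = Q.sliceR (mulL f c) X := by
  have : (Q.sliceR f).comp (ContinuousLinearMap.mul ℂ B (Q.inr c)) =
      Q.sliceR (mulL f c) := Q.ext_dense fun a b => by
    simp only [ContinuousLinearMap.comp_apply, ContinuousLinearMap.mul_apply']
    rw [← mul_assoc, ← (Q.comm a c).eq, mul_assoc, ← map_mul, Q.sliceR_mul, Q.sliceR_mul]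
    rfl
  exact DFunLike.congr_fun this X

theorem sliceR_mul_inr (f : A →L[ℂ] ℂ) (c : A) (X : B) :
    Q.sliceR f (X * Q.inr c) = Q.sliceR (mulR f c) X := by
  have : (Q.sliceR f).comp ((ContinuousLinearMap.mul ℂ B).flip (Q.inr c)) =
      Q.sliceR (mulR f c) := Q.ext_dense fun a b => by
    simp only [ContinuousLinearMap.comp_apply, ContinuousLinearMap.mul_apply',
      ContinuousLinearMap.flip_apply]
    rw [mul_assoc, ← map_mul, Q.sliceR_mul, Q.sliceR_mul]
    rfl
  exact DFunLike.congr_fun this X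

theorem sliceL_inr_mul (f : A →L[ℂ] ℂ) (c : A) (X : B) :
    Q.sliceL f (Q.inr c * X) = c * Q.sliceL f X := Q.op.sliceR_inl_mul f c X

theorem sliceL_inl_mul (f : A →L[ℂ] ℂ) (c : A) (X : B) :
    Q.sliceL f (Q.inl c * X) = Q.sliceL (mulL f c) X := Q.op.sliceR_inr_mul f c X

theorem sliceR_inl (f : A →L[ℂ] ℂ) (c : A) : Q.sliceR f (Q.inl c) = f 1 • c := by
  simpa using Q.sliceR_mul f c 1

theorem sliceR_inr (f : A →L[ℂ] ℂ) (c : A) : Q.sliceR f (Q.inr c) = f c • 1 := by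
  simpa using Q.sliceR_mul f 1 c

theorem sliceR_star (f : A →L[ℂ] ℂ) (X : B) :
    Q.sliceR f (star X) = star (Q.sliceR (conjMap f) X) := by
  have : conjMap (Q.sliceR f) = Q.sliceR (conjMap f) := Q.ext_dense fun a b => by
    simp [Q.sliceR_mul, ← map_star, ← (Q.comm _ _).eq]
  rw [← this, conjMap_apply, star_star]

end SliceSystem

end

section

namespace SliceSystem

variable {A B : Type*} [CStarAlgebra A] [CStarAlgebra B] (Q : SliceSystem A B)

/-! ### Convolution of functionals and the Haar state -/

/-- The convolution `(φ ⊗ ψ) Δ` of two functionals. -/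
def conv (φ ψ : A →L[ℂ] ℂ) : A →L[ℂ] ℂ := φ.comp ((Q.sliceR ψ).comp Q.comulL)

theorem conv_apply (φ ψ : A →L[ℂ] ℂ) (a : A) : Q.conv φ ψ a = φ (Q.sliceR ψ (Q.comul a)) := rfl

theorem conv_apply' (φ ψ : A →L[ℂ] ℂ) (a : A) : Q.conv φ ψ a = ψ (Q.sliceL φ (Q.comul a)) :=
  Q.apply_sliceR φ ψ _

theorem op_conv (φ ψ : A →L[ℂ] ℂ) : Q.op.conv φ ψ = Q.conv ψ φ := by
  ext a
  rw [conv_apply']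
  rfl

theorem conv_assoc (φ ψ χ : A →L[ℂ] ℂ) : Q.conv (Q.conv φ ψ) χ = Q.conv φ (Q.conv ψ χ) := by
  ext a
  rw [conv_apply, conv_apply', Q.coassoc, conv_apply' Q φ, conv_apply]

theorem sliceR_comul_sliceR (φ ψ : A →L[ℂ] ℂ) (a : A) :
    Q.sliceR φ (Q.comul (Q.sliceR ψ (Q.comul a))) = Q.sliceR (Q.conv φ ψ) (Q.comul a) :=
  eq_of_forall_functional fun χ => by
    rw [← conv_apply, ← conv_apply, ← conv_apply, conv_assoc]

theorem norm_conv_le (φ ψ : A →L[ℂ] ℂ) : ‖Q.conv φ ψ‖ ≤ ‖φ‖ * ‖ψ‖ := by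
  refine ContinuousLinearMap.opNorm_le_bound _ (by positivity) fun a => ?_
  rw [conv_apply]
  calc _ ≤ ‖φ‖ * ‖Q.sliceR ψ (Q.comul a)‖ := φ.le_opNorm _
    _ ≤ ‖φ‖ * (‖ψ‖ * ‖a‖) := by
      gcongr
      exact (Q.norm_sliceR_le _ _).trans (by gcongr; exact Q.norm_comul_le a)
    _ = _ := by ring

theorem conv_one (φ ψ : A →L[ℂ] ℂ) : Q.conv φ ψ 1 = φ 1 * ψ 1 := by
  have : Q.comul 1 = Q.inl 1 * Q.inr 1 := by simp
  rw [conv_apply, this, Q.sliceR_mul]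
  simp [mul_comm]

theorem conv_pos {φ ψ : A →L[ℂ] ℂ} (hφ : IsPos φ) (hψ : IsPos ψ) : IsPos (Q.conv φ ψ) :=
  fun a => by
    rw [conv_apply, map_mul, map_star]
    exact Q.pos φ ψ hφ hψ _

/-- If a product functional `h ⊗ ω` vanishes on `X* X` and `ω` is faithful, then `h ⊗ id`
vanishes on all multiples of `X`. -/
theorem sliceL_mul_eq_zero {h ω : A →L[ℂ] ℂ} (hh : IsPos h) (hω : IsPos ω)
    (hfaith : ∀ a, ω (star a * a) = 0 → a = 0) {X : B}
    (hX : ω (Q.sliceL h (star X * X)) = 0) (Y : B) : Q.sliceL h (Y * X) = 0 := by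
  apply hfaith
  rw [← Q.sliceL_inr_mul, ← mul_assoc]
  refine eq_zero_of_pos (ω.comp (Q.sliceL h)).toLinearMap (fun X => ?_) hX _
  have := Q.pos h ω hh hω X
  rw [apply_sliceR] at this
  exact this

/-- Kawada–Itô–Woronowicz: a state fixed by a faithful state under convolution is invariant. -/
theorem sliceR_comul_of_conv_eq {h ω : A →L[ℂ] ℂ} (hh : IsPos h) (h1 : h 1 = 1) (hω : IsPos ω)
    (hω1 : ω 1 = 1) (hfaith : ∀ a, ω (star a * a) = 0 → a = 0)
    (hhω : Q.conv h ω = h) (hωh : Q.conv ω h = h) (a : A) :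
    Q.sliceR h (Q.comul a) = h a • 1 := by
  refine eq_of_forall_functional fun ρ => ?_
  rw [map_smul, smul_eq_mul, ← conv_apply, mul_comm]
  -- it suffices to compare `h ⊗ (ρ * h)` with `ρ 1 • (h ⊗ h)` on the dense set `(A ⊗ 1) Δ(A)`
  suffices hs : h.comp (Q.sliceR (Q.conv ρ h)) = ρ 1 • h.comp (Q.sliceR h) by
    have := DFunLike.congr_fun hs (Q.inr a)
    simpa [sliceR_inr, h1] using this
  refine Q.ext_cancel_left fun c a => ?_
  set b := Q.sliceR h (Q.comul a) with hb
  have hωb : Q.sliceR ω (Q.comul b) = b := by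
    rw [hb, sliceR_comul_sliceR, hωh]
  have hωb' : Q.sliceR ω (Q.comul (star b)) = star b := by
    rw [map_star, sliceR_star, hω.star_eq, hωb]
  set X := Q.comul b - Q.inl b with hX
  have hX0 : ω (Q.sliceL h (star X * X)) = 0 := by
    rw [← apply_sliceR]
    have : star X * X = Q.comul (star b * b) - Q.comul (star b) * Q.inl b -
        Q.inl (star b) * Q.comul b + Q.inl (star b * b) := by
      rw [hX, star_sub, map_mul, map_mul, map_star, map_star]
      noncomm_ring
    rw [this]
    simp only [map_add, map_sub, sliceR_mul_inl, sliceR_inl_mul, hωb, hωb', sliceR_inl, hω1,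
      one_smul]
    rw [← conv_apply, hhω]
    ring
  have hz := Q.sliceL_mul_eq_zero hh hω hfaith hX0 (Q.inl c)
  have hz' := congrArg ρ hz
  rw [map_zero, ← apply_sliceR, sliceR_inl_mul, hX, map_sub, sliceR_inl, mul_sub, map_sub,
    sub_eq_zero, hb, sliceR_comul_sliceR] at hz'
  simpa [sliceR_inl_mul] using hz'

/-- Existence of the Haar state, given a faithful state. -/
theorem exists_haar {ω : A →L[ℂ] ℂ} (hω : IsPos ω) (hω1 : ω 1 = 1) (hωn : ‖ω‖ ≤ 1)
    (hfaith : ∀ a, ω (star a * a) = 0 → a = 0) :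
    ∃ h : A →L[ℂ] ℂ, IsPos h ∧ h 1 = 1 ∧ (∀ a, Q.sliceR h (Q.comul a) = h a • 1) ∧
      ∀ a, Q.sliceL h (Q.comul a) = h a • 1 := by
  -- convolution powers and their Cesàro means
  let p : ℕ → (A →L[ℂ] ℂ) := fun n => (Q.conv ω)^[n] ω
  have hp0 : p 0 = ω := rfl
  have hps : ∀ n, p (n + 1) = Q.conv ω (p n) := fun n => Function.iterate_succ_apply' _ _ _
  have hps' : ∀ n, p (n + 1) = Q.conv (p n) ω := by
    intro n
    induction n with
    | zero => rw [hps, hp0]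
    | succ n ih => exact (hps _).trans (by rw [ih, ← conv_assoc, ← hps, ih])
  have hpn : ∀ n, ‖p n‖ ≤ 1 := by
    intro n
    induction n with
    | zero => exact hωn
    | succ n ih =>
      rw [hps]
      exact (Q.norm_conv_le _ _).trans (mul_le_one₀ hωn (norm_nonneg _) ih)
  have hp1 : ∀ n, p n 1 = 1 := by
    intro n
    induction n with
    | zero => exact hω1
    | succ n ih => rw [hps, conv_one, ih, hω1, one_mul]
  have hpp : ∀ n, IsPos (p n) := by
    intro n
    induction n with
    | zero => exact hω
    | succ n ih => rw [hps]; exact Q.conv_pos hω ih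
  let c : ℕ → (A →L[ℂ] ℂ) := fun n => ((n + 1 : ℝ)⁻¹ : ℂ) • ∑ k ∈ Finset.range (n + 1), p k
  have hca : ∀ n a, c n a = ((n + 1 : ℝ)⁻¹ : ℂ) * ∑ k ∈ Finset.range (n + 1), p k a := fun n a => by
    simp [c]
  have hcn : ∀ n, ‖c n‖ ≤ 1 := fun n => by
    have hs : ‖∑ k ∈ Finset.range (n + 1), p k‖ ≤ (n + 1 : ℝ) :=
      (norm_sum_le_of_le _ fun k _ => hpn k).trans (by simp)
    have hn : (0 : ℝ) < n + 1 := by positivity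
    rw [norm_smul, norm_inv, Complex.norm_real, Real.norm_of_nonneg hn.le]
    exact (inv_mul_le_one₀ hn).2 hs
  -- a weak* limit point of the means
  let l : Ultrafilter ℕ := hyperfilter ℕ
  obtain ⟨h', -, hlim⟩ := (WeakDual.isCompact_closedBall (𝕜 := ℂ) (E := A) 0 1).ultrafilter_le_nhds
    (l.map fun n => StrongDual.toWeakDual (c n)) (by
      simp only [le_principal_iff, Ultrafilter.mem_coe, Ultrafilter.mem_map]
      refine univ_mem' fun n => ?_
      simpa using hcn n)
  let h : A →L[ℂ] ℂ := WeakDual.toStrongDual h'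
  have hl : (l : Filter ℕ) ≤ atTop := by
    rw [← Nat.cofinite_eq_atTop]; exact hyperfilter_le_cofinite
  have hc : ∀ a, Tendsto (fun n => c n a) l (𝓝 (h a)) := fun a =>
    ((WeakDual.eval_continuous a).tendsto h').comp hlim
  have hhp : IsPos h := fun a => by
    refine ge_of_tendsto (hc (star a * a)) (Eventually.of_forall fun n => ?_)
    rw [hca]
    refine mul_nonneg ?_ (Finset.sum_nonneg fun k _ => hpp k a)
    have : (0 : ℝ) ≤ (n + 1 : ℝ)⁻¹ := by positivity
    exact_mod_cast this
  have hh1 : h 1 = 1 := by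
    refine tendsto_nhds_unique (hc 1) (tendsto_const_nhds.congr fun n => ?_)
    rw [hca, Finset.sum_congr rfl fun k _ => hp1 k]
    have : ((n : ℂ) + 1) ≠ 0 := Nat.cast_add_one_ne_zero n
    simp [this]
  -- convolving a mean with `ω` changes it by `O(1/n)`
  have hdiff : ∀ a, Tendsto (fun n : ℕ => ((n + 1 : ℝ)⁻¹ : ℂ) * (p (n + 1) a - p 0 a)) l (𝓝 0) := by
    intro a
    have h1 : Tendsto (fun n : ℕ => (n + 1 : ℝ)⁻¹ * (2 * ‖a‖)) l (𝓝 0) := by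
      have := (tendsto_one_div_add_atTop_nhds_zero_nat (𝕜 := ℝ)).mul_const (2 * ‖a‖)
      simp only [one_div, zero_mul] at this
      exact this.mono_left hl
    refine squeeze_zero_norm (fun n => ?_) h1
    have hn : (0 : ℝ) < n + 1 := by positivity
    rw [norm_mul, norm_inv, Complex.norm_real, Real.norm_of_nonneg hn.le]
    gcongr
    have := norm_sub_le (p (n + 1) a) (p 0 a)
    have h2 := (p (n + 1)).le_of_opNorm_le (hpn _) a
    have h3 := (p 0).le_of_opNorm_le (hpn _) a
    linarith
  have hcω : ∀ n a, Q.conv ω (c n) a = c n a + ((n + 1 : ℝ)⁻¹ : ℂ) * (p (n + 1) a - p 0 a) := by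
    intro n a
    rw [conv_apply', hca, hca, ← mul_add, ← Finset.sum_range_sub (fun k => p k a),
      ← Finset.sum_add_distrib]
    congr 1
    refine Finset.sum_congr rfl fun k _ => ?_
    rw [hps, conv_apply']
    ring
  have hcω' : ∀ n a, Q.conv (c n) ω a = c n a + ((n + 1 : ℝ)⁻¹ : ℂ) * (p (n + 1) a - p 0 a) := by
    intro n a
    rw [conv_apply, hca, hca, ← mul_add, ← Finset.sum_range_sub (fun k => p k a),
      ← Finset.sum_add_distrib]
    congr 1
    refine Finset.sum_congr rfl fun k _ => ?_
    rw [hps', conv_apply]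
    ring
  have hωh : Q.conv ω h = h := by
    ext a
    have h1 := hc (Q.sliceL ω (Q.comul a))
    simp_rw [← conv_apply', hcω] at h1
    simpa using tendsto_nhds_unique h1 ((hc a).add (hdiff a))
  have hhω : Q.conv h ω = h := by
    ext a
    have h1 := hc (Q.sliceR ω (Q.comul a))
    simp_rw [← conv_apply, hcω'] at h1
    simpa using tendsto_nhds_unique h1 ((hc a).add (hdiff a))
  exact ⟨h, hhp, hh1, Q.sliceR_comul_of_conv_eq hhp hh1 hω hω1 hfaith hhω hωh,
    Q.op.sliceR_comul_of_conv_eq hhp hh1 hω hω1 hfaith (by rw [op_conv, hωh])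
      (by rw [op_conv, hhω])⟩

end SliceSystem

end

section

namespace SliceSystem

variable {A B : Type*} [CStarAlgebra A] [CStarAlgebra B] (Q : SliceSystem A B)

/-! ### The null space of the Haar state -/

/-- `h` is the Haar state, and there is some faithful state `ω` on the algebra. The latter only
serves to detect zero elements through positive functionals. -/
structure IsHaar (h : A →L[ℂ] ℂ) : Prop where
  pos : IsPos h
  one : h 1 = 1
  right : ∀ a, Q.sliceR h (Q.comul a) = h a • 1
  left : ∀ a, Q.sliceL h (Q.comul a) = h a • 1
  exists_faithful : ∃ ω : A →L[ℂ] ℂ, IsPos ω ∧ ∀ a, ω (star a * a) = 0 → a = 0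

variable {Q} {h : A →L[ℂ] ℂ}

theorem IsHaar.op (hh : Q.IsHaar h) : Q.op.IsHaar h :=
  ⟨hh.pos, hh.one, hh.left, hh.right, hh.exists_faithful⟩

/-- The left kernel of a functional. -/
def nullSpace (h : A →L[ℂ] ℂ) : Set A := {a | ∀ b, h (b * a) = 0}

theorem mul_mem_nullSpace {a : A} (ha : a ∈ nullSpace h) (c : A) : c * a ∈ nullSpace h :=
  fun b => by
  rw [← mul_assoc]; exact ha _

theorem IsHaar.sliceR_mem_nullSpace (hh : Q.IsHaar h) {a : A} (ha : a ∈ nullSpace h)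
    (ψ : A →L[ℂ] ℂ) : Q.sliceR ψ (Q.comul a) ∈ nullSpace h := by
  obtain ⟨ω, hω, hfaith⟩ := hh.exists_faithful
  intro b
  rw [← sliceR_inl_mul, apply_sliceR, Q.sliceL_mul_eq_zero hh.pos hω hfaith, map_zero]
  rw [← map_star, ← map_mul, hh.left, ha]
  simp

theorem IsHaar.sliceL_mem_nullSpace (hh : Q.IsHaar h) {a : A} (ha : a ∈ nullSpace h)
    (ψ : A →L[ℂ] ℂ) : Q.sliceL ψ (Q.comul a) ∈ nullSpace h :=
  hh.op.sliceR_mem_nullSpace ha ψ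

theorem IsHaar.star_sliceR_mem_nullSpace (hh : Q.IsHaar h) {a : A} (ha : star a ∈ nullSpace h)
    (ψ : A →L[ℂ] ℂ) : star (Q.sliceR ψ (Q.comul a)) ∈ nullSpace h := by
  have := hh.sliceR_mem_nullSpace ha (conjMap ψ)
  rw [map_star, sliceR_star] at this
  convert this using 4
  ext
  simp

theorem IsHaar.star_sliceL_mem_nullSpace (hh : Q.IsHaar h) {a : A} (ha : star a ∈ nullSpace h)
    (ψ : A →L[ℂ] ℂ) : star (Q.sliceL ψ (Q.comul a)) ∈ nullSpace h :=
  hh.op.star_sliceR_mem_nullSpace ha ψ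

/-- Convolution by all the functionals `h(c ·)` is injective, because of the density of
`(1 ⊗ A) Δ(A)`. -/
theorem IsHaar.eq_zero_of_conv_mulL (hh : Q.IsHaar h) {φ : A →L[ℂ] ℂ}
    (hφ : ∀ c, Q.conv φ (mulL h c) = 0) : φ = 0 := by
  have : φ.comp (Q.sliceR h) = 0 := Q.op.ext_cancel_left fun c a => by
    have := DFunLike.congr_fun (hφ c) a
    rw [conv_apply, ← sliceR_inr_mul] at this
    exact this
  ext a
  simpa [sliceR_inl, hh.one] using DFunLike.congr_fun this (Q.inl a)

theorem conv_conjMap (φ ψ : A →L[ℂ] ℂ) :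
    Q.conv (conjMap φ) (conjMap ψ) = conjMap (Q.conv φ ψ) := by
  ext a
  rw [conv_apply, conjMap_apply, ← sliceR_star, ← map_star Q.comul, conjMap_apply, conv_apply]

theorem IsHaar.eq_zero_of_conv_mulR (hh : Q.IsHaar h) {φ : A →L[ℂ] ℂ}
    (hφ : ∀ c, Q.conv φ (mulR h c) = 0) : φ = 0 := by
  have h1 : conjMap φ = 0 := hh.eq_zero_of_conv_mulL fun c => by
    have : mulL h c = conjMap (mulR h (star c)) := by
      ext a
      have := DFunLike.congr_fun hh.pos.star_eq (c * a)
      simp only [conjMap_apply, mulL_apply, mulR_apply, star_mul] at this ⊢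
      rw [this]
    rw [this, conv_conjMap, hφ]
    ext; simp
  ext a
  simpa using DFunLike.congr_fun h1 (star a)

/-- If all functionals vanishing on the null space and on its adjoint factor through one linear map
`C` of finite rank, then the algebra has finite dimension: those functionals form a space of finite
dimension, which is large enough for all functionals to act faithfully on it by convolution. -/
theorem IsHaar.finiteDimensional (hh : Q.IsHaar h) (C : A →ₗ[ℂ] A)
    [FiniteDimensional ℂ (LinearMap.range C)]
    (hC : ∀ i : A →L[ℂ] ℂ, (∀ a ∈ nullSpace h, i a = 0) → (∀ a, star a ∈ nullSpace h → i a = 0) →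
      ∀ a, i a = i (C a)) : FiniteDimensional ℂ A := by
  let I : Submodule ℂ (A →L[ℂ] ℂ) :=
    { carrier := {i | (∀ a ∈ nullSpace h, i a = 0) ∧ ∀ a, star a ∈ nullSpace h → i a = 0}
      zero_mem' := by simp
      add_mem' := fun {i j} hi hj =>
        ⟨fun a ha => by simp [hi.1 a ha, hj.1 a ha], fun a ha => by simp [hi.2 a ha, hj.2 a ha]⟩
      smul_mem' := fun c i hi =>
        ⟨fun a ha => by simp [hi.1 a ha], fun a ha => by simp [hi.2 a ha]⟩ }
  have hIC : ∀ i ∈ I, ∀ a, i a = i (C a) := fun i hi => hC i hi.1 hi.2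
  have : FiniteDimensional ℂ I := by
    let r : I →ₗ[ℂ] (LinearMap.range C →ₗ[ℂ] ℂ) :=
      { toFun := fun i => (i : A →L[ℂ] ℂ).toLinearMap ∘ₗ (LinearMap.range C).subtype
        map_add' := fun _ _ => rfl
        map_smul' := fun _ _ => rfl }
    refine Module.Finite.of_injective r fun i j hij => Subtype.ext ?_
    ext a
    rw [hIC i i.2, hIC j j.2]
    exact DFunLike.congr_fun hij ⟨C a, LinearMap.mem_range_self _ _⟩
  -- functionals act on `I` by convolution; only the values on the range of `C` are recorded, so
  -- that the space of such actions has finite dimension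
  let T : (A →L[ℂ] ℂ) →ₗ[ℂ] I →ₗ[ℂ] (LinearMap.range C →ₗ[ℂ] ℂ) :=
    LinearMap.mk₂ ℂ (fun φ i => (Q.conv φ i).toLinearMap ∘ₗ (LinearMap.range C).subtype)
      (fun _ _ _ => rfl) (fun _ _ _ => rfl)
      (fun φ i j => by ext r; simp [conv_apply']) (fun c φ i => by ext r; simp [conv_apply'])
  have hinj : Function.Injective T := by
    rw [injective_iff_map_eq_zero]
    intro φ hφ
    have h1 : ∀ i ∈ I, Q.conv φ i ∈ I → Q.conv φ i = 0 := fun i hi hi' => by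
      ext a
      rw [hIC _ hi' a]
      exact DFunLike.congr_fun (DFunLike.congr_fun hφ ⟨i, hi⟩) ⟨C a, LinearMap.mem_range_self _ _⟩
    -- `ψ ⋆ h(· c) ⋆ h(d ·)` vanishes on the null space because of its last factor, and on the
    -- adjoint of the null space because of the middle one
    have hI : ∀ (ψ : A →L[ℂ] ℂ) (c d : A), Q.conv (Q.conv ψ (mulR h c)) (mulL h d) ∈ I := by
      refine fun ψ c d => ⟨fun a ha => ?_, fun a ha => ?_⟩
      · rw [conv_apply']
        exact hh.sliceL_mem_nullSpace ha _ d
      · have h2 := hh.star_sliceL_mem_nullSpace (hh.star_sliceR_mem_nullSpace ha (mulL h d)) ψ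
        have h3 := DFunLike.congr_fun hh.pos.star_eq
          (star c * star (Q.sliceL ψ (Q.comul (Q.sliceR (mulL h d) (Q.comul a)))))
        rw [conv_apply, conv_apply', mulR_apply]
        rw [h2, conjMap_apply, star_eq_zero, star_mul, star_star, star_star] at h3
        exact h3
    refine hh.eq_zero_of_conv_mulR fun c => hh.eq_zero_of_conv_mulL fun d => ?_
    have hi : Q.conv (mulR h c) (mulL h d) ∈ I := by
      refine ⟨fun a ha => ?_, fun a ha => ?_⟩
      · rw [conv_apply']
        exact hh.sliceL_mem_nullSpace ha _ d
      · have h2 := hh.star_sliceR_mem_nullSpace ha (mulL h d)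
        have h3 := DFunLike.congr_fun hh.pos.star_eq
          (star c * star (Q.sliceR (mulL h d) (Q.comul a)))
        rw [conv_apply, mulR_apply]
        rw [h2, conjMap_apply, star_eq_zero, star_mul, star_star, star_star] at h3
        exact h3
    rw [conv_assoc]
    exact h1 _ hi (by rw [← conv_assoc]; exact hI _ _ _)
  have h1 : FiniteDimensional ℂ (LinearMap.range C →ₗ[ℂ] ℂ) := inferInstance
  have h0 : Module.Free ℂ I := Module.Free.of_divisionRing ℂ I
  have h2 : Module.Finite ℂ (I →ₗ[ℂ] (LinearMap.range C →ₗ[ℂ] ℂ)) := by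
    exact Module.Finite.linearMap (R := ℂ) (S := ℂ) (M := I) (N := LinearMap.range C →ₗ[ℂ] ℂ)
  have : FiniteDimensional ℂ (A →L[ℂ] ℂ) := Module.Finite.of_injective T hinj
  -- the algebra embeds in the dual of its space of functionals
  let ev : A →ₗ[ℂ] ((A →L[ℂ] ℂ) →ₗ[ℂ] ℂ) :=
    LinearMap.mk₂ ℂ (fun a φ => φ a) (fun _ _ _ => map_add _ _ _) (fun _ _ _ => map_smul _ _ _)
      (fun _ _ _ => rfl) (fun _ _ _ => rfl)
  exact Module.Finite.of_injective ev fun a b hab =>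
    eq_of_forall_functional fun φ => DFunLike.congr_fun hab φ

end SliceSystem

end

section

namespace SliceSystem

variable {A B : Type*} [CStarAlgebra A] [CStarAlgebra B]

/-! ### Modular property of matrix coefficients -/

/-- `w` is the matrix, in an orthonormal eigenbasis of the modular operator, of an irreducible
unitary representation; `r i > 0` are the eigenvalues of the modular operator. The fields
`weighted_col` and `weighted_row` say that `(r i / r j) (w i j)*` are the entries of the
inverse of the transpose of `w`. -/
structure IsDiagRep (Q : SliceSystem A B) {n : ℕ} (w : Matrix (Fin n) (Fin n) A)
    (r : Fin n → ℝ) : Prop where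
  r_pos : ∀ i, 0 < r i
  comul_apply : ∀ i j, Q.comul (w i j) = ∑ k, Q.inl (w i k) * Q.inr (w k j)
  row : ∀ i j, ∑ k, w i k * star (w j k) = if i = j then 1 else 0
  col : ∀ i j, ∑ k, star (w k i) * w k j = if i = j then 1 else 0
  weighted_col : ∀ i j, ∑ k, (r k : ℂ) • (w k i * star (w k j)) = if i = j then (r i : ℂ) • 1 else 0
  weighted_row : ∀ i j, ∑ k, (r k : ℂ)⁻¹ • (star (w i k) * w j k) =
    if i = j then (r i : ℂ)⁻¹ • 1 else 0
  schur : ∀ T : Matrix (Fin n) (Fin n) ℂ,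
    (∀ i j, ∑ k, T i k • w k j = ∑ k, T k j • w i k) → ∃ c : ℂ, T = c • 1

variable {Q : SliceSystem A B} {h : A →L[ℂ] ℂ} {n : ℕ} {w : Matrix (Fin n) (Fin n) A}
  {r : Fin n → ℝ}

theorem IsDiagRep.sum_ne_zero (hw : Q.IsDiagRep w r) (p : Fin n) : (∑ k, (r k : ℂ)) ≠ 0 := by
  have : 0 < ∑ k, r k := Finset.sum_pos (fun i _ => hw.r_pos i) ⟨p, Finset.mem_univ _⟩
  exact_mod_cast this.ne'

theorem IsDiagRep.sum_inv_ne_zero (hw : Q.IsDiagRep w r) (p : Fin n) :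
    (∑ k, (r k : ℂ)⁻¹) ≠ 0 := by
  have : 0 < ∑ k, (r k)⁻¹ :=
    Finset.sum_pos (fun i _ => inv_pos.2 (hw.r_pos i)) ⟨p, Finset.mem_univ _⟩
  exact_mod_cast this.ne'

/-- Orthogonality relations. By invariance of `h` the matrix `h(w p i (w k i)*)`, for fixed `i`,
intertwines `w` with itself, so it is scalar by Schur's lemma; the scalar is found by summing with
the weights of `weighted_col`. -/
theorem IsDiagRep.haar_mul_star (hh : Q.IsHaar h) (hw : Q.IsDiagRep w r) (p k i : Fin n) :
    h (w p i * star (w k i)) = if p = k then (r i : ℂ) / ∑ l, (r l : ℂ) else 0 := by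
  set T : Matrix (Fin n) (Fin n) ℂ := fun p k => h (w p i * star (w k i)) with hT
  have h1 : ∀ p k, ∑ s, ∑ t, T s t • (w p s * star (w k t)) = T p k • 1 := fun p k => by
    rw [hT, ← hh.right, map_mul, map_star, hw.comul_apply, hw.comul_apply, star_sum,
      Finset.sum_mul_sum, map_sum]
    refine Finset.sum_congr rfl fun s _ => ?_
    rw [map_sum]
    refine Finset.sum_congr rfl fun t _ => ?_
    rw [star_mul, ← map_star, ← map_star, mul_assoc, ← mul_assoc (Q.inr _), ← map_mul Q.inr,
      ← (Q.comm _ _).eq, ← mul_assoc, ← map_mul, sliceR_mul]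
  obtain ⟨c, hc⟩ := hw.schur T fun a b => by
    calc ∑ k, T a k • w k b = ∑ k, ∑ s, ∑ t, T s t • (w a s * star (w k t) * w k b) := by
          refine Finset.sum_congr rfl fun k _ => ?_
          rw [← one_mul (w k b), ← smul_mul_assoc, ← h1, Finset.sum_mul]
          refine Finset.sum_congr rfl fun s _ => ?_
          rw [Finset.sum_mul, one_mul]
          exact Finset.sum_congr rfl fun t _ => by rw [smul_mul_assoc]
      _ = ∑ s, ∑ t, T s t • (w a s * ∑ k, star (w k t) * w k b) := by
          rw [Finset.sum_comm]
          refine Finset.sum_congr rfl fun s _ => ?_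
          rw [Finset.sum_comm]
          refine Finset.sum_congr rfl fun t _ => ?_
          rw [Finset.mul_sum, Finset.smul_sum]
          exact Finset.sum_congr rfl fun k _ => by rw [mul_assoc]
      _ = _ := by
          refine Finset.sum_congr rfl fun s _ => ?_
          simp [hw.col]
  have hTc : ∀ p k, h (w p i * star (w k i)) = if p = k then c else 0 := fun p k => by
    have := congrFun (congrFun hc p) k
    rw [hT] at this
    simpa [Matrix.one_apply] using this
  rw [hTc]
  split_ifs with hpk
  · rw [eq_div_iff (hw.sum_ne_zero p)]
    have h2 := congrArg h (hw.weighted_col i i)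
    rw [map_sum] at h2
    simp only [map_smul, hTc, if_true, hh.one, smul_eq_mul, mul_one] at h2
    rw [← h2, Finset.mul_sum]
    exact Finset.sum_congr rfl fun _ _ => mul_comm _ _
  · rfl

/-- Orthogonality relations, in the other order. The argument is that of `haar_mul_star`, with the
weights of `weighted_row`. -/
theorem IsDiagRep.haar_star_mul (hh : Q.IsHaar h) (hw : Q.IsDiagRep w r) (k i q : Fin n) :
    h (star (w k i) * w k q) = if i = q then (r k : ℂ)⁻¹ / ∑ l, (r l : ℂ)⁻¹ else 0 := by
  set T : Matrix (Fin n) (Fin n) ℂ := fun i q => h (star (w k i) * w k q) with hT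
  have h1 : ∀ i q, ∑ s, ∑ t, T s t • (star (w s i) * w t q) = T i q • 1 := fun i q => by
    rw [hT, ← hh.left, map_mul, map_star, hw.comul_apply, hw.comul_apply, star_sum,
      Finset.sum_mul_sum, map_sum]
    refine Finset.sum_congr rfl fun s _ => ?_
    rw [map_sum]
    refine Finset.sum_congr rfl fun t _ => ?_
    rw [star_mul, ← map_star, ← map_star, ← (Q.comm _ _).eq, mul_assoc, ← mul_assoc (Q.inr _),
      ← (Q.comm _ _).eq, mul_assoc, ← map_mul, ← mul_assoc, ← map_mul, sliceL_mul]
  obtain ⟨c, hc⟩ := hw.schur T fun a b => by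
    symm
    calc ∑ k, T k b • w a k = ∑ k, ∑ s, ∑ t, T s t • (w a k * (star (w s k) * w t b)) := by
          refine Finset.sum_congr rfl fun k _ => ?_
          rw [← mul_one (w a k), ← mul_smul_comm, ← h1, Finset.mul_sum]
          refine Finset.sum_congr rfl fun s _ => ?_
          rw [Finset.mul_sum, mul_one]
          exact Finset.sum_congr rfl fun t _ => by rw [mul_smul_comm]
      _ = ∑ s, ∑ t, T s t • ((∑ k, w a k * star (w s k)) * w t b) := by
          rw [Finset.sum_comm]
          refine Finset.sum_congr rfl fun s _ => ?_
          rw [Finset.sum_comm]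
          refine Finset.sum_congr rfl fun t _ => ?_
          rw [Finset.sum_mul, Finset.smul_sum]
          exact Finset.sum_congr rfl fun k _ => by rw [mul_assoc]
      _ = _ := by
          rw [Finset.sum_comm]
          refine Finset.sum_congr rfl fun s _ => ?_
          simp [hw.row]
  have hTc : ∀ i q, h (star (w k i) * w k q) = if i = q then c else 0 := fun p k => by
    have := congrFun (congrFun hc p) k
    rw [hT] at this
    simpa [Matrix.one_apply] using this
  rw [hTc]
  split_ifs with hpk
  · rw [eq_div_iff (hw.sum_inv_ne_zero k)]
    have h2 := congrArg h (hw.weighted_row k k)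
    rw [map_sum] at h2
    simp only [map_smul, hTc, if_true, hh.one, smul_eq_mul, mul_one] at h2
    rw [← h2, Finset.mul_sum]
    exact Finset.sum_congr rfl fun _ _ => mul_comm _ _
  · rfl

/-- `(id ⊗ h)(Δ(b)(1 ⊗ w i j))` in terms of the numbers `h(b w k j)`. -/
theorem IsDiagRep.smul_sliceR (hh : Q.IsHaar h) (hw : Q.IsDiagRep w r) (b : A) (i j : Fin n) :
    (r i : ℂ) • Q.sliceR (mulR h (w i j)) (Q.comul b) =
      ∑ k, ((r k : ℂ) * h (b * w k j)) • star (w k i) := by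
  have h1 : ∀ k, ∑ l, Q.sliceR (mulR h (w l j)) (Q.comul b) * w k l = h (b * w k j) • 1 :=
    fun k => by
      rw [← hh.right, map_mul, hw.comul_apply, Finset.mul_sum, map_sum]
      refine Finset.sum_congr rfl fun l _ => ?_
      rw [← mul_assoc, sliceR_mul_inr, sliceR_mul_inl]
  symm
  calc ∑ k, ((r k : ℂ) * h (b * w k j)) • star (w k i)
      = ∑ k, ∑ l, Q.sliceR (mulR h (w l j)) (Q.comul b) *
          ((r k : ℂ) • (w k l * star (w k i))) := by
        refine Finset.sum_congr rfl fun k _ => ?_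
        rw [mul_smul, ← one_mul (star (w k i)), ← smul_mul_assoc (h _), ← h1, Finset.sum_mul,
          Finset.smul_sum, one_mul]
        exact Finset.sum_congr rfl fun l _ => by rw [mul_smul_comm, mul_assoc]
    _ = ∑ l, Q.sliceR (mulR h (w l j)) (Q.comul b) *
          ∑ k, (r k : ℂ) • (w k l * star (w k i)) := by
        rw [Finset.sum_comm]
        exact Finset.sum_congr rfl fun l _ => by rw [Finset.mul_sum]
    _ = _ := by simp [hw.weighted_col, -Complex.coe_smul]

/-- `(h ⊗ id)((w p i ⊗ 1) Δ(b))` in terms of the numbers `h(w p k b)`. -/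
theorem IsDiagRep.smul_sliceL (hh : Q.IsHaar h) (hw : Q.IsDiagRep w r) (b : A) (p i : Fin n) :
    (r i : ℂ)⁻¹ • Q.sliceL (mulL h (w p i)) (Q.comul b) =
      ∑ k, ((r k : ℂ)⁻¹ * h (w p k * b)) • star (w i k) := by
  have h1 : ∀ k, ∑ l, w l k * Q.sliceL (mulL h (w p l)) (Q.comul b) = h (w p k * b) • 1 :=
    fun k => by
      rw [← hh.left, map_mul, hw.comul_apply, Finset.sum_mul, map_sum]
      refine Finset.sum_congr rfl fun l _ => ?_
      rw [(Q.comm _ _).eq, mul_assoc, sliceL_inr_mul, sliceL_inl_mul]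
  symm
  calc ∑ k, ((r k : ℂ)⁻¹ * h (w p k * b)) • star (w i k)
      = ∑ k, ∑ l, ((r k : ℂ)⁻¹ • (star (w i k) * w l k)) *
          Q.sliceL (mulL h (w p l)) (Q.comul b) := by
        refine Finset.sum_congr rfl fun k _ => ?_
        rw [mul_smul, ← mul_one (star (w i k)), ← mul_smul_comm (h _), ← h1, Finset.mul_sum,
          Finset.smul_sum, mul_one]
        exact Finset.sum_congr rfl fun l _ => by rw [smul_mul_assoc, mul_assoc]
    _ = ∑ l, (∑ k, (r k : ℂ)⁻¹ • (star (w i k) * w l k)) *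
          Q.sliceL (mulL h (w p l)) (Q.comul b) := by
        rw [Finset.sum_comm]
        exact Finset.sum_congr rfl fun l _ => by rw [Finset.sum_mul]
    _ = _ := by simp [hw.weighted_row]

/-- The modular property of the Haar state on matrix coefficients. Both sides are obtained from
`(h ⊗ h)((w p j ⊗ 1) Δ(b) (1 ⊗ w j j))`, by slicing either leg first. -/
theorem IsDiagRep.haar_mul (hh : Q.IsHaar h) (hw : Q.IsDiagRep w r) (p j : Fin n) (b : A) :
    h (w p j * b) = ((∑ k, (r k)⁻¹) / (∑ k, r k) * (r p * r j) : ℝ) * h (b * w p j) := by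
  have hrj : (r j : ℂ) ≠ 0 := by exact_mod_cast (hw.r_pos j).ne'
  have hS := hw.sum_ne_zero p
  have hS' := hw.sum_inv_ne_zero p
  set M := Q.conv (mulL h (w p j)) (mulR h (w j j)) b with hM
  -- slicing the second leg first
  have e1 : (r j : ℂ) * M = r p * h (b * w p j) * (r j / ∑ l, (r l : ℂ)) := by
    rw [hM, conv_apply, ← smul_eq_mul, ← map_smul, hw.smul_sliceR hh, map_sum]
    simp only [map_smul, mulL_apply, hw.haar_mul_star hh, smul_eq_mul, mul_ite, mul_zero,
      Finset.sum_ite_eq, Finset.mem_univ, if_true]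
  -- slicing the first leg first
  have e2 : (r j : ℂ)⁻¹ * M = (r j : ℂ)⁻¹ * h (w p j * b) *
      ((r j : ℂ)⁻¹ / ∑ l, (r l : ℂ)⁻¹) := by
    rw [hM, conv_apply', ← smul_eq_mul, ← map_smul, hw.smul_sliceL hh, map_sum]
    simp only [map_smul, mulR_apply, hw.haar_star_mul hh, smul_eq_mul, mul_ite, mul_zero,
      Finset.sum_ite_eq', Finset.mem_univ, if_true]
  have e3 : M = r p * h (b * w p j) / ∑ l, (r l : ℂ) := by
    apply mul_left_cancel₀ hrj
    rw [e1]; ring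
  have e4 : M = h (w p j * b) * (r j : ℂ)⁻¹ / ∑ l, (r l : ℂ)⁻¹ := by
    apply mul_left_cancel₀ (inv_ne_zero hrj)
    rw [e2]; ring
  rw [e3] at e4
  push_cast
  set S := ∑ l, (r l : ℂ)
  set S' := ∑ l, (r l : ℂ)⁻¹
  field_simp at e4 ⊢
  linear_combination -e4

end SliceSystem

end

section

/-! ### Slice maps of a compact quantum group -/

theorem norm_le_of_norm_inner_le {E : Type*} [NormedAddCommGroup E] [InnerProductSpace ℂ E]
    (T : E →L[ℂ] E) {C : ℝ} (hC : 0 ≤ C) (h : ∀ x y, ‖inner ℂ x (T y)‖ ≤ C * ‖x‖ * ‖y‖) :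
    ‖T‖ ≤ C := by
  refine T.opNorm_le_bound hC fun y => ?_
  rcases eq_or_ne (T y) 0 with h0 | h0
  · rw [h0, norm_zero]; positivity
  · have := h (T y) y
    rw [inner_self_eq_norm_sq_to_K] at this
    have hp : 0 < ‖T y‖ := norm_pos_iff.mpr h0
    simp only [norm_pow, RCLike.norm_ofReal, abs_norm] at this
    nlinarith

variable {A : Type*} [CStarAlgebra A] {H : Type*} [NormedAddCommGroup H]
  [InnerProductSpace ℂ H]

theorem norm_pureTensor (ξ η : H) : ‖pureTensor ξ η‖ = ‖ξ‖ * ‖η‖ := by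
  rw [pureTensor, LinearIsometry.norm_map, TensorProduct.norm_tmul]

theorem inner_pureTensor {K : Type*} [NormedAddCommGroup K] [InnerProductSpace ℂ K]
    (ξ : H) (η : K) (ξ' : H) (η' : K) :
    inner ℂ (pureTensor ξ η) (pureTensor ξ' η') = inner ℂ ξ ξ' * inner ℂ η η' := by
  rw [pureTensor, pureTensor, LinearIsometry.inner_map_map, TensorProduct.inner_tmul]

variable [CompleteSpace H]

theorem tensorRep_mul (π : A →⋆ₐ[ℂ] (H →L[ℂ] H)) (x y : A ⊗[ℂ] A) :
    tensorRep π π x * tensorRep π π y = tensorRep π π (x * y) := by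
  induction x using TensorProduct.induction_on with
  | zero => simp
  | add x x' hx hx' => rw [map_add, add_mul, add_mul, map_add, hx, hx']
  | tmul a b =>
    induction y using TensorProduct.induction_on with
    | zero => simp
    | add x x' hx hx' => rw [map_add, mul_add, mul_add, map_add, hx, hx']
    | tmul c d =>
      rw [tensorRep_tmul, tensorRep_tmul, opTensor_mul, Algebra.TensorProduct.tmul_mul_tmul,
        tensorRep_tmul, map_mul, map_mul]

theorem star_tensorRep_mem (π : A →⋆ₐ[ℂ] (H →L[ℂ] H)) (x : A ⊗[ℂ] A) :
    star (tensorRep π π x) ∈ LinearMap.range (tensorRep π π) := by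
  induction x using TensorProduct.induction_on with
  | zero => simp
  | add x x' hx hx' => rw [map_add, star_add]; exact add_mem hx hx'
  | tmul a b =>
    exact ⟨star a ⊗ₜ star b, by
      rw [tensorRep_tmul, tensorRep_tmul, opTensor_star, map_star, map_star]⟩

/-- The spatial tensor product `A ⊗ A` in the representation `π`, as a C*-algebra. -/
def spatialAlgebra (π : A →⋆ₐ[ℂ] (H →L[ℂ] H)) :
    StarSubalgebra ℂ (HilbertTensor H H →L[ℂ] HilbertTensor H H) where
  carrier := spatialTensor π π
  mul_mem' {X Y} hX hY := by
    refine map_mem_closure₂ continuous_mul hX hY ?_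
    rintro _ ⟨x, rfl⟩ _ ⟨y, rfl⟩
    exact ⟨x * y, (tensorRep_mul π x y).symm⟩
  add_mem' := (spatialTensor π π).add_mem
  algebraMap_mem' c := by
    refine Submodule.le_topologicalClosure _ ⟨c • (1 ⊗ₜ 1), ?_⟩
    rw [map_smul, tensorRep_tmul, map_one, opTensor_one, Algebra.algebraMap_eq_smul_one]
  star_mem' {X} hX := by
    refine map_mem_closure continuous_star hX ?_
    rintro _ ⟨x, rfl⟩
    exact star_tensorRep_mem π x

instance (π : A →⋆ₐ[ℂ] (H →L[ℂ] H)) :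
    IsClosed (spatialAlgebra π : Set (HilbertTensor H H →L[ℂ] HilbertTensor H H)) :=
  Submodule.isClosed_topologicalClosure _

/-- The dense embedding of the algebraic tensor product. -/
def toSpatialAlgebra (π : A →⋆ₐ[ℂ] (H →L[ℂ] H)) : A ⊗[ℂ] A →ₗ[ℂ] spatialAlgebra π where
  toFun x := ⟨tensorRep π π x, Submodule.le_topologicalClosure _ ⟨x, rfl⟩⟩
  map_add' x y := Subtype.ext (map_add _ x y)
  map_smul' c x := Subtype.ext (map_smul _ c x)

theorem denseRange_toSpatialAlgebra (π : A →⋆ₐ[ℂ] (H →L[ℂ] H)) :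
    DenseRange (toSpatialAlgebra π) := toSpatialTensor_dense π π

theorem norm_toSpatialAlgebra (π : A →⋆ₐ[ℂ] (H →L[ℂ] H)) (x : A ⊗[ℂ] A) :
    ‖toSpatialAlgebra π x‖ = ‖tensorRep π π x‖ := rfl

/-- `a ⊗ b ↦ f b • a`. -/
def algSliceR (f : A →L[ℂ] ℂ) : A ⊗[ℂ] A →ₗ[ℂ] A :=
  TensorProduct.lift (LinearMap.mk₂ ℂ (fun a b => f b • a) (fun _ _ _ => smul_add _ _ _)
    (fun _ _ _ => smul_comm _ _ _) (fun _ _ _ => by rw [map_add, add_smul])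
    (fun _ _ _ => by rw [map_smul, smul_assoc]))

/-- `a ⊗ b ↦ f a • b`. -/
def algSliceL (f : A →L[ℂ] ℂ) : A ⊗[ℂ] A →ₗ[ℂ] A :=
  TensorProduct.lift (LinearMap.mk₂ ℂ (fun a b => f a • b)
    (fun _ _ _ => by rw [map_add, add_smul]) (fun _ _ _ => by rw [map_smul, smul_assoc])
    (fun _ _ _ => smul_add _ _ _) (fun _ _ _ => smul_comm _ _ _))

@[simp] theorem algSliceR_tmul (f : A →L[ℂ] ℂ) (a b : A) : algSliceR f (a ⊗ₜ b) = f b • a := rfl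

@[simp] theorem algSliceL_tmul (f : A →L[ℂ] ℂ) (a b : A) : algSliceL f (a ⊗ₜ b) = f a • b := rfl

theorem apply_algSliceR (f g : A →L[ℂ] ℂ) (x : A ⊗[ℂ] A) :
    f (algSliceR g x) = g (algSliceL f x) := by
  induction x using TensorProduct.induction_on with
  | zero => simp
  | add x y hx hy => simp only [map_add, hx, hy]
  | tmul a b => simp [mul_comm]

/-- The vector functional `a ↦ ⟪ξ, π a η⟫`. -/
def vecFun (π : A →⋆ₐ[ℂ] (H →L[ℂ] H)) (ξ η : H) : A →L[ℂ] ℂ :=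
  LinearMap.mkContinuous
    { toFun := fun a => inner ℂ ξ (π a η)
      map_add' := fun a b => by simp
      map_smul' := fun c a => by simp } (‖ξ‖ * ‖η‖) fun a => by
    calc ‖inner ℂ ξ (π a η)‖ ≤ ‖ξ‖ * ‖π a η‖ := norm_inner_le_norm _ _
      _ ≤ ‖ξ‖ * (‖a‖ * ‖η‖) := by
        gcongr
        exact (π a).le_of_opNorm_le (NonUnitalStarAlgHom.norm_apply_le π a) η
      _ = _ := by ring

@[simp] theorem vecFun_apply (π : A →⋆ₐ[ℂ] (H →L[ℂ] H)) (ξ η : H) (a : A) :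
    vecFun π ξ η a = inner ℂ ξ (π a η) := rfl

theorem eq_of_forall_vecFun {π : A →⋆ₐ[ℂ] (H →L[ℂ] H)} (hπ : Function.Injective π) {a b : A}
    (h : ∀ ξ η, vecFun π ξ η a = vecFun π ξ η b) : a = b :=
  hπ (ContinuousLinearMap.ext fun η => ext_inner_left ℂ fun ξ => h ξ η)

theorem inner_tensorRep (π : A →⋆ₐ[ℂ] (H →L[ℂ] H)) (ξ₁ ξ₂ η₁ η₂ : H) (x : A ⊗[ℂ] A) :
    inner ℂ (pureTensor ξ₁ ξ₂) (tensorRep π π x (pureTensor η₁ η₂)) =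
      vecFun π ξ₁ η₁ (algSliceR (vecFun π ξ₂ η₂) x) := by
  induction x using TensorProduct.induction_on with
  | zero => simp
  | add x y hx hy => simp only [map_add, add_apply, inner_add_right, hx, hy]
  | tmul a b =>
    rw [tensorRep_tmul, opTensor_pure, inner_pureTensor, algSliceR_tmul, map_smul]
    simp [mul_comm]

theorem norm_le_of_vecFun {π : A →⋆ₐ[ℂ] (H →L[ℂ] H)} (hπ : Function.Injective π) {a : A} {C : ℝ}
    (hC : 0 ≤ C) (h : ∀ ξ η, ‖vecFun π ξ η a‖ ≤ C * ‖ξ‖ * ‖η‖) : ‖a‖ ≤ C := by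
  rw [← NonUnitalStarAlgHom.norm_map π hπ a]
  exact norm_le_of_norm_inner_le _ hC h

theorem norm_inner_tensorRep_le (π : A →⋆ₐ[ℂ] (H →L[ℂ] H)) (ξ₁ ξ₂ η₁ η₂ : H) (x : A ⊗[ℂ] A) :
    ‖vecFun π ξ₁ η₁ (algSliceR (vecFun π ξ₂ η₂) x)‖ ≤
      ‖tensorRep π π x‖ * (‖ξ₁‖ * ‖ξ₂‖) * (‖η₁‖ * ‖η₂‖) := by
  rw [← inner_tensorRep, ← norm_pureTensor ξ₁, ← norm_pureTensor η₁]
  calc _ ≤ ‖pureTensor ξ₁ ξ₂‖ * ‖tensorRep π π x (pureTensor η₁ η₂)‖ := norm_inner_le_norm _ _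
    _ ≤ ‖pureTensor ξ₁ ξ₂‖ * (‖tensorRep π π x‖ * ‖pureTensor η₁ η₂‖) := by
      gcongr; exact ContinuousLinearMap.le_opNorm _ _
    _ = _ := by ring

/-- Slice maps are bounded for the spatial norm: matrix coefficients in the first leg reduce the
claim to vector functionals on both legs. -/
theorem norm_algSliceR_le {π : A →⋆ₐ[ℂ] (H →L[ℂ] H)} (hπ : Function.Injective π)
    (f : A →L[ℂ] ℂ) (x : A ⊗[ℂ] A) : ‖algSliceR f x‖ ≤ ‖f‖ * ‖toSpatialAlgebra π x‖ := by
  rw [norm_toSpatialAlgebra]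
  have hn : 0 ≤ ‖tensorRep π π x‖ := ContinuousLinearMap.opNorm_nonneg _
  refine norm_le_of_vecFun hπ (by positivity) fun ξ η => ?_
  rw [apply_algSliceR]
  have h1 : ‖algSliceL (vecFun π ξ η) x‖ ≤ ‖tensorRep π π x‖ * ‖ξ‖ * ‖η‖ := by
    refine norm_le_of_vecFun hπ (by positivity) fun ξ' η' => ?_
    rw [← apply_algSliceR]
    exact (norm_inner_tensorRep_le π _ _ _ _ x).trans_eq (by ring)
  calc _ ≤ ‖f‖ * ‖algSliceL (vecFun π ξ η) x‖ := f.le_opNorm _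
    _ ≤ ‖f‖ * (‖tensorRep π π x‖ * ‖ξ‖ * ‖η‖) := by gcongr
    _ = _ := by ring

theorem norm_algSliceL_le {π : A →⋆ₐ[ℂ] (H →L[ℂ] H)} (hπ : Function.Injective π)
    (f : A →L[ℂ] ℂ) (x : A ⊗[ℂ] A) : ‖algSliceL f x‖ ≤ ‖f‖ * ‖toSpatialAlgebra π x‖ := by
  rw [norm_toSpatialAlgebra]
  have hn : 0 ≤ ‖tensorRep π π x‖ := ContinuousLinearMap.opNorm_nonneg _
  refine norm_le_of_vecFun hπ (by positivity) fun ξ η => ?_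
  rw [← apply_algSliceR]
  have h1 : ‖algSliceR (vecFun π ξ η) x‖ ≤ ‖tensorRep π π x‖ * ‖ξ‖ * ‖η‖ := by
    refine norm_le_of_vecFun hπ (by positivity) fun ξ' η' => ?_
    exact (norm_inner_tensorRep_le π _ _ _ _ x).trans_eq (by ring)
  calc _ ≤ ‖f‖ * ‖algSliceR (vecFun π ξ η) x‖ := f.le_opNorm _
    _ ≤ ‖f‖ * (‖tensorRep π π x‖ * ‖ξ‖ * ‖η‖) := by gcongr
    _ = _ := by ring

/-- The slice map `id ⊗ f` on the spatial tensor product. -/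
def spatialSliceR (π : A →⋆ₐ[ℂ] (H →L[ℂ] H)) (f : A →L[ℂ] ℂ) : spatialAlgebra π →L[ℂ] A :=
  (algSliceR f).extendOfNorm (toSpatialAlgebra π)

/-- The slice map `f ⊗ id` on the spatial tensor product. -/
def spatialSliceL (π : A →⋆ₐ[ℂ] (H →L[ℂ] H)) (f : A →L[ℂ] ℂ) : spatialAlgebra π →L[ℂ] A :=
  (algSliceL f).extendOfNorm (toSpatialAlgebra π)

theorem spatialSliceR_apply {π : A →⋆ₐ[ℂ] (H →L[ℂ] H)} (hπ : Function.Injective π)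
    (f : A →L[ℂ] ℂ) (x : A ⊗[ℂ] A) :
    spatialSliceR π f (toSpatialAlgebra π x) = algSliceR f x :=
  LinearMap.extendOfNorm_eq (denseRange_toSpatialAlgebra π) ⟨_, norm_algSliceR_le hπ f⟩ x

theorem spatialSliceL_apply {π : A →⋆ₐ[ℂ] (H →L[ℂ] H)} (hπ : Function.Injective π)
    (f : A →L[ℂ] ℂ) (x : A ⊗[ℂ] A) :
    spatialSliceL π f (toSpatialAlgebra π x) = algSliceL f x :=
  LinearMap.extendOfNorm_eq (denseRange_toSpatialAlgebra π) ⟨_, norm_algSliceL_le hπ f⟩ x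

theorem apply_spatialSliceR {π : A →⋆ₐ[ℂ] (H →L[ℂ] H)} (hπ : Function.Injective π)
    (f g : A →L[ℂ] ℂ) (X : spatialAlgebra π) :
    f (spatialSliceR π g X) = g (spatialSliceL π f X) := by
  refine (denseRange_toSpatialAlgebra π).induction_on X
    (isClosed_eq (by fun_prop) (by fun_prop)) fun x => ?_
  rw [spatialSliceR_apply hπ, spatialSliceL_apply hπ, apply_algSliceR]

theorem inner_spatial {π : A →⋆ₐ[ℂ] (H →L[ℂ] H)} (hπ : Function.Injective π)
    (ξ₁ ξ₂ η₁ η₂ : H) (X : spatialAlgebra π) :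
    inner ℂ (pureTensor ξ₁ ξ₂) ((X : HilbertTensor H H →L[ℂ] HilbertTensor H H)
      (pureTensor η₁ η₂)) = vecFun π ξ₁ η₁ (spatialSliceR π (vecFun π ξ₂ η₂) X) := by
  refine (denseRange_toSpatialAlgebra π).induction_on X
    (isClosed_eq (by fun_prop) (by fun_prop)) fun x => ?_
  rw [spatialSliceR_apply hπ]
  exact inner_tensorRep π _ _ _ _ x

end

section

variable {A : Type*} [CStarAlgebra A] {H : Type*} [NormedAddCommGroup H]
  [InnerProductSpace ℂ H] [CompleteSpace H]

theorem posSemidef_of_isPos {f : A →L[ℂ] ℂ} (hf : IsPos f) {n : ℕ} (a : Fin n → A) :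
    (Matrix.of fun i j => f (star (a i) * a j)).PosSemidef := by
  refine Matrix.PosSemidef.of_dotProduct_mulVec_nonneg ?_ fun x => ?_
  · ext i j
    have := DFunLike.congr_fun hf.star_eq (star (a i) * a j)
    simpa using this
  · have := hf (∑ i, x i • a i)
    simp only [star_sum, Finset.sum_mul_sum, map_sum, star_smul, smul_mul_smul_comm, map_smul,
      smul_eq_mul] at this
    simp only [dotProduct, Matrix.mulVec, Finset.mul_sum, Matrix.of_apply, Pi.star_apply]
    refine this.trans_eq (Finset.sum_congr rfl fun i _ => Finset.sum_congr rfl fun j _ => ?_)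
    ring

/-- The entrywise product of two Gram matrices has a nonnegative sum of entries. -/
theorem sum_mul_nonneg_of_isPos {f g : A →L[ℂ] ℂ} (hf : IsPos f) (hg : IsPos g) {n : ℕ}
    (a b : Fin n → A) :
    0 ≤ ∑ i, ∑ j, f (star (a i) * a j) * g (star (b i) * b j) := by
  obtain ⟨m, v, hv⟩ := Matrix.posSemidef_iff_eq_sum_vecMulVec.1 (posSemidef_of_isPos hf a)
  have hfv : ∀ i j, f (star (a i) * a j) = ∑ k, v k i * star (v k j) := fun i j => by
    have := congrFun (congrFun hv i) j
    simpa [Matrix.sum_apply, Matrix.vecMulVec_apply] using this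
  have h1 : ∀ k, 0 ≤ ∑ i, ∑ j, v k i * star (v k j) * g (star (b i) * b j) := fun k => by
    have := hg (∑ i, star (v k i) • b i)
    simpa [star_sum, Finset.sum_mul_sum, smul_mul_smul_comm, mul_comm, mul_left_comm, mul_assoc]
      using this
  have h2 := Finset.sum_nonneg fun k (_ : k ∈ Finset.univ) => h1 k
  refine h2.trans_eq ?_
  rw [Finset.sum_comm]
  refine Finset.sum_congr rfl fun i _ => ?_
  rw [Finset.sum_comm]
  refine Finset.sum_congr rfl fun j _ => ?_
  rw [hfv, Finset.sum_mul]

theorem exists_fin_sum_tmul (x : A ⊗[ℂ] A) :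
    ∃ (n : ℕ) (a b : Fin n → A), x = ∑ i, a i ⊗ₜ b i := by
  obtain ⟨S, rfl⟩ := TensorProduct.exists_finset x
  refine ⟨S.card, fun i => (S.equivFin.symm i).1.1, fun i => (S.equivFin.symm i).1.2, ?_⟩
  rw [← Finset.sum_coe_sort]
  exact (Equiv.sum_comp S.equivFin.symm fun i : S => i.1.1 ⊗ₜ[ℂ] i.1.2).symm

theorem toSpatialAlgebra_mul (π : A →⋆ₐ[ℂ] (H →L[ℂ] H)) (x y : A ⊗[ℂ] A) :
    toSpatialAlgebra π (x * y) = toSpatialAlgebra π x * toSpatialAlgebra π y :=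
  Subtype.ext (tensorRep_mul π x y).symm

theorem toSpatialAlgebra_star_tmul (π : A →⋆ₐ[ℂ] (H →L[ℂ] H)) (a b : A) :
    toSpatialAlgebra π (star a ⊗ₜ star b) = star (toSpatialAlgebra π (a ⊗ₜ b)) :=
  Subtype.ext (by
    change tensorRep π π _ = star (tensorRep π π _)
    rw [tensorRep_tmul, tensorRep_tmul, opTensor_star, map_star, map_star])

/-- The product of two positive functionals is positive on the spatial tensor product. -/
theorem spatialSlice_pos {π : A →⋆ₐ[ℂ] (H →L[ℂ] H)} (hπ : Function.Injective π)
    {f g : A →L[ℂ] ℂ} (hf : IsPos f) (hg : IsPos g) (X : spatialAlgebra π) :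
    0 ≤ f (spatialSliceR π g (star X * X)) := by
  refine (denseRange_toSpatialAlgebra π).induction_on X
    (isClosed_le continuous_const (by fun_prop)) fun x => ?_
  obtain ⟨n, a, b, rfl⟩ := exists_fin_sum_tmul x
  refine (sum_mul_nonneg_of_isPos hf hg a b).trans_eq ?_
  rw [map_sum, star_sum, Finset.sum_mul_sum]
  simp only [← toSpatialAlgebra_star_tmul, ← toSpatialAlgebra_mul,
    Algebra.TensorProduct.tmul_mul_tmul, map_sum, spatialSliceR_apply hπ, algSliceR_tmul, map_smul,
    smul_eq_mul]
  exact Finset.sum_congr rfl fun i _ => Finset.sum_congr rfl fun j _ => mul_comm _ _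

theorem topologicalClosure_span_eq_top {V : Type*} [NormedRing V] [StarRing V] [NormedAlgebra ℂ V]
    [StarModule ℂ V] (S : StarSubalgebra ℂ V) {ι : Type*} (s : ι → S)
    (h : (Submodule.span ℂ (Set.range fun i => (s i : V))).topologicalClosure =
      Subalgebra.toSubmodule S.toSubalgebra) :
    (Submodule.span ℂ (Set.range s)).topologicalClosure = ⊤ := by
  rw [eq_top_iff]
  rintro y -
  change y ∈ closure (Submodule.span ℂ (Set.range s) : Set S)
  rw [closure_subtype]
  have hy : (y : V) ∈ (Submodule.span ℂ (Set.range fun i => (s i : V))).topologicalClosure := by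
    rw [h]; exact y.2
  have hmap : Submodule.span ℂ (Set.range fun i => (s i : V)) =
      (Submodule.span ℂ (Set.range s)).map (S.subtype.toAlgHom.toLinearMap) := by
    rw [Submodule.map_span, ← Set.range_comp]
    rfl
  rw [hmap] at hy
  exact hy

/-- `a ↦ a ⊗ 1` -/
def spatialInl (π : A →⋆ₐ[ℂ] (H →L[ℂ] H)) : A →⋆ₐ[ℂ] spatialAlgebra π where
  toFun a := toSpatialAlgebra π (a ⊗ₜ 1)
  map_one' := Subtype.ext (by
    change tensorRep π π _ = 1
    rw [tensorRep_tmul, map_one, opTensor_one])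
  map_mul' a b := by rw [← toSpatialAlgebra_mul]; simp
  map_zero' := by simp
  map_add' a b := by simp [TensorProduct.add_tmul]
  commutes' c := Subtype.ext (by
    change tensorRep π π _ = algebraMap ℂ _ c
    rw [Algebra.algebraMap_eq_smul_one, tensorRep_tmul, map_smul, map_one, opTensor_smul_left,
      opTensor_one, Algebra.algebraMap_eq_smul_one])
  map_star' a := by rw [← toSpatialAlgebra_star_tmul, star_one]

/-- `a ↦ 1 ⊗ a` -/
def spatialInr (π : A →⋆ₐ[ℂ] (H →L[ℂ] H)) : A →⋆ₐ[ℂ] spatialAlgebra π where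
  toFun a := toSpatialAlgebra π (1 ⊗ₜ a)
  map_one' := Subtype.ext (by
    change tensorRep π π _ = 1
    rw [tensorRep_tmul, map_one, opTensor_one])
  map_mul' a b := by rw [← toSpatialAlgebra_mul]; simp
  map_zero' := by simp
  map_add' a b := by simp [TensorProduct.tmul_add]
  commutes' c := Subtype.ext (by
    change tensorRep π π _ = algebraMap ℂ _ c
    rw [Algebra.algebraMap_eq_smul_one, tensorRep_tmul, map_smul, map_one, opTensor_smul_right,
      opTensor_one, Algebra.algebraMap_eq_smul_one])
  map_star' a := by rw [← toSpatialAlgebra_star_tmul, star_one]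

theorem spatialInl_mul_inr (π : A →⋆ₐ[ℂ] (H →L[ℂ] H)) (a b : A) :
    spatialInl π a * spatialInr π b = toSpatialAlgebra π (a ⊗ₜ b) := by
  change toSpatialAlgebra π (a ⊗ₜ 1) * toSpatialAlgebra π (1 ⊗ₜ b) = _
  rw [← toSpatialAlgebra_mul]
  simp

theorem spatialInr_mul_inl (π : A →⋆ₐ[ℂ] (H →L[ℂ] H)) (a b : A) :
    spatialInr π b * spatialInl π a = toSpatialAlgebra π (a ⊗ₜ b) := by
  change toSpatialAlgebra π (1 ⊗ₜ b) * toSpatialAlgebra π (a ⊗ₜ 1) = _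
  rw [← toSpatialAlgebra_mul]
  simp

namespace CompactQuantumGroup

variable (G : CompactQuantumGroup A H)

/-- The comultiplication with values in the spatial tensor product. -/
def comulSpatial : A →⋆ₐ[ℂ] spatialAlgebra G.rep :=
  StarAlgHom.codRestrict G.comul (spatialAlgebra G.rep) G.comul_mem

theorem continuous_comulSpatial : Continuous G.comulSpatial :=
  AddMonoidHomClass.continuous_of_bound G.comulSpatial 1 fun a => by
    rw [one_mul]; exact NonUnitalStarAlgHom.norm_apply_le G.comulSpatial a

theorem inner_comul (ξ₁ ξ₂ η₁ η₂ : H) (b : A) :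
    inner ℂ (pureTensor ξ₁ ξ₂) (G.comul b (pureTensor η₁ η₂)) =
      vecFun G.rep ξ₁ η₁ (spatialSliceR G.rep (vecFun G.rep ξ₂ η₂) (G.comulSpatial b)) :=
  inner_spatial G.rep_injective ξ₁ ξ₂ η₁ η₂ (G.comulSpatial b)

theorem continuous_spatialMap_apply (π σ : A →⋆ₐ[ℂ] (H →L[ℂ] H))
    {H' K' : Type*} [NormedAddCommGroup H'] [InnerProductSpace ℂ H'] [CompleteSpace H']
    [NormedAddCommGroup K'] [InnerProductSpace ℂ K'] [CompleteSpace K']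
    (π' : A →⋆ₐ[ℂ] (H' →L[ℂ] H')) (σ' : A →⋆ₐ[ℂ] (K' →L[ℂ] K'))
    (ξ η : HilbertTensor H' K') :
    Continuous fun X : spatialTensor π σ => inner ℂ ξ (spatialMap π σ π' σ' X η) :=
  continuous_const.inner ((spatialMap π σ π' σ').continuous.clm_apply continuous_const)

/-- The matrix coefficients of `(Δ ⊗ id) X` between simple tensors, through vector functionals. -/
theorem inner_spatialMap_comul_rep (ξ₁ ξ₂ ξ₃ η₁ η₂ η₃ : H) (X : spatialAlgebra G.rep) :
    inner ℂ (pureTensor (pureTensor ξ₁ ξ₂) ξ₃)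
      (spatialMap G.rep G.rep G.comul G.rep ⟨X, X.2⟩ (pureTensor (pureTensor η₁ η₂) η₃)) =
      vecFun G.rep ξ₁ η₁ (spatialSliceR G.rep (vecFun G.rep ξ₂ η₂)
      (G.comulSpatial (spatialSliceR G.rep (vecFun G.rep ξ₃ η₃) X))) := by
  have hinj := G.rep_injective
  have hι : Continuous fun X : spatialAlgebra G.rep => (⟨X, X.2⟩ : spatialTensor G.rep G.rep) :=
    continuous_subtype_val.subtype_mk _
  refine (denseRange_toSpatialAlgebra G.rep).induction_on X
    (isClosed_eq ((continuous_spatialMap_apply _ _ _ _ _ _).comp hι) ?_) fun x => ?_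
  · exact (vecFun G.rep ξ₁ η₁).continuous.comp ((spatialSliceR G.rep _).continuous.comp
      (G.continuous_comulSpatial.comp (spatialSliceR G.rep _).continuous))
  · rw [spatialSliceR_apply hinj]
    have h : (⟨toSpatialAlgebra G.rep x, (toSpatialAlgebra G.rep x).2⟩ :
      spatialTensor G.rep G.rep) = toSpatialTensor G.rep G.rep x := rfl
    rw [h, spatialMap_toSpatialTensor _ hinj _ hinj]
    induction x using TensorProduct.induction_on with
    | zero => simp only [map_zero, zero_apply, inner_zero_right]
    | add x y hx hy =>
      simp only [map_add, add_apply, inner_add_right]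
      rw [hx rfl, hy rfl]
    | tmul b c =>
      rw [tensorRep_tmul, opTensor_pure, inner_pureTensor, inner_comul, algSliceR_tmul]
      simp only [map_smul, smul_eq_mul, vecFun_apply, mul_comm]

/-- The matrix coefficients of `(id ⊗ Δ) X` between simple tensors, through vector functionals. -/
theorem inner_spatialMap_rep_comul (ξ₁ ξ₂ ξ₃ η₁ η₂ η₃ : H) (X : spatialAlgebra G.rep) :
    inner ℂ (pureTensor ξ₁ (pureTensor ξ₂ ξ₃))
      (spatialMap G.rep G.rep G.rep G.comul ⟨X, X.2⟩ (pureTensor η₁ (pureTensor η₂ η₃))) =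
      vecFun G.rep ξ₃ η₃ (spatialSliceL G.rep (vecFun G.rep ξ₂ η₂)
      (G.comulSpatial (spatialSliceL G.rep (vecFun G.rep ξ₁ η₁) X))) := by
  have hinj := G.rep_injective
  have hι : Continuous fun X : spatialAlgebra G.rep => (⟨X, X.2⟩ : spatialTensor G.rep G.rep) :=
    continuous_subtype_val.subtype_mk _
  refine (denseRange_toSpatialAlgebra G.rep).induction_on X
    (isClosed_eq ((continuous_spatialMap_apply _ _ _ _ _ _).comp hι) ?_) fun x => ?_
  · exact (vecFun G.rep ξ₃ η₃).continuous.comp ((spatialSliceL G.rep _).continuous.comp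
      (G.continuous_comulSpatial.comp (spatialSliceL G.rep _).continuous))
  · rw [spatialSliceL_apply hinj]
    have h : (⟨toSpatialAlgebra G.rep x, (toSpatialAlgebra G.rep x).2⟩ :
      spatialTensor G.rep G.rep) = toSpatialTensor G.rep G.rep x := rfl
    rw [h, spatialMap_toSpatialTensor _ hinj _ hinj]
    induction x using TensorProduct.induction_on with
    | zero => simp only [map_zero, zero_apply, inner_zero_right]
    | add x y hx hy =>
      simp only [map_add, add_apply, inner_add_right]
      rw [hx rfl, hy rfl]
    | tmul b c =>
      rw [tensorRep_tmul, opTensor_pure, inner_pureTensor, inner_comul, algSliceL_tmul,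
        apply_spatialSliceR hinj]
      simp only [map_smul, smul_eq_mul, vecFun_apply]

theorem coassoc_vecFun (a : A) (ξ₁ ξ₂ ξ₃ η₁ η₂ η₃ : H) :
    vecFun G.rep ξ₁ η₁ (spatialSliceR G.rep (vecFun G.rep ξ₂ η₂)
      (G.comulSpatial (spatialSliceR G.rep (vecFun G.rep ξ₃ η₃) (G.comulSpatial a)))) =
    vecFun G.rep ξ₃ η₃ (spatialSliceL G.rep (vecFun G.rep ξ₂ η₂)
      (G.comulSpatial (spatialSliceL G.rep (vecFun G.rep ξ₁ η₁) (G.comulSpatial a)))) :=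
  (G.inner_spatialMap_comul_rep ξ₁ ξ₂ ξ₃ η₁ η₂ η₃ (G.comulSpatial a)).symm.trans
    ((G.coassoc a ξ₁ ξ₂ ξ₃ η₁ η₂ η₃).trans
      (G.inner_spatialMap_rep_comul ξ₁ ξ₂ ξ₃ η₁ η₂ η₃ (G.comulSpatial a)))

/-- Coassociativity for arbitrary functionals. It is known for vector functionals, and those
separate the points of `A`; the three functionals are freed one at a time. -/
theorem coassoc_slice (f g : A →L[ℂ] ℂ) (a : A) :
    spatialSliceL G.rep f (G.comulSpatial (spatialSliceR G.rep g (G.comulSpatial a))) =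
      spatialSliceR G.rep g (G.comulSpatial (spatialSliceL G.rep f (G.comulSpatial a))) := by
  have hinj := G.rep_injective
  have hap := apply_spatialSliceR hinj
  let Δ : A →L[ℂ] spatialAlgebra G.rep :=
    ⟨G.comulSpatial.toAlgHom.toLinearMap, G.continuous_comulSpatial⟩
  have hΔ : ∀ a, Δ a = G.comulSpatial a := fun _ => rfl
  let R := spatialSliceR G.rep
  let L := spatialSliceL G.rep
  let V := vecFun G.rep
  simp only [← hΔ]
  have e0 : ∀ ξ₁ η₁ ξ₃ η₃, L (V ξ₁ η₁) (Δ (R (V ξ₃ η₃) (Δ a))) =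
      R (V ξ₃ η₃) (Δ (L (V ξ₁ η₁) (Δ a))) := fun ξ₁ η₁ ξ₃ η₃ =>
    eq_of_forall_vecFun hinj fun ξ₂ η₂ => by
      have := G.coassoc_vecFun a ξ₁ ξ₂ ξ₃ η₁ η₂ η₃
      rw [hap (vecFun G.rep ξ₁ η₁), ← hap (vecFun G.rep ξ₂ η₂) (vecFun G.rep ξ₃ η₃)] at this
      exact this
  -- the convolution of two functionals
  let cv : (A →L[ℂ] ℂ) → (A →L[ℂ] ℂ) → (A →L[ℂ] ℂ) := fun φ ψ => φ.comp ((R ψ).comp Δ)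
  have hcv : ∀ φ ψ b, cv φ ψ b = φ (R ψ (Δ b)) := fun _ _ _ => rfl
  have e1 : ∀ φ ξ₃ η₃, R φ (Δ (R (V ξ₃ η₃) (Δ a))) = R (cv φ (V ξ₃ η₃)) (Δ a) := fun φ ξ₃ η₃ =>
    eq_of_forall_vecFun hinj fun ξ₁ η₁ => by
      change V ξ₁ η₁ (R φ _) = V ξ₁ η₁ (R _ _)
      rw [hap, e0, hap (V ξ₁ η₁), hcv]
  have e2 : ∀ φ ξ₃ η₃, L φ (Δ (R (V ξ₃ η₃) (Δ a))) = R (V ξ₃ η₃) (Δ (L φ (Δ a))) :=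
    fun φ ξ₃ η₃ => eq_of_forall_vecFun hinj fun ξ₂ η₂ => by
      change V ξ₂ η₂ (L φ _) = V ξ₂ η₂ (R _ _)
      rw [← hap, e1, hap, hcv]
  have e3 : ∀ φ ψ, L ψ (Δ (L φ (Δ a))) = L (cv φ ψ) (Δ a) := fun φ ψ =>
    eq_of_forall_vecFun hinj fun ξ₃ η₃ => by
      change V ξ₃ η₃ (L ψ _) = V ξ₃ η₃ (L _ _)
      rw [← hap, ← e2, ← hap φ, ← hcv, hap]
  refine eq_of_forall_functional fun ψ => ?_
  change ψ (L f (Δ (R g (Δ a)))) = ψ (R g (Δ (L f (Δ a))))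
  rw [← hap f ψ, ← hcv, hap (cv f ψ) g, ← e3, ← hap ψ g]

/-- The slice system of a compact quantum group. -/
def sliceSystem : SliceSystem A (spatialAlgebra G.rep) where
  inl := spatialInl G.rep
  inr := spatialInr G.rep
  comul := G.comulSpatial
  sliceR := spatialSliceR G.rep
  sliceL := spatialSliceL G.rep
  comm a b := (spatialInl_mul_inr G.rep a b).trans (spatialInr_mul_inl G.rep a b).symm
  sliceR_mul f a b := by
    rw [spatialInl_mul_inr, spatialSliceR_apply G.rep_injective, algSliceR_tmul]
  sliceL_mul f a b := by
    rw [spatialInl_mul_inr, spatialSliceL_apply G.rep_injective, algSliceL_tmul]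
  norm_sliceR_le f X := LinearMap.norm_extendOfNorm_apply_le (denseRange_toSpatialAlgebra G.rep) _
    (norm_algSliceR_le G.rep_injective f) X
  norm_sliceL_le f X := LinearMap.norm_extendOfNorm_apply_le (denseRange_toSpatialAlgebra G.rep) _
    (norm_algSliceL_le G.rep_injective f) X
  dense := by
    have hle : LinearMap.range (toSpatialAlgebra G.rep) ≤ Submodule.span ℂ
        (Set.range fun p : A × A => spatialInl G.rep p.1 * spatialInr G.rep p.2) := by
      rintro _ ⟨x, rfl⟩
      induction x using TensorProduct.induction_on with
      | zero => simp
      | add x y hx hy => rw [map_add]; exact add_mem hx hy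
      | tmul a b =>
        rw [← spatialInl_mul_inr]
        exact Submodule.subset_span ⟨(a, b), rfl⟩
    rw [← Submodule.dense_iff_topologicalClosure_eq_top]
    exact (denseRange_toSpatialAlgebra G.rep).mono hle
  cancel_left := by
    refine topologicalClosure_span_eq_top _ _ (Eq.trans ?_ G.cancel_left)
    congr 3
    ext1 p
    change tensorRep G.rep G.rep (p.1 ⊗ₜ 1) * G.comul p.2 = _
    rw [tensorRep_tmul, map_one]
  cancel_right := by
    refine topologicalClosure_span_eq_top _ _ (Eq.trans ?_ G.cancel_right)
    congr 3
    ext1 p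
    change tensorRep G.rep G.rep (1 ⊗ₜ p.1) * G.comul p.2 = _
    rw [tensorRep_tmul, map_one]
  pos f g hf hg X := spatialSlice_pos G.rep_injective hf hg X
  coassoc f g a := G.coassoc_slice f g a

end CompactQuantumGroup

end

section

variable {A : Type*} [CStarAlgebra A] {H : Type*} [NormedAddCommGroup H]
  [InnerProductSpace ℂ H] [CompleteSpace H] {n : ℕ}

/-! ### The modular operator -/

theorem scalarMatrix_apply (T : Matrix (Fin n) (Fin n) ℂ) (i j : Fin n) :
    scalarMatrix A T i j = algebraMap ℂ A (T i j) := rfl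

theorem scalarMatrix_mul (S T : Matrix (Fin n) (Fin n) ℂ) :
    scalarMatrix A (S * T) = scalarMatrix A S * scalarMatrix A T :=
  Matrix.map_mul

theorem scalarMatrix_one : scalarMatrix A (1 : Matrix (Fin n) (Fin n) ℂ) = 1 :=
  Matrix.map_one _ (map_zero _) (map_one _)

theorem star_scalarMatrix (T : Matrix (Fin n) (Fin n) ℂ) :
    star (scalarMatrix A T) = scalarMatrix A (star T) := by
  ext i j
  simp [Matrix.star_apply, scalarMatrix_apply, ← algebraMap_star_comm]

theorem transpose_scalarMatrix_mul (T : Matrix (Fin n) (Fin n) ℂ) (X : Matrix (Fin n) (Fin n) A) :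
    (scalarMatrix A T * X).transpose = X.transpose * scalarMatrix A T.transpose := by
  ext i j
  simp only [Matrix.transpose_apply, Matrix.mul_apply, scalarMatrix_apply, Algebra.commutes]

theorem transpose_mul_scalarMatrix (T : Matrix (Fin n) (Fin n) ℂ) (X : Matrix (Fin n) (Fin n) A) :
    (X * scalarMatrix A T).transpose = scalarMatrix A T.transpose * X.transpose := by
  ext i j
  simp only [Matrix.transpose_apply, Matrix.mul_apply, scalarMatrix_apply, Algebra.commutes]

theorem matrixElement_eq (u : Matrix (Fin n) (Fin n) A)
    (b : OrthonormalBasis (Fin n) ℂ (EuclideanSpace ℂ (Fin n))) :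
    Matrix.of (matrixElement u b) = scalarMatrix A (star (Matrix.of fun k i => b i k)) * u *
      scalarMatrix A (Matrix.of fun k i => b i k) := by
  ext i j
  simp only [Matrix.of_apply, matrixElement, Matrix.mul_apply, scalarMatrix_apply,
    Matrix.star_apply, Finset.sum_mul]
  rw [Finset.sum_comm]
  refine Finset.sum_congr rfl fun l _ => Finset.sum_congr rfl fun k _ => ?_
  rw [Algebra.smul_def, map_mul, mul_assoc, Algebra.commutes (b j l), mul_assoc]

theorem star_mul_of_orthonormalBasis
    (b : OrthonormalBasis (Fin n) ℂ (EuclideanSpace ℂ (Fin n))) :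
    star (Matrix.of fun k i => b i k) * (Matrix.of fun k i => b i k) =
      (1 : Matrix (Fin n) (Fin n) ℂ) := by
  ext i j
  have := orthonormal_iff_ite.1 b.orthonormal i j
  simp only [PiLp.inner_apply, RCLike.inner_apply] at this
  simp only [Matrix.mul_apply, Matrix.star_apply, Matrix.of_apply, Matrix.one_apply, ← this]
  exact Finset.sum_congr rfl fun k _ => mul_comm _ _

/-- The conjugate representation is invertible: otherwise its `Ring.inverse` would be zero, and
so would be the intertwiner `ρ`. -/
theorem IsModularOperator.isUnit {u : Matrix (Fin n) (Fin n) A} {ρ : Matrix (Fin n) (Fin n) ℂ}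
    (hρ : IsModularOperator u ρ) (hu : u ∈ unitary (Matrix (Fin n) (Fin n) A)) :
    IsUnit (contragredient u) := by
  by_contra h
  have h1 := hρ.intertwines
  rw [contragredient, Ring.inverse_non_unit _ h, Matrix.transpose_zero, zero_mul] at h1
  have hρu : scalarMatrix A ρ⁻¹ * scalarMatrix A ρ = 1 := by
    rw [← scalarMatrix_mul, Matrix.nonsing_inv_mul _ ((Matrix.isUnit_iff_isUnit_det _).1
      hρ.posDef.isUnit), scalarMatrix_one]
  have h2 : (1 : Matrix (Fin n) (Fin n) A) = 0 := by
    calc (1 : Matrix (Fin n) (Fin n) A) = scalarMatrix A ρ⁻¹ * (scalarMatrix A ρ * u) * star u := by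
          rw [← mul_assoc, hρu, one_mul, (Unitary.mem_iff.1 hu).2]
      _ = 0 := by rw [h1, mul_zero, zero_mul]
  have : Subsingleton (Matrix (Fin n) (Fin n) A) := subsingleton_of_zero_eq_one h2.symm
  exact h (isUnit_of_subsingleton _)

theorem contragredient_of_unitary {u : Matrix (Fin n) (Fin n) A}
    (hu : u ∈ unitary (Matrix (Fin n) (Fin n) A)) : contragredient u = (star u).transpose := by
  rw [contragredient]
  have : Ring.inverse u = star u :=
    Ring.inverse_unit (Unitary.toUnits ⟨u, hu⟩)
  rw [this]

variable {u : Matrix (Fin n) (Fin n) A} {ρ : Matrix (Fin n) (Fin n) ℂ} {r : Fin n → ℝ}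
  {b : OrthonormalBasis (Fin n) ℂ (EuclideanSpace ℂ (Fin n))}

/-- In an eigenbasis of `ρ`, the transposed inverse of the conjugate matrix `w̄` has entries
`(r k / r i) w k i`. -/
theorem IsModularOperator.inverse_matrixElement (hρ : IsModularOperator u ρ)
    (hu : u ∈ unitary (Matrix (Fin n) (Fin n) A)) (hr : ∀ i, 0 < r i)
    (hb : ∀ j, Matrix.toEuclideanLin ρ (b j) = (r j : ℂ) • b j) :
    let w : Matrix (Fin n) (Fin n) A := Matrix.of (matrixElement u b)
    let y : Matrix (Fin n) (Fin n) A := Matrix.of fun i k => ((r k : ℂ) * (r i : ℂ)⁻¹) • w k i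
    y * (star w).transpose = 1 ∧ (star w).transpose * y = 1 := by
  intro w y
  -- `V` has the basis vectors as columns, so that `w = V* u V` and `ρ V = V R`
  let V : Matrix (Fin n) (Fin n) ℂ := Matrix.of fun k i => b i k
  let R : Matrix (Fin n) (Fin n) ℂ := Matrix.diagonal fun i => (r i : ℂ)
  let R' : Matrix (Fin n) (Fin n) ℂ := Matrix.diagonal fun i => (r i : ℂ)⁻¹
  have hRR : R * R' = 1 := by
    rw [Matrix.diagonal_mul_diagonal, ← Matrix.diagonal_one]
    congr 1; ext i
    exact mul_inv_cancel₀ (by exact_mod_cast (hr i).ne')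
  have hVV : star V * V = 1 := star_mul_of_orthonormalBasis b
  have hVV' : V * star V = 1 := mul_eq_one_comm.1 hVV
  have hρV : ρ * V = V * R := by
    ext k j
    have := congrArg (fun x : EuclideanSpace ℂ (Fin n) => x k) (hb j)
    simp only [Matrix.toLpLin_apply, Matrix.mulVec, dotProduct, PiLp.smul_apply,
      smul_eq_mul] at this
    rw [Matrix.mul_diagonal]
    simpa [Matrix.mul_apply, V, mul_comm] using this
  have hunit := hρ.isUnit hu
  rw [contragredient_of_unitary hu] at hunit
  have hint := hρ.intertwines
  rw [contragredient_of_unitary hu, contragredient] at hint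
  set ub := (star u).transpose
  have hw : w = scalarMatrix A (star V) * u * scalarMatrix A V := matrixElement_eq u b
  have hwb : (star w).transpose =
      scalarMatrix A V.transpose * ub * scalarMatrix A (star V).transpose := by
    rw [hw, star_mul, star_mul, star_scalarMatrix, star_scalarMatrix, star_star,
      ← mul_assoc, transpose_mul_scalarMatrix, transpose_scalarMatrix_mul, mul_assoc]
  have hy : y = scalarMatrix A V.transpose * Ring.inverse ub *
      scalarMatrix A (star V).transpose := by
    have h1 : y = (scalarMatrix A R * w * scalarMatrix A R').transpose := by
      have hd : ∀ d : Fin n → ℂ, scalarMatrix A (Matrix.diagonal d) =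
          Matrix.diagonal fun i => algebraMap ℂ A (d i) := fun d =>
        Matrix.diagonal_map (map_zero _)
      ext i k
      rw [Matrix.transpose_apply, hd, hd, Matrix.mul_diagonal, Matrix.diagonal_mul,
        ← Algebra.commutes, ← mul_assoc, ← map_mul, mul_comm (_⁻¹), ← Algebra.smul_def]
      rfl
    have h2 : (Ring.inverse ub).transpose * scalarMatrix A V =
        scalarMatrix A V * (scalarMatrix A R * w * scalarMatrix A R') := by
      calc (Ring.inverse ub).transpose * scalarMatrix A V
          = (Ring.inverse ub).transpose * scalarMatrix A (V * R * R') := by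
            rw [mul_assoc V, hRR, mul_one]
        _ = scalarMatrix A (ρ * V * star V) * u * scalarMatrix A (V * R') := by
            rw [← hρV, mul_assoc ρ, mul_assoc ρ V, hVV', mul_one, scalarMatrix_mul, ← mul_assoc,
              hint]
        _ = _ := by
            rw [hρV, hw]
            simp only [scalarMatrix_mul, mul_assoc]
    have h3 : scalarMatrix A R * w * scalarMatrix A R' =
        scalarMatrix A (star V) * ((Ring.inverse ub).transpose * scalarMatrix A V) := by
      rw [h2, ← mul_assoc, ← scalarMatrix_mul, hVV, scalarMatrix_one, one_mul]
    rw [h1, h3, transpose_scalarMatrix_mul, transpose_mul_scalarMatrix, Matrix.transpose_transpose]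
  have hT : scalarMatrix A (star V).transpose * scalarMatrix A V.transpose = 1 := by
    rw [← scalarMatrix_mul, ← Matrix.transpose_mul, hVV', Matrix.transpose_one, scalarMatrix_one]
  have hT' : scalarMatrix A V.transpose * scalarMatrix A (star V).transpose = 1 := by
    rw [← scalarMatrix_mul, ← Matrix.transpose_mul, hVV, Matrix.transpose_one, scalarMatrix_one]
  have key : ∀ X Y : Matrix (Fin n) (Fin n) A, X * Y = 1 →
      scalarMatrix A V.transpose * X * scalarMatrix A (star V).transpose *
      (scalarMatrix A V.transpose * Y * scalarMatrix A (star V).transpose) = 1 := by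
    intro X Y hXY
    calc _ = scalarMatrix A V.transpose * (X * (scalarMatrix A (star V).transpose *
          scalarMatrix A V.transpose) * Y) * scalarMatrix A (star V).transpose := by
          simp only [mul_assoc]
      _ = 1 := by rw [hT, mul_one, hXY, mul_one, hT']
  rw [hy, hwb]
  exact ⟨key _ _ (Ring.inverse_mul_cancel _ hunit), key _ _ (Ring.mul_inverse_cancel _ hunit)⟩

/-- The matrix of an irreducible unitary representation in an orthonormal eigenbasis of its modular
operator. -/
theorem CompactQuantumGroup.IsIrreducibleUnitaryRep.isDiagRep {G : CompactQuantumGroup A H}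
    (hu : G.IsIrreducibleUnitaryRep u) (hρ : IsModularOperator u ρ) (hr : ∀ i, 0 < r i)
    (hb : ∀ j, Matrix.toEuclideanLin ρ (b j) = (r j : ℂ) • b j) :
    G.sliceSystem.IsDiagRep (Matrix.of (matrixElement u b)) r := by
  let V : Matrix (Fin n) (Fin n) ℂ := Matrix.of fun k i => b i k
  set w : Matrix (Fin n) (Fin n) A := Matrix.of (matrixElement u b) with hwdef
  have hVV : star V * V = 1 := star_mul_of_orthonormalBasis b
  have hVV' : V * star V = 1 := mul_eq_one_comm.1 hVV
  have hs : scalarMatrix A (star V) * scalarMatrix A V = 1 := by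
    rw [← scalarMatrix_mul, hVV, scalarMatrix_one]
  have hs' : scalarMatrix A V * scalarMatrix A (star V) = 1 := by
    rw [← scalarMatrix_mul, hVV', scalarMatrix_one]
  have hw : w = scalarMatrix A (star V) * u * scalarMatrix A V := matrixElement_eq u b
  have hstar : star w = scalarMatrix A (star V) * star u * scalarMatrix A V := by
    rw [hw, star_mul, star_mul, star_scalarMatrix, star_scalarMatrix, star_star, mul_assoc]
  have conjmul : ∀ X Y : Matrix (Fin n) (Fin n) A,
      scalarMatrix A (star V) * X * scalarMatrix A V *
      (scalarMatrix A (star V) * Y * scalarMatrix A V) =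
      scalarMatrix A (star V) * (X * Y) * scalarMatrix A V := fun X Y => by
    calc _ = scalarMatrix A (star V) * (X * (scalarMatrix A V * scalarMatrix A (star V)) * Y) *
          scalarMatrix A V := by simp only [mul_assoc]
      _ = _ := by rw [hs', mul_one]
  have hww : w * star w = 1 := by
    rw [hstar, hw, conjmul, (Unitary.mem_iff.1 hu.unitary).2, mul_one, hs]
  have hww' : star w * w = 1 := by
    rw [hstar, hw, conjmul, (Unitary.mem_iff.1 hu.unitary).1, mul_one, hs]
  obtain ⟨hy1, hy2⟩ := hρ.inverse_matrixElement hu.unitary hr hb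
  have hr0 : ∀ i, (r i : ℂ) ≠ 0 := fun i => by exact_mod_cast (hr i).ne'
  refine ⟨hr, fun i j => ?_, fun i j => ?_, fun i j => ?_, fun i j => ?_, fun i j => ?_, ?_⟩
  · -- `Δ w = (V* ⊗ 1) u₁ u₂ (V ⊗ 1)`, and `V V* = 1` is inserted in the middle
    let Q := G.sliceSystem
    have hΔu : ∀ i j, Q.comul (u i j) = ∑ k, Q.inl (u i k) * Q.inr (u k j) := fun i j => by
      refine Subtype.ext ?_
      rw [AddSubmonoidClass.coe_finsetSum]
      refine (hu.comul_apply i j).trans (Finset.sum_congr rfl fun k _ => ?_)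
      change _ = ((spatialInl G.rep _ * spatialInr G.rep _ : spatialAlgebra G.rep) :
        HilbertTensor H H →L[ℂ] HilbertTensor H H)
      rw [spatialInl_mul_inr]
      exact (tensorRep_tmul _ _ _ _).symm
    change Q.comul (w i j) = ∑ k, Q.inl (w i k) * Q.inr (w k j)
    have hmap : ∀ (f : A →⋆ₐ[ℂ] spatialAlgebra G.rep), w.map f =
        scalarMatrix _ (star V) * u.map f * scalarMatrix _ V := fun f => by
      rw [hw]
      have hsc : ∀ T : Matrix (Fin n) (Fin n) ℂ,
          (scalarMatrix A T).map f = scalarMatrix (spatialAlgebra G.rep) T := fun T => by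
        ext1 i j
        exact AlgHomClass.commutes f _
      have hmul : ∀ X Y : Matrix (Fin n) (Fin n) A, (X * Y).map f = X.map f * Y.map f :=
        fun X Y => by
          ext1 i j
          simp only [Matrix.map_apply, Matrix.mul_apply, map_sum, map_mul]
      rw [hmul, hmul, hsc, hsc]
    have hΔ : u.map Q.comul = u.map Q.inl * u.map Q.inr := by
      ext1 i j
      rw [Matrix.mul_apply]
      exact hΔu i j
    have hs'' : scalarMatrix (spatialAlgebra G.rep) V *
        scalarMatrix (spatialAlgebra G.rep) (star V) = 1 := by
      rw [← scalarMatrix_mul, hVV', scalarMatrix_one]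
    have hΔw : w.map Q.comul = w.map Q.inl * w.map Q.inr := by
      calc w.map Q.comul = scalarMatrix _ (star V) * (u.map Q.inl * (scalarMatrix _ V *
            scalarMatrix _ (star V)) * u.map Q.inr) * scalarMatrix _ V := by
            rw [hmap, hΔ, hs'', mul_one]
        _ = _ := by
            rw [hmap, hmap]
            simp only [mul_assoc]
    have := congrFun (congrFun hΔw i) j
    rwa [Matrix.mul_apply] at this
  · have := congrFun (congrFun hww i) j
    simpa [Matrix.mul_apply, Matrix.one_apply, Matrix.star_apply] using this
  · have := congrFun (congrFun hww' i) j
    simpa [Matrix.mul_apply, Matrix.one_apply, Matrix.star_apply] using this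
  · have := congrArg (fun x => (r i : ℂ) • x) (congrFun (congrFun hy1 i) j)
    simp only [Matrix.mul_apply, Matrix.one_apply, Matrix.star_apply, Matrix.transpose_apply,
      Matrix.of_apply, Finset.smul_sum, smul_mul_assoc, smul_smul] at this
    refine Eq.trans (Finset.sum_congr rfl fun k _ => ?_) (this.trans ?_)
    · congr 1
      field_simp [hr0 i]
    · split_ifs <;> simp
  · have := congrArg (fun x => (r j : ℂ)⁻¹ • x) (congrFun (congrFun hy2 i) j)
    simp only [Matrix.mul_apply, Matrix.one_apply, Matrix.star_apply, Matrix.transpose_apply,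
      Matrix.of_apply, Finset.smul_sum, mul_smul_comm, smul_smul] at this
    refine Eq.trans (Finset.sum_congr rfl fun k _ => ?_) (this.trans ?_)
    · congr 1
      field_simp [hr0 j, hr0 k]
    · split_ifs with h <;> simp [h]
  · -- if `T` intertwines `w` with itself, then `V T V*` intertwines `u` with itself
    intro T hT
    have hTw : scalarMatrix A T * w = w * scalarMatrix A T := by
      ext i j
      simpa [Matrix.mul_apply, scalarMatrix_apply, Algebra.smul_def, Algebra.commutes] using hT i j
    obtain ⟨c, hc⟩ := hu.schur (V * T * star V) (by
      have hu' : u = scalarMatrix A V * w * scalarMatrix A (star V) := by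
        calc u = scalarMatrix A V * scalarMatrix A (star V) * u * (scalarMatrix A V *
              scalarMatrix A (star V)) := by rw [hs', one_mul, mul_one]
          _ = _ := by rw [hw]; simp only [mul_assoc]
      rw [hu']
      simp only [scalarMatrix_mul]
      calc _ = scalarMatrix A V * (scalarMatrix A T * (scalarMatrix A (star V) * scalarMatrix A V) *
            w) * scalarMatrix A (star V) := by simp only [mul_assoc]
        _ = scalarMatrix A V * (w * (scalarMatrix A (star V) * scalarMatrix A V) * scalarMatrix A T)
            * scalarMatrix A (star V) := by rw [hs, mul_one, mul_one, hTw]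
        _ = _ := by simp only [mul_assoc])
    refine ⟨c, ?_⟩
    calc T = star V * (V * T * star V) * V := by
          rw [mul_assoc V, ← mul_assoc, hVV, one_mul, mul_assoc, hVV, mul_one]
      _ = c • 1 := by rw [hc, mul_smul_comm, mul_one, smul_mul_assoc, hVV]

end

section

/-! ### Compact operators and the Toeplitz algebra -/

section Compact

variable {E : Type*} [NormedAddCommGroup E] [InnerProductSpace ℂ E]

/-- A bounded net of operators converging strongly to zero converges in norm when multiplied from
the right by a compact operator. -/
theorem tendsto_mul_of_isCompactOperator {ι : Type*} {l : Filter ι} {F : ι → E →L[ℂ] E}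
    (hF : ∀ i, ‖F i‖ ≤ 1) (h : ∀ x, Tendsto (fun i => F i x) l (𝓝 0)) {k : E →L[ℂ] E}
    (hk : IsCompactOperator k) : Tendsto (fun i => F i * k) l (𝓝 0) := by
  obtain ⟨K, hK, hsub⟩ := hk.image_closedBall_subset_compact (𝕜₁ := ℂ) (f := (k : E →ₗ[ℂ] E)) 1
  rw [Metric.tendsto_nhds]
  intro ε hε
  obtain ⟨t, ht, hcover⟩ := Metric.totallyBounded_iff.1 hK.totallyBounded (ε / 4) (by positivity)
  have hev : ∀ᶠ i in l, ∀ y ∈ t, ‖F i y‖ < ε / 4 := by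
    rw [eventually_all_finite ht]
    intro y _
    have := Metric.tendsto_nhds.1 (h y) (ε / 4) (by positivity)
    simpa using this
  filter_upwards [hev] with i hi
  rw [dist_zero_right]
  refine lt_of_le_of_lt (b := ε / 2) ?_ (by linarith)
  refine ContinuousLinearMap.opNorm_le_of_unit_norm (by positivity) fun x hx => ?_
  have hkx : k x ∈ K := hsub ⟨x, by simp [hx], rfl⟩
  obtain ⟨y, hy, hyx⟩ := Set.mem_iUnion₂.1 (hcover hkx)
  calc ‖(F i * k) x‖ = ‖F i (k x - y) + F i y‖ := by
        rw [← map_add, sub_add_cancel]; rfl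
    _ ≤ ‖F i‖ * ‖k x - y‖ + ‖F i y‖ :=
        (norm_add_le _ _).trans (add_le_add_left ((F i).le_opNorm _) _)
    _ ≤ 1 * (ε / 4) + ε / 4 := by
        gcongr
        · exact hF i
        · rw [← dist_eq_norm]; exact (Metric.mem_ball.1 hyx).le
        · exact (hi y hy).le
    _ = ε / 2 := by ring

theorem tendsto_starProjection_mul [CompleteSpace E] {ι : Type*} [Preorder ι]
    {U : ι → Submodule ℂ E} [∀ i, (U i).HasOrthogonalProjection] (hU : Monotone U)
    (hd : ⊤ ≤ (⨆ i, U i).topologicalClosure) {k : E →L[ℂ] E} (hk : IsCompactOperator k) :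
    Tendsto (fun i => (U i).starProjection * k) atTop (𝓝 k) := by
  have h := tendsto_mul_of_isCompactOperator (l := atTop)
    (F := fun i => (U i)ᗮ.starProjection) (fun i => (U i)ᗮ.starProjection_norm_le) (fun x => ?_) hk
  · have h2 := (tendsto_const_nhds (x := k)).sub h
    rw [sub_zero] at h2
    refine h2.congr fun i => ?_
    ext x
    simp [Submodule.starProjection_orthogonal]
  · have h1 := (tendsto_const_nhds (x := x)).sub
      (Submodule.starProjection_tendsto_self U hU x hd)
    rw [sub_self] at h1
    refine h1.congr fun i => ?_
    simp [Submodule.starProjection_orthogonal]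

theorem isCompactOperator_rankOne (ξ η : E) :
    IsCompactOperator (InnerProductSpace.rankOne ℂ ξ η : E →L[ℂ] E) := by
  have h : (InnerProductSpace.rankOne ℂ ξ η : E →L[ℂ] E) =
      (ContinuousLinearMap.toSpanSingleton ℂ ξ).comp (innerSL ℂ η) := by
    ext x
    simp
  rw [h]
  have h1 : IsCompactOperator (innerSL ℂ η : E →L[ℂ] ℂ) :=
    isCompactOperator_of_locallyCompactSpace_dom _
  exact h1.clm_comp (ContinuousLinearMap.toSpanSingleton ℂ ξ)

end Compact

/-- The bounded operators on `ℓ₂(ℤ₊)`. -/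
abbrev BEll : Type := EllTwo →L[ℂ] EllTwo

/-- The standard basis vector `e_n`. -/
abbrev ellBasis (n : ℕ) : EllTwo := lp.single 2 n (1 : ℂ)

/-- The unilateral shift as a bounded operator. -/
abbrev shiftOp : BEll := shift.toContinuousLinearMap

theorem inner_ellBasis (n : ℕ) (x : EllTwo) : inner ℂ (ellBasis n) x = x n := by
  rw [ellBasis, lp.inner_single_left]
  simp

theorem star_shiftOp_mul : star shiftOp * shiftOp = 1 := by
  rw [ContinuousLinearMap.star_eq_adjoint]
  exact ContinuousLinearMap.norm_map_iff_adjoint_comp_self shiftOp |>.1 shift.norm_map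

theorem star_shiftOp_apply (x : EllTwo) (n : ℕ) : star shiftOp x n = x (n + 1) := by
  rw [← inner_ellBasis, ContinuousLinearMap.star_eq_adjoint,
    ContinuousLinearMap.adjoint_inner_right, ← inner_ellBasis (n + 1)]
  exact congrArg (fun y => inner ℂ y x) (shift_single n)

theorem one_sub_shiftOp_mul_star :
    1 - shiftOp * star shiftOp = InnerProductSpace.rankOne ℂ (ellBasis 0) (ellBasis 0) := by
  ext x n
  rw [InnerProductSpace.rankOne_apply, inner_ellBasis]
  cases n with
  | zero =>
    change x 0 - (0 : ℂ) = x 0 * _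
    simp
  | succ n =>
    change x (n + 1) - star shiftOp x n = x 0 * _
    rw [star_shiftOp_apply]
    simp

theorem shiftOp_pow_apply (i : ℕ) : (shiftOp ^ i) (ellBasis 0) = ellBasis i := by
  induction i with
  | zero => simp
  | succ i ih =>
    rw [pow_succ', mul_apply_eq_comp, ih]
    exact shift_single i

theorem rankOne_ellBasis (i j : ℕ) :
    (InnerProductSpace.rankOne ℂ (ellBasis i) (ellBasis j) : BEll) =
      shiftOp ^ i * (1 - shiftOp * star shiftOp) * star shiftOp ^ j := by
  rw [one_sub_shiftOp_mul_star, ← star_pow]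
  ext1 x
  rw [mul_apply_eq_comp, mul_apply_eq_comp, InnerProductSpace.rankOne_apply,
    InnerProductSpace.rankOne_apply, map_smul, shiftOp_pow_apply,
    ContinuousLinearMap.star_eq_adjoint, ContinuousLinearMap.adjoint_inner_right,
    shiftOp_pow_apply]

/-- A closed subspace of operators that contains the matrix units contains every compact
operator. -/
theorem mem_of_isCompactOperator {M : Submodule ℂ BEll} (hM : IsClosed (M : Set BEll))
    (h : ∀ i j, (InnerProductSpace.rankOne ℂ (ellBasis i) (ellBasis j) : BEll) ∈ M) {k : BEll}
    (hk : IsCompactOperator k) : k ∈ M := by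
  have hs : ∀ x : EllTwo, HasSum (fun i => x i • ellBasis i) x := fun x => by
    have := lp.hasSum_single (p := 2) (by norm_num) x
    refine this.congr_fun fun i => ?_
    rw [ellBasis, ← lp.single_smul, smul_eq_mul, mul_one]
  have h1 : ∀ ξ j, (InnerProductSpace.rankOne ℂ ξ (ellBasis j) : BEll) ∈ M := fun ξ j => by
    have h2 := (hs ξ).mapL ((InnerProductSpace.rankOne ℂ (E := EllTwo) (F := EllTwo)).flip
      (ellBasis j))
    exact hM.mem_of_tendsto h2 (Eventually.of_forall fun s => sum_mem fun i _ => by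
      rw [map_smul]; exact M.smul_mem _ (h i j))
  have h2 : ∀ ξ η, (InnerProductSpace.rankOne ℂ ξ η : BEll) ∈ M := fun ξ η => by
    have h2 := (hs η).map (InnerProductSpace.rankOne ℂ (E := EllTwo) (F := EllTwo) ξ)
      (ContinuousLinearMap.continuous _)
    exact hM.mem_of_tendsto h2 (Eventually.of_forall fun s => sum_mem fun i _ => by
      simp only [Function.comp_apply, map_smulₛₗ]; exact M.smul_mem _ (h1 ξ i))
  let U : Finset ℕ → Submodule ℂ EllTwo := fun s => Submodule.span ℂ (ellBasis '' s)
  have hfin : ∀ s, FiniteDimensional ℂ (U s) := fun s =>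
    FiniteDimensional.span_of_finite ℂ (s.finite_toSet.image _)
  have hU : Monotone U := fun s t hst => Submodule.span_mono (Set.image_mono (by simpa using hst))
  have hd : ⊤ ≤ (⨆ i, U i).topologicalClosure := fun x _ =>
    mem_closure_of_tendsto (hs x) (Eventually.of_forall fun s => by
      refine (le_iSup U s) (sum_mem fun i hi => Submodule.smul_mem _ _ ?_)
      exact Submodule.subset_span ⟨i, hi, rfl⟩)
  refine hM.mem_of_tendsto (tendsto_starProjection_mul hU hd hk) (Eventually.of_forall fun s => ?_)
  rw [(stdOrthonormalBasis ℂ (U s)).starProjection_eq_sum_rankOne, Finset.sum_mul]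
  refine sum_mem fun i _ => ?_
  have : ∀ ξ η : EllTwo, (InnerProductSpace.rankOne ℂ ξ η : BEll) * k =
      InnerProductSpace.rankOne ℂ ξ (star k η) := fun ξ η => by
    ext1 x
    rw [mul_apply_eq_comp, InnerProductSpace.rankOne_apply, InnerProductSpace.rankOne_apply,
      ContinuousLinearMap.star_eq_adjoint, ContinuousLinearMap.adjoint_inner_left]
  rw [this]
  exact h2 _ _

theorem isCompactOperator_star {k : BEll} (hk : IsCompactOperator k) :
    IsCompactOperator (star k : BEll) := by
  let M : Submodule ℂ BEll :=
    { carrier := {a | IsCompactOperator (star a : BEll)}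
      add_mem' := fun ha hb => by
        simp only [Set.mem_ofPred_eq, star_add] at *; exact ha.add hb
      zero_mem' := by
        simp only [Set.mem_ofPred_eq, star_zero]; exact isCompactOperator_zero
      smul_mem' := fun c a ha => by
        simp only [Set.mem_ofPred_eq, star_smul] at *; exact ha.smul (star c) }
  refine mem_of_isCompactOperator (M := M)
    (isClosed_setOfPred_isCompactOperator.preimage (continuous_star (R := BEll))) (fun i j => ?_) hk
  change IsCompactOperator (star (InnerProductSpace.rankOne ℂ (ellBasis i) (ellBasis j)) : BEll)
  rw [ContinuousLinearMap.star_eq_adjoint, InnerProductSpace.adjoint_rankOne]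
  exact isCompactOperator_rankOne _ _

theorem shiftOp_mem : shiftOp ∈ toeplitzAlgebra := StarAlgebra.elemental.self_mem ℂ _

instance isClosed_toeplitzAlgebra : IsClosed (toeplitzAlgebra : Set BEll) :=
  StarAlgebra.elemental.isClosed ℂ _

theorem rankOne_ellBasis_mem (i j : ℕ) :
    (InnerProductSpace.rankOne ℂ (ellBasis i) (ellBasis j) : BEll) ∈ toeplitzAlgebra := by
  rw [rankOne_ellBasis]
  have hS := shiftOp_mem
  exact mul_mem (mul_mem (pow_mem hS _) (sub_mem (one_mem _) (mul_mem hS (star_mem hS))))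
    (pow_mem (star_mem hS) _)

theorem mem_toeplitzAlgebra_of_isCompactOperator {k : BEll} (hk : IsCompactOperator k) :
    k ∈ toeplitzAlgebra :=
  mem_of_isCompactOperator (M := Subalgebra.toSubmodule toeplitzAlgebra.toSubalgebra)
    isClosed_toeplitzAlgebra rankOne_ellBasis_mem hk

/-- The shift as an element of the Toeplitz algebra. -/
abbrev toeplitzShift : toeplitzAlgebra := ⟨shiftOp, shiftOp_mem⟩

/-- A unital homomorphism from the Toeplitz algebra to `ℂ` kills the compact operators, because it
kills `1 - S S*`. -/
theorem character_eq_zero_of_isCompactOperator (χ : toeplitzAlgebra →⋆ₐ[ℂ] ℂ)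
    {k : toeplitzAlgebra} (hk : IsCompactOperator (k : BEll)) : χ k = 0 := by
  have hχ : Continuous χ := AddMonoidHomClass.continuous_of_bound χ 1 fun a => by
    rw [one_mul]; exact NonUnitalStarAlgHom.norm_apply_le χ a
  let M : Submodule ℂ BEll := (LinearMap.ker χ.toAlgHom.toLinearMap).map
    toeplitzAlgebra.subtype.toAlgHom.toLinearMap
  have hM : IsClosed (M : Set BEll) :=
    isClosed_toeplitzAlgebra.isClosedEmbedding_subtypeVal.isClosedMap _
      (isClosed_singleton.preimage hχ)
  have hS : star toeplitzShift * toeplitzShift = 1 := Subtype.ext star_shiftOp_mul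
  have h0 : χ (1 - toeplitzShift * star toeplitzShift) = 0 := by
    rw [map_sub, map_mul, mul_comm, ← map_mul, hS, map_one, sub_self]
  obtain ⟨k', hk', hkk'⟩ := mem_of_isCompactOperator hM (fun i j => by
    refine ⟨toeplitzShift ^ i * (1 - toeplitzShift * star toeplitzShift) * star toeplitzShift ^ j,
      ?_, (rankOne_ellBasis i j).symm⟩
    change χ _ = 0
    rw [map_mul, map_mul, h0, mul_zero, zero_mul]) hk
  have : k' = k := Subtype.ext hkk'
  rw [← this]
  exact hk'

end

/-! ### Characters of the Toeplitz algebra -/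

/-- A sequence of approximate joint eigenvectors of `S` and `S*` gives a character of the
C*-algebra generated by `S`. -/
theorem exists_character_of_approx_eigenvector {E : Type*} [NormedAddCommGroup E]
    [InnerProductSpace ℂ E] [CompleteSpace E] (S : E →L[ℂ] E) (c : ℂ) (ξ : ℕ → E)
    (hξ : ∀ n, ‖ξ n‖ = 1) (h : Tendsto (fun n => S (ξ n) - c • ξ n) atTop (𝓝 0))
    (h' : Tendsto (fun n => (star S : E →L[ℂ] E) (ξ n) - star c • ξ n) atTop (𝓝 0)) :
    ∃ χ : StarAlgebra.elemental ℂ S →⋆ₐ[ℂ] ℂ, χ ⟨S, StarAlgebra.elemental.self_mem ℂ S⟩ = c := by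
  let l : Ultrafilter ℕ := hyperfilter ℕ
  have hl : (l : Filter ℕ) ≤ atTop := Nat.hyperfilter_le_atTop
  have hbd : ∀ a : E →L[ℂ] E, ∀ n, ‖a (ξ n)‖ ≤ ‖a‖ := fun a n => by
    simpa [hξ] using a.le_opNorm (ξ n)
  have hin : ∀ a : E →L[ℂ] E, ∀ n, ‖inner ℂ (ξ n) (a (ξ n))‖ ≤ ‖a‖ := fun a n =>
    (norm_inner_le_norm _ _).trans (by rw [hξ, one_mul]; exact hbd a n)
  have hinn : ∀ n, inner ℂ (ξ n) (ξ n) = (1 : ℂ) := fun n => by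
    rw [inner_self_eq_norm_sq_to_K, hξ]; simp
  have hex : ∀ a : E →L[ℂ] E, ∃ d : ℂ,
      Tendsto (fun n => (inner ℂ (ξ n) (a (ξ n)) : ℂ)) l (𝓝 d) := fun a => by
    obtain ⟨d, -, hd⟩ := (isCompact_closedBall (0 : ℂ) ‖a‖).ultrafilter_le_nhds'
      (l.map fun n => (inner ℂ (ξ n) (a (ξ n)) : ℂ))
      (mem_map.2 (Eventually.of_forall fun n => by simpa using hin a n))
    exact ⟨d, hd⟩
  -- limits of the vector states along an ultrafilter
  choose φ hφ using hex
  -- an approximate eigenvalue is automatically the limit of the vector states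
  have huniq : ∀ (a : E →L[ℂ] E) (d : ℂ), Tendsto (fun n => a (ξ n) - d • ξ n) l (𝓝 0) →
      φ a = d := fun a d hd => by
    refine tendsto_nhds_unique (hφ a) ?_
    have h1 : Tendsto (fun n => (inner ℂ (ξ n) (a (ξ n) - d • ξ n) : ℂ)) l (𝓝 0) :=
      squeeze_zero_norm (fun n => (norm_inner_le_norm _ _).trans (by rw [hξ, one_mul]))
        (tendsto_zero_iff_norm_tendsto_zero.1 hd)
    have h2 := h1.add_const d
    rw [zero_add] at h2
    refine h2.congr fun n => ?_
    rw [inner_sub_right, inner_smul_right, hinn]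
    ring
  have hφn : ∀ a b, ‖φ a - φ b‖ ≤ ‖a - b‖ := fun a b => by
    have h1 := ((hφ a).sub (hφ b)).norm
    refine le_of_tendsto h1 (Eventually.of_forall fun n => ?_)
    rw [← inner_sub_right]
    exact hin (a - b) n
  have hadd : ∀ a b : E →L[ℂ] E, Tendsto (fun n => a (ξ n) - φ a • ξ n) l (𝓝 0) →
      Tendsto (fun n => b (ξ n) - φ b • ξ n) l (𝓝 0) →
      Tendsto (fun n => (a + b) (ξ n) - (φ a + φ b) • ξ n) l (𝓝 0) := fun a b ha hb => by
    have := ha.add hb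
    rw [add_zero] at this
    refine this.congr fun n => ?_
    rw [add_apply, add_smul]
    abel
  have hmul : ∀ a b : E →L[ℂ] E, Tendsto (fun n => a (ξ n) - φ a • ξ n) l (𝓝 0) →
      Tendsto (fun n => b (ξ n) - φ b • ξ n) l (𝓝 0) →
      Tendsto (fun n => (a * b) (ξ n) - (φ a * φ b) • ξ n) l (𝓝 0) := fun a b ha hb => by
    have h1 := ((a.continuous.tendsto 0).comp hb).add (ha.const_smul (φ b))
    rw [map_zero, smul_zero, add_zero] at h1
    refine h1.congr fun n => ?_
    simp only [Function.comp_apply, map_sub, map_smul, smul_sub, smul_smul, mul_apply_eq_comp,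
      mul_comm (φ a)]
    abel
  have hconst : ∀ d : ℂ, Tendsto (fun n => (algebraMap ℂ (E →L[ℂ] E) d) (ξ n) - d • ξ n) l
      (𝓝 0) := fun d => by
    refine tendsto_const_nhds.congr fun n => ?_
    rw [Algebra.algebraMap_eq_smul_one, smul_apply, one_apply_eq_self, sub_self]
  have key : ∀ a ∈ StarAlgebra.elemental ℂ S, Tendsto (fun n => a (ξ n) - φ a • ξ n) l (𝓝 0) := by
    intro a ha
    induction ha using StarAlgebra.elemental.induction_on with
    | self => rw [huniq S c (h.mono_left hl)]; exact h.mono_left hl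
    | star_self => rw [huniq _ _ (h'.mono_left hl)]; exact h'.mono_left hl
    | algebraMap d => rw [huniq _ _ (hconst d)]; exact hconst d
    | add a _ b _ ha hb => rw [huniq _ _ (hadd a b ha hb)]; exact hadd a b ha hb
    | mul a _ b _ ha hb => rw [huniq _ _ (hmul a b ha hb)]; exact hmul a b ha hb
    | closure s _ hs v hv =>
      rw [Metric.tendsto_nhds]
      intro ε hε
      obtain ⟨u, hu, huv⟩ := Metric.mem_closure_iff.1 hv (ε / 4) (by positivity)
      filter_upwards [Metric.tendsto_nhds.1 (hs u hu) (ε / 4) (by positivity)] with n hn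
      rw [dist_zero_right] at hn ⊢
      rw [dist_eq_norm] at huv
      have e : v (ξ n) - φ v • ξ n = (v - u) (ξ n) + (u (ξ n) - φ u • ξ n) +
          (φ u - φ v) • ξ n := by
        rw [sub_apply, sub_smul]; abel
      rw [e]
      have h1 := hbd (v - u) n
      have h2 : ‖(φ u - φ v) • ξ n‖ ≤ ‖v - u‖ := by
        rw [norm_smul, hξ, mul_one, norm_sub_rev]; exact hφn v u
      have h3 := norm_add₃_le (a := (v - u) (ξ n)) (b := u (ξ n) - φ u • ξ n)
        (c := (φ u - φ v) • ξ n)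
      linarith
  refine ⟨⟨⟨⟨⟨⟨fun a => φ a, ?_⟩, fun a b => ?_⟩, ?_, fun a b => ?_⟩, fun d => ?_⟩,
    fun a => ?_⟩, ?_⟩
  · exact huniq _ _ (by simp)
  · exact huniq _ _ (hmul _ _ (key a a.2) (key b b.2))
  · exact huniq _ _ (by simp)
  · exact huniq _ _ (hadd _ _ (key a a.2) (key b b.2))
  · exact huniq _ _ (hconst d)
  · refine tendsto_nhds_unique (hφ _) (((hφ a).star).congr fun n => ?_)
    change _ = inner ℂ (ξ n) ((star (a : E →L[ℂ] E)) (ξ n))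
    rw [ContinuousLinearMap.star_eq_adjoint, ContinuousLinearMap.adjoint_inner_right]
    exact inner_conj_symm _ _
  · exact huniq _ _ (h.mono_left hl)

theorem orthonormal_ellBasis : Orthonormal ℂ ellBasis := by
  rw [orthonormal_iff_ite]
  intro i j
  rw [inner_ellBasis, ellBasis, lp.single_apply, Pi.single_apply]

/-- Every point of the unit circle is the value at the shift of a character; approximate
eigenvectors are the truncations of the formal eigenvector `∑ c̄ ^ j e_j`. -/
theorem exists_character (c : Circle) : ∃ χ : toeplitzAlgebra →⋆ₐ[ℂ] ℂ, χ toeplitzShift = c := by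
  have hc : (c : ℂ) * star (c : ℂ) = 1 := by
    rw [← starRingEnd_apply, Complex.mul_conj, Circle.normSq_coe]; simp
  let y : ℕ → EllTwo := fun n => ∑ j ∈ Finset.range (n + 1), star (c : ℂ) ^ j • ellBasis j
  have hy : ∀ n, ‖y n‖ = √(n + 1) := fun n => by
    rw [← Real.sqrt_sq (norm_nonneg (y n))]
    congr 1
    have h1 := orthonormal_ellBasis.inner_sum (fun j => star (c : ℂ) ^ j)
      (fun j => star (c : ℂ) ^ j) (Finset.range (n + 1))
    rw [inner_self_eq_norm_sq_to_K] at h1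
    have h2 : ∀ j : ℕ, (starRingEnd ℂ) (star (c : ℂ) ^ j) * star (c : ℂ) ^ j = 1 := fun j => by
      rw [starRingEnd_apply, star_pow, star_star, ← mul_pow, hc, one_pow]
    simp only [h2, Finset.sum_const, Finset.card_range, nsmul_eq_mul, mul_one] at h1
    have h3 : ‖y n‖ ^ 2 = ((n + 1 : ℕ) : ℝ) :=
      Complex.ofReal_injective (by rw [Complex.ofReal_pow, Complex.ofReal_natCast]; exact h1)
    rw [h3, Nat.cast_succ]
  -- the sum telescopes
  have hSy : ∀ n, shiftOp (y n) - (c : ℂ) • y n =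
      star (c : ℂ) ^ n • ellBasis (n + 1) - (c : ℂ) • ellBasis 0 := fun n => by
    have hs : ∀ j, shiftOp (ellBasis j) = ellBasis (j + 1) := fun j => shift_single j
    induction n with
    | zero => simp [y, hs]
    | succ n ih =>
      have e : y (n + 1) = y n + star (c : ℂ) ^ (n + 1) • ellBasis (n + 1) :=
        Finset.sum_range_succ _ _
      have e2 : (c : ℂ) * star (c : ℂ) ^ (n + 1) = star (c : ℂ) ^ n := by
        rw [pow_succ', ← mul_assoc, hc, one_mul]
      rw [e, map_add, smul_add, add_sub_add_comm, ih, map_smul, hs, smul_smul, e2]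
      abel
  have hpos : ∀ n : ℕ, 0 < √((n : ℝ) + 1) := fun n => Real.sqrt_pos.2 (by positivity)
  obtain ⟨ξ, hξ⟩ : ∃ ξ : ℕ → EllTwo, ∀ n, ξ n = ((√((n : ℝ) + 1))⁻¹ : ℂ) • y n := ⟨_, fun _ => rfl⟩
  have hsmall : Tendsto (fun n => shiftOp (ξ n) - (c : ℂ) • ξ n) atTop (𝓝 0) := by
    have ht : Tendsto (fun n : ℕ => (√((n : ℝ) + 1))⁻¹ * 2) atTop (𝓝 0) := by
      have h1 : Tendsto (fun n : ℕ => √((n : ℝ) + 1)) atTop atTop :=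
        Real.tendsto_sqrt_atTop.comp
          (tendsto_atTop_add_const_right _ _ tendsto_natCast_atTop_atTop)
      simpa using h1.inv_tendsto_atTop.mul_const 2
    refine squeeze_zero_norm (fun n => ?_) ht
    have e : shiftOp (ξ n) - (c : ℂ) • ξ n =
        ((√((n : ℝ) + 1))⁻¹ : ℂ) • (shiftOp (y n) - (c : ℂ) • y n) := by
      rw [hξ, smul_sub, map_smul, smul_comm]
    rw [e, norm_smul, hSy]
    have h1 : ∀ j, ‖ellBasis j‖ = 1 := orthonormal_ellBasis.1
    have h2 : ‖star (c : ℂ)‖ = 1 := by rw [norm_star, Circle.norm_coe]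
    have h3 : ‖star (c : ℂ) ^ n • ellBasis (n + 1) - (c : ℂ) • ellBasis 0‖ ≤ 2 := by
      refine (norm_sub_le _ _).trans ?_
      rw [norm_smul, norm_smul, norm_pow, h1, h1, h2, Circle.norm_coe]
      norm_num
    rw [norm_inv, Complex.norm_real, Real.norm_of_nonneg (hpos n).le]
    gcongr
  refine exists_character_of_approx_eigenvector shiftOp c ξ (fun n => ?_) hsmall ?_
  · rw [hξ, norm_smul, hy, norm_inv, Complex.norm_real, Real.norm_of_nonneg (hpos n).le,
      inv_mul_cancel₀ (hpos n).ne']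
  · -- since `S* S = 1`, applying `- c̄ S*` to `S ξ - c ξ` gives `S* ξ - c̄ ξ`
    have h1 := (((star shiftOp : BEll).continuous.tendsto 0).comp hsmall).const_smul
      (-star (c : ℂ))
    rw [map_zero, smul_zero] at h1
    refine h1.congr fun n => ?_
    have h2 : (star shiftOp : BEll) (shiftOp (ξ n)) = ξ n :=
      DFunLike.congr_fun star_shiftOp_mul (ξ n)
    rw [Function.comp_apply, map_sub, map_smul, h2, smul_sub, smul_smul, neg_mul, mul_comm (star _),
      hc, neg_smul, neg_smul, one_smul]
    abel

theorem star_character_mul (χ : toeplitzAlgebra →⋆ₐ[ℂ] ℂ) :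
    star (χ toeplitzShift) * χ toeplitzShift = 1 := by
  have hS : star toeplitzShift * toeplitzShift = 1 := Subtype.ext star_shiftOp_mul
  rw [← map_star, ← map_mul, hS, map_one]

theorem mem_sphere_of_star_mul {c : ℂ} (h : star c * c = 1) : c ∈ Submonoid.unitSphere ℂ := by
  refine mem_sphere_zero_iff_norm.2 ?_
  have := congrArg norm h
  rw [norm_mul, norm_star, norm_one] at this
  nlinarith [norm_nonneg c]

/-- The point of the circle that determines a character. -/
def symbolPoint (χ : toeplitzAlgebra →⋆ₐ[ℂ] ℂ) : Circle :=
  ⟨χ toeplitzShift, mem_sphere_of_star_mul (star_character_mul χ)⟩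

@[simp] theorem coe_symbolPoint (χ : toeplitzAlgebra →⋆ₐ[ℂ] ℂ) :
    (symbolPoint χ : ℂ) = χ toeplitzShift := rfl

theorem symbolPoint_injective : Function.Injective symbolPoint := fun χ ψ h => by
  have h1 : Continuous χ := AddMonoidHomClass.continuous_of_bound χ 1 fun a => by
    rw [one_mul]; exact NonUnitalStarAlgHom.norm_apply_le χ a
  have h2 : Continuous ψ := AddMonoidHomClass.continuous_of_bound ψ 1 fun a => by
    rw [one_mul]; exact NonUnitalStarAlgHom.norm_apply_le ψ a
  exact StarAlgebra.elemental.starAlgHomClass_ext ℂ h1 h2 (congrArg Subtype.val h)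

/-! ### The symbol map of the Toeplitz algebra -/

/-- The unitary dilation `[[S, 1 - S S*], [0, S*]]` of the shift. -/
def shiftDilation : CStarMatrix (Fin 2) (Fin 2) BEll :=
  CStarMatrix.ofMatrix !![shiftOp, 1 - shiftOp * star shiftOp; 0, star shiftOp]

theorem star_shiftDilation_mul : star shiftDilation * shiftDilation = 1 := by
  have h := star_shiftOp_mul
  have h2 : star shiftOp * (1 - shiftOp * star shiftOp) = 0 := by
    rw [mul_sub, ← mul_assoc, h]; simp
  have h3 : (1 - shiftOp * star shiftOp) * shiftOp = 0 := by
    rw [sub_mul, mul_assoc, h]; simp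
  have h4 : (1 - shiftOp * star shiftOp) * (1 - shiftOp * star shiftOp) + shiftOp * star shiftOp =
      1 := by
    rw [mul_sub, ← mul_assoc, h3]; simp
  ext1 i j
  fin_cases i <;> fin_cases j <;>
    simp [CStarMatrix.mul_apply, CStarMatrix.star_apply, shiftDilation,
      h, h2, h3, h4]

theorem shiftDilation_mul_star : shiftDilation * star shiftDilation = 1 := by
  have h := star_shiftOp_mul
  have h2 : star shiftOp * (1 - shiftOp * star shiftOp) = 0 := by
    rw [mul_sub, ← mul_assoc, h]; simp
  have h3 : (1 - shiftOp * star shiftOp) * shiftOp = 0 := by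
    rw [sub_mul, mul_assoc, h]; simp
  have h4 : shiftOp * star shiftOp + (1 - shiftOp * star shiftOp) * (1 - shiftOp * star shiftOp) =
      1 := by
    rw [mul_sub, ← mul_assoc, h3]; simp
  ext1 i j
  fin_cases i <;> fin_cases j <;>
    simp [CStarMatrix.mul_apply, CStarMatrix.star_apply, shiftDilation,
      h, h2, h3, h4]

instance isStarNormal_shiftDilation : IsStarNormal shiftDilation :=
  ⟨by rw [Commute, SemiconjBy, star_shiftDilation_mul, shiftDilation_mul_star]⟩

/-- The commutative C*-algebra generated by the dilation; it is a copy of `C(𝕋)`. -/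
abbrev dilationAlgebra : StarSubalgebra ℂ (CStarMatrix (Fin 2) (Fin 2) BEll) :=
  StarAlgebra.elemental ℂ shiftDilation

theorem continuous_entry (i j : Fin 2) :
    Continuous fun x : CStarMatrix (Fin 2) (Fin 2) BEll => x i j :=
  (LipschitzWith.of_dist_le_mul (K := 1) fun x y => by
    rw [dist_eq_norm, dist_eq_norm, NNReal.coe_one, one_mul]
    exact CStarMatrix.norm_entry_le_norm (M := x - y)).continuous

/-- The matrices whose upper left entry is in the Toeplitz algebra and whose off-diagonal entries
are compact. -/
def cornerAlgebra : StarSubalgebra ℂ (CStarMatrix (Fin 2) (Fin 2) BEll) where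
  carrier := {x | x 0 0 ∈ toeplitzAlgebra ∧ IsCompactOperator (x 0 1) ∧ IsCompactOperator (x 1 0)}
  mul_mem' := by
    rintro x y ⟨hx, hx1, hx2⟩ ⟨hy, hy1, hy2⟩
    simp only [Set.mem_ofPred_eq, CStarMatrix.mul_apply, Fin.sum_univ_two]
    refine ⟨add_mem (mul_mem hx hy) (mem_toeplitzAlgebra_of_isCompactOperator ?_), ?_, ?_⟩
    · exact hx1.comp_clm (y 1 0)
    · exact (hy1.clm_comp (x 0 0)).add (hx1.comp_clm (y 1 1))
    · exact (hx2.comp_clm (y 0 0)).add (hy2.clm_comp (x 1 1))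
  add_mem' := by
    rintro x y ⟨hx, hx1, hx2⟩ ⟨hy, hy1, hy2⟩
    exact ⟨add_mem hx hy, hx1.add hy1, hx2.add hy2⟩
  algebraMap_mem' c := by
    simp only [Set.mem_ofPred_eq, CStarMatrix.algebraMap_apply]
    exact ⟨algebraMap_mem _ c, isCompactOperator_zero, isCompactOperator_zero⟩
  star_mem' := by
    rintro x ⟨hx, hx1, hx2⟩
    exact ⟨star_mem hx, isCompactOperator_star hx2, isCompactOperator_star hx1⟩

theorem dilationAlgebra_le : dilationAlgebra ≤ cornerAlgebra := by
  refine StarAlgebra.elemental.le_of_mem ?_ ⟨?_, ?_, ?_⟩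
  · refine IsClosed.inter (isClosed_toeplitzAlgebra.preimage (continuous_entry 0 0))
      (IsClosed.inter ?_ ?_)
    · exact isClosed_setOfPred_isCompactOperator.preimage (continuous_entry 0 1)
    · exact isClosed_setOfPred_isCompactOperator.preimage (continuous_entry 1 0)
  · exact shiftOp_mem
  · change IsCompactOperator (1 - shiftOp * star shiftOp : BEll)
    rw [one_sub_shiftOp_mul_star]
    exact isCompactOperator_rankOne _ _
  · exact isCompactOperator_zero

/-- The upper left corner of an element of the dilation algebra. -/
def corner (x : dilationAlgebra) : toeplitzAlgebra :=
  ⟨(x : CStarMatrix (Fin 2) (Fin 2) BEll) 0 0, (dilationAlgebra_le x.2).1⟩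

/-- Taking the corner is multiplicative up to compact operators, so it composes with characters. -/
def cornerHom (χ : toeplitzAlgebra →⋆ₐ[ℂ] ℂ) : dilationAlgebra →⋆ₐ[ℂ] ℂ where
  toFun x := χ (corner x)
  map_one' := (congrArg χ (Subtype.ext rfl)).trans (map_one χ)
  map_mul' x y := by
    rw [← map_mul, ← sub_eq_zero, ← map_sub]
    refine character_eq_zero_of_isCompactOperator χ ?_
    have h : (corner (x * y) - corner x * corner y : toeplitzAlgebra) =
        ((x : CStarMatrix (Fin 2) (Fin 2) BEll) 0 1 *
          (y : CStarMatrix (Fin 2) (Fin 2) BEll) 1 0 : BEll) := by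
      change ((x : CStarMatrix (Fin 2) (Fin 2) BEll) * (y : CStarMatrix (Fin 2) (Fin 2) BEll)) 0 0 -
        (x : CStarMatrix (Fin 2) (Fin 2) BEll) 0 0 *
        (y : CStarMatrix (Fin 2) (Fin 2) BEll) 0 0 = _
      rw [CStarMatrix.mul_apply, Fin.sum_univ_two, add_sub_cancel_left]
    rw [h]
    exact (dilationAlgebra_le x.2).2.1.comp_clm _
  map_zero' := (congrArg χ (Subtype.ext rfl)).trans (map_zero χ)
  map_add' x y := (congrArg χ (Subtype.ext rfl)).trans (map_add χ (corner x) (corner y))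
  commutes' c := (congrArg χ (Subtype.ext (by
    change (algebraMap ℂ (CStarMatrix (Fin 2) (Fin 2) BEll) c) 0 0 = _
    rw [CStarMatrix.algebraMap_apply, if_pos rfl]
    rfl))).trans (AlgHomClass.commutes χ c)
  map_star' x := (congrArg χ (Subtype.ext rfl)).trans (map_star χ (corner x))

/-- Every element of the Toeplitz algebra is a limit of sums of corners and compact operators. -/
theorem exists_corner_near (a : toeplitzAlgebra) {ε : ℝ} (hε : 0 < ε) :
    ∃ (x : dilationAlgebra) (k : toeplitzAlgebra), IsCompactOperator (k : BEll) ∧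
      ‖a - (corner x + k)‖ < ε := by
  let D : StarSubalgebra ℂ BEll :=
    { carrier := {a | ∃ x : dilationAlgebra, IsCompactOperator (a - corner x : BEll)}
      mul_mem' := by
        rintro a b ⟨x, hx⟩ ⟨y, hy⟩
        refine ⟨x * y, ?_⟩
        have e : a * b - (corner (x * y) : BEll) = a * (b - corner y) + (a - corner x) * corner y -
            (x : CStarMatrix (Fin 2) (Fin 2) BEll) 0 1 *
            (y : CStarMatrix (Fin 2) (Fin 2) BEll) 1 0 := by
          have : (corner (x * y) : BEll) = corner x * corner y +
              (x : CStarMatrix (Fin 2) (Fin 2) BEll) 0 1 *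
              (y : CStarMatrix (Fin 2) (Fin 2) BEll) 1 0 := by
            change ((x : CStarMatrix (Fin 2) (Fin 2) BEll) *
              (y : CStarMatrix (Fin 2) (Fin 2) BEll)) 0 0 = _
            rw [CStarMatrix.mul_apply, Fin.sum_univ_two]
            rfl
          rw [this]
          noncomm_ring
        rw [e]
        exact ((hy.clm_comp a).add (hx.comp_clm _)).sub ((dilationAlgebra_le x.2).2.1.comp_clm _)
      add_mem' := by
        rintro a b ⟨x, hx⟩ ⟨y, hy⟩
        refine ⟨x + y, ?_⟩
        have e : a + b - (corner (x + y) : BEll) = (a - corner x) + (b - corner y) := by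
          change a + b - ((corner x : BEll) + corner y) = _
          abel
        rw [e]
        exact hx.add hy
      algebraMap_mem' := fun c => ⟨algebraMap ℂ _ c, by
        have e : algebraMap ℂ BEll c - (corner (algebraMap ℂ dilationAlgebra c) : BEll) = 0 := by
          change _ - (algebraMap ℂ (CStarMatrix (Fin 2) (Fin 2) BEll) c) 0 0 = _
          rw [CStarMatrix.algebraMap_apply, if_pos rfl, sub_self]
        rw [e]
        exact isCompactOperator_zero⟩
      star_mem' := by
        rintro a ⟨x, hx⟩
        refine ⟨star x, ?_⟩
        have e : star a - (corner (star x) : BEll) = star (a - corner x : BEll) := by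
          rw [star_sub]; rfl
        rw [e]
        exact isCompactOperator_star hx }
  have hle : toeplitzAlgebra ≤ D.topologicalClosure :=
    StarAlgebra.elemental.le_of_mem D.isClosed_topologicalClosure
      (D.le_topologicalClosure ⟨⟨shiftDilation, StarAlgebra.elemental.self_mem ℂ _⟩, by
        have e : shiftOp - (corner ⟨shiftDilation, StarAlgebra.elemental.self_mem ℂ _⟩ : BEll) =
          0 := sub_self _
        rw [e]
        exact isCompactOperator_zero⟩)
  obtain ⟨b, ⟨x, hx⟩, hb⟩ := Metric.mem_closure_iff.1 (hle a.2) ε hε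
  refine ⟨x, ⟨b - corner x, mem_toeplitzAlgebra_of_isCompactOperator hx⟩, hx, ?_⟩
  rw [dist_eq_norm] at hb
  refine lt_of_eq_of_lt ?_ hb
  change ‖(a : BEll) - (corner x + (b - corner x))‖ = _
  rw [add_sub_cancel]

/-- Every character of the dilation algebra comes from one of the Toeplitz algebra. -/
theorem exists_cornerHom_eq (ψ : WeakDual.characterSpace ℂ dilationAlgebra) :
    ∃ χ : toeplitzAlgebra →⋆ₐ[ℂ] ℂ, ∀ x, ψ x = cornerHom χ x := by
  let U : dilationAlgebra := ⟨shiftDilation, StarAlgebra.elemental.self_mem ℂ _⟩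
  have hU : star U * U = 1 := Subtype.ext star_shiftDilation_mul
  have hc : star (ψ U) * ψ U = 1 := by rw [← map_star, ← map_mul, hU, map_one]
  obtain ⟨χ, hχ⟩ := exists_character ⟨ψ U, mem_sphere_of_star_mul hc⟩
  refine ⟨χ, fun x => ?_⟩
  let ψ' : dilationAlgebra →⋆ₐ[ℂ] ℂ := StarAlgHomClass.toStarAlgHom ψ
  have h2 : Continuous (cornerHom χ) := AddMonoidHomClass.continuous_of_bound _ 1 fun a => by
    rw [one_mul]; exact NonUnitalStarAlgHom.norm_apply_le _ a
  exact DFunLike.congr_fun (StarAlgebra.elemental.starAlgHomClass_ext ℂ (φ := ψ')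
    (ψ := cornerHom χ) (map_continuous ψ) h2 hχ.symm) x

/-- An element of the Toeplitz algebra with zero symbol is compact. -/
theorem isCompactOperator_of_forall_character {a : toeplitzAlgebra}
    (ha : ∀ χ : toeplitzAlgebra →⋆ₐ[ℂ] ℂ, χ a = 0) : IsCompactOperator (a : BEll) := by
  refine isClosed_setOfPred_isCompactOperator.closure_subset ?_
  rw [Metric.mem_closure_iff]
  intro ε hε
  obtain ⟨x, k, hk, hx⟩ := exists_corner_near a (ε := ε / 2) (by positivity)
  refine ⟨k, hk, ?_⟩
  -- the norm of `x` is the supremum of its values at the characters `cornerHom χ`, which are small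
  -- because `a` has zero symbol
  have hxn : ‖x‖ ≤ ε / 2 := by
    have hn : ‖gelfandStarTransform dilationAlgebra x‖ = ‖x‖ :=
      NonUnitalStarAlgHom.norm_map (gelfandStarTransform dilationAlgebra)
        (gelfandStarTransform dilationAlgebra).injective x
    rw [← hn, ContinuousMap.norm_le _ (by positivity)]
    intro ψ
    obtain ⟨χ, hχ⟩ := exists_cornerHom_eq ψ
    change ‖ψ x‖ ≤ _
    have e : ψ x = -χ (a - (corner x + k)) := by
      rw [map_sub, map_add, ha, character_eq_zero_of_isCompactOperator χ hk, hχ]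
      simp [cornerHom]
    rw [e, norm_neg]
    exact (NonUnitalStarAlgHom.norm_apply_le χ _).trans hx.le
  have hc : ‖corner x‖ ≤ ‖x‖ :=
    CStarMatrix.norm_entry_le_norm (M := (x : CStarMatrix (Fin 2) (Fin 2) BEll))
  have e : (a : BEll) - k = ((a - (corner x + k) : toeplitzAlgebra) : BEll) + corner x := by
    change _ = (a : BEll) - (corner x + k) + corner x
    abel
  rw [dist_eq_norm, e]
  calc _ ≤ ‖a - (corner x + k)‖ + ‖corner x‖ := norm_add_le _ _
    _ < ε / 2 + ε / 2 := add_lt_add_of_lt_of_le hx (hc.trans hxn)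
    _ = ε := by ring

/-- Every continuous function on the circle is the symbol of an element of the Toeplitz algebra. -/
theorem exists_symbol (g : C(Circle, ℂ)) :
    ∃ a : toeplitzAlgebra, ∀ χ : toeplitzAlgebra →⋆ₐ[ℂ] ℂ, χ a = g (symbolPoint χ) := by
  let U : dilationAlgebra := ⟨shiftDilation, StarAlgebra.elemental.self_mem ℂ _⟩
  have hU : star U * U = 1 := Subtype.ext star_shiftDilation_mul
  have hc : ∀ ψ : WeakDual.characterSpace ℂ dilationAlgebra, star (ψ U) * ψ U = 1 := fun ψ => by
    rw [← map_star, ← map_mul, hU, map_one]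
  let p : C(WeakDual.characterSpace ℂ dilationAlgebra, Circle) :=
    ⟨fun ψ => ⟨ψ U, mem_sphere_of_star_mul (hc ψ)⟩,
      ((WeakDual.gelfandTransform ℂ dilationAlgebra U).continuous).subtype_mk _⟩
  refine ⟨corner ((gelfandStarTransform dilationAlgebra).symm (g.comp p)), fun χ => ?_⟩
  let ψ : WeakDual.characterSpace ℂ dilationAlgebra :=
    WeakDual.CharacterSpace.equivAlgHom.symm (cornerHom χ).toAlgHom
  have h := DFunLike.congr_fun
    ((gelfandStarTransform dilationAlgebra).apply_symm_apply (g.comp p)) ψ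
  exact h

/-! ### Index obstructions -/

/-- A proper power of the shift is not a compact perturbation of an invertible operator: by the
Fredholm alternative it would be surjective, since it is injective. -/
theorem eq_zero_of_shiftOp_pow_eq_add {m : ℕ} {b k : BEll} (hb : IsUnit b)
    (hk : IsCompactOperator k) (h : shiftOp ^ m = b + k) : m = 0 := by
  obtain ⟨b, rfl⟩ := hb
  have hinj : Function.Injective (shiftOp ^ m) := by
    have h1 : star shiftOp ^ m * shiftOp ^ m = 1 := by
      clear h
      induction m with
      | zero => simp
      | succ m ih =>
        rw [pow_succ, pow_succ', mul_assoc, ← mul_assoc (star shiftOp), star_shiftOp_mul, one_mul,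
          ih]
    exact Function.LeftInverse.injective (g := star shiftOp ^ m) fun x => DFunLike.congr_fun h1 x
  have hK : IsCompactOperator (-((b⁻¹ : BEllˣ) : BEll) * k) := hk.clm_comp (-((b⁻¹ : BEllˣ) : BEll))
  have h1 : 1 - -((b⁻¹ : BEllˣ) : BEll) * k = ((b⁻¹ : BEllˣ) : BEll) * shiftOp ^ m := by
    rw [h, mul_add, Units.inv_mul, neg_mul, sub_neg_eq_add]
  rcases hK.hasEigenvalue_or_mem_resolventSet (one_ne_zero (α := ℂ)) with hev | hres
  · obtain ⟨x, hx, hx0⟩ := hev.exists_hasEigenvector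
    rw [Module.End.mem_eigenspace_iff, one_smul] at hx
    have h2 : (1 - -((b⁻¹ : BEllˣ) : BEll) * k) x = 0 := by
      rw [sub_apply, one_apply_eq_self, sub_eq_zero]
      exact hx.symm
    rw [h1, mul_apply_eq_comp] at h2
    have h3 : (shiftOp ^ m) x = 0 := by
      have := congrArg (b : BEll) h2
      rwa [map_zero, ← mul_apply_eq_comp, Units.mul_inv, one_apply_eq_self] at this
    exact absurd (hinj (h3.trans (map_zero _).symm)) hx0
  · rw [spectrum.mem_resolventSet_iff, map_one, h1, Units.isUnit_units_mul] at hres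
    by_contra hm
    obtain ⟨m, rfl⟩ := Nat.exists_eq_succ_of_ne_zero hm
    obtain ⟨s, hs⟩ := hres
    have h4 : (shiftOp ^ (m + 1)) (((s⁻¹ : BEllˣ) : BEll) (ellBasis 0)) = ellBasis 0 := by
      rw [← hs, ← mul_apply_eq_comp, Units.mul_inv, one_apply_eq_self]
    have h5 := congrArg (fun x : EllTwo => x 0) h4
    rw [pow_succ'] at h5
    change (0 : ℂ) = (ellBasis 0 : EllTwo) 0 at h5
    simp at h5

/-- A nowhere vanishing continuous function on the circle is `z ^ m * exp g` for an integer `m`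
and a continuous function `g`. -/
theorem exists_zpow_mul_exp (f : C(Circle, ℂ)) (hf : ∀ z, f z ≠ 0) :
    ∃ (m : ℤ) (g : C(Circle, ℂ)), ∀ z : Circle, f z = (z : ℂ) ^ m * Complex.exp (g z) := by
  let F : C(ℝ, ℂ) := f.comp Circle.exp
  obtain ⟨L, ⟨-, hL⟩, -⟩ := Complex.isCoveringMapOn_exp.existsUnique_continuousMap_lifts F
    (a₀ := 0) (e₀ := Complex.log (F 0)) (Complex.exp_log (hf _)) (fun t => hf _)
  have hL' : ∀ t, Complex.exp (L t) = F t := fun t => congrFun hL t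
  have hper : ∀ t, ∃ n : ℤ, L (t + 2 * Real.pi) = L t + n * (2 * Real.pi * Complex.I) := fun t => by
    rw [← Complex.exp_eq_exp_iff_exists_int, hL', hL']
    exact congrArg f (Circle.periodic_exp t)
  choose n hn using hper
  have hpi : (2 * Real.pi * Complex.I : ℂ) ≠ 0 := Complex.two_pi_I_ne_zero
  -- the increment of the logarithm over a period is continuous and integral, hence constant
  have hcont : Continuous n := by
    rw [Int.isClosedEmbedding_coe_real.isEmbedding.continuous_iff]
    have : (fun t => (n t : ℝ)) = fun t =>
        ((L (t + 2 * Real.pi) - L t) / (2 * Real.pi * Complex.I)).re := by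
      ext t
      rw [hn, add_sub_cancel_left, mul_div_cancel_right₀ _ hpi]
      simp
    change Continuous fun t => (n t : ℝ)
    rw [this]
    fun_prop
  have hconst : ∀ t, n t = n 0 := fun t => PreconnectedSpace.constant inferInstance hcont
  let G : C(ℝ, ℂ) := ⟨fun t => L t - n 0 * (t * Complex.I), by fun_prop⟩
  have hG : ∀ t, G (t + 2 * Real.pi) = G t := fun t => by
    change L (t + 2 * Real.pi) - n 0 * ((t + 2 * Real.pi : ℝ) * Complex.I) =
      L t - n 0 * (t * Complex.I)
    rw [hn, hconst]
    push_cast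
    ring
  have hq : IsQuotientMap Circle.exp :=
    isLocalHomeomorph_circleExp.isOpenMap.isQuotientMap Circle.exp.continuous
      Circle.exp_surjective
  have hfac : Function.FactorsThrough G Circle.exp := fun x y hxy => by
    obtain ⟨k, rfl⟩ := Circle.exp_eq_exp.1 hxy
    exact (show Function.Periodic G (2 * Real.pi) from hG).int_mul k y
  refine ⟨n 0, IsQuotientMap.lift hq G hfac, fun z => ?_⟩
  obtain ⟨t, rfl⟩ := Circle.exp_surjective z
  have hl : IsQuotientMap.lift hq G hfac (Circle.exp t) = G t :=
    DFunLike.congr_fun (IsQuotientMap.lift_comp hq G hfac) t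
  rw [hl]
  change F t = _ * Complex.exp (L t - n 0 * (t * Complex.I))
  rw [← hL', Circle.coe_exp, ← Complex.exp_int_mul, ← Complex.exp_add]
  congr 1
  ring

/-- The characters of the Toeplitz algebra form a circle. -/
def toeplitzCharacterHomeo : WeakDual.characterSpace ℂ toeplitzAlgebra ≃ₜ Circle :=
  Continuous.homeoOfEquivCompactToT2
    (f := Equiv.ofBijective (fun φ => symbolPoint (StarAlgHomClass.toStarAlgHom φ)) (by
      refine ⟨fun φ ψ h => ?_, fun c => ?_⟩
      · have := symbolPoint_injective h
        exact DFunLike.ext _ _ fun a => DFunLike.congr_fun this a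
      · obtain ⟨χ, hχ⟩ := exists_character c
        exact ⟨WeakDual.CharacterSpace.equivAlgHom.symm χ.toAlgHom, Subtype.ext hχ⟩))
    (((WeakDual.gelfandTransform ℂ toeplitzAlgebra toeplitzShift).continuous).subtype_mk _)

/-- The symbol of an element of the Toeplitz algebra, as a continuous function on the circle. -/
theorem exists_symbolFun (a : toeplitzAlgebra) :
    ∃ f : C(Circle, ℂ), ∀ χ : toeplitzAlgebra →⋆ₐ[ℂ] ℂ, χ a = f (symbolPoint χ) := by
  refine ⟨(WeakDual.gelfandTransform ℂ toeplitzAlgebra a).comp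
    (toeplitzCharacterHomeo.symm : C(Circle, _)), fun χ => ?_⟩
  let φ : WeakDual.characterSpace ℂ toeplitzAlgebra :=
    WeakDual.CharacterSpace.equivAlgHom.symm χ.toAlgHom
  have h : symbolPoint χ = toeplitzCharacterHomeo φ := rfl
  rw [h]
  change _ = WeakDual.gelfandTransform ℂ toeplitzAlgebra a
    (toeplitzCharacterHomeo.symm (toeplitzCharacterHomeo φ))
  rw [Homeomorph.symm_apply_apply]
  rfl

theorem exp_character (χ : toeplitzAlgebra →⋆ₐ[ℂ] ℂ) (c : toeplitzAlgebra) :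
    χ (NormedSpace.exp c) = Complex.exp (χ c) := by
  have hχ : Continuous χ := AddMonoidHomClass.continuous_of_bound χ 1 fun a => by
    rw [one_mul]; exact NonUnitalStarAlgHom.norm_apply_le χ a
  let +nondep : NormedAlgebra ℚ toeplitzAlgebra := .restrictScalars ℚ ℂ toeplitzAlgebra
  rw [NormedSpace.map_exp χ hχ, Complex.exp_eq_exp_ℂ]

/-- The symbol of an invertible element has no positive winding number: dividing by an exponential
would make a power of the shift a compact perturbation of an invertible operator. -/
theorem eq_zero_of_symbol_eq_pow_mul_exp {a : toeplitzAlgebra} (ha : IsUnit (a : BEll)) {m : ℕ}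
    {g : C(Circle, ℂ)} (h : ∀ χ : toeplitzAlgebra →⋆ₐ[ℂ] ℂ,
      χ a = (symbolPoint χ : ℂ) ^ m * Complex.exp (g (symbolPoint χ))) : m = 0 := by
  obtain ⟨c, hc⟩ := exists_symbol g
  let k : toeplitzAlgebra := toeplitzShift ^ m - a * NormedSpace.exp (-c)
  have hk : IsCompactOperator (k : BEll) := isCompactOperator_of_forall_character fun χ => by
    rw [map_sub, map_mul, map_pow, exp_character, map_neg, hc, h, mul_assoc, ← Complex.exp_add,
      add_neg_cancel, Complex.exp_zero, mul_one, coe_symbolPoint, sub_self]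
  have hu : IsUnit (NormedSpace.exp (-c)) := by
    let +nondep : NormedAlgebra ℚ toeplitzAlgebra := .restrictScalars ℚ ℂ toeplitzAlgebra
    exact NormedSpace.isUnit_exp (-c)
  have hu' : IsUnit ((a * NormedSpace.exp (-c) : toeplitzAlgebra) : BEll) :=
    ha.mul (hu.map toeplitzAlgebra.subtype)
  refine eq_zero_of_shiftOp_pow_eq_add hu' hk ?_
  change shiftOp ^ m = ((a * NormedSpace.exp (-c) : toeplitzAlgebra) : BEll) +
    (shiftOp ^ m - ((a * NormedSpace.exp (-c) : toeplitzAlgebra) : BEll))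
  rw [add_sub_cancel]

/-- The symbol of an invertible element of the Toeplitz algebra has a continuous logarithm. -/
theorem exists_log_symbol {a : toeplitzAlgebra} (ha : IsUnit (a : BEll)) :
    ∃ g : C(Circle, ℂ), ∀ χ : toeplitzAlgebra →⋆ₐ[ℂ] ℂ,
      χ a = Complex.exp (g (symbolPoint χ)) := by
  obtain ⟨f, hf⟩ := exists_symbolFun a
  have hau : IsUnit a := (StarSubalgebra.coe_isUnit toeplitzAlgebra).1 ha
  obtain ⟨m, g, hg⟩ := exists_zpow_mul_exp f fun z => by
    obtain ⟨χ, hχ⟩ := exists_character z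
    have : symbolPoint χ = z := Subtype.ext hχ
    rw [← this, ← hf]
    exact (hau.map χ).ne_zero
  have hfg : ∀ χ : toeplitzAlgebra →⋆ₐ[ℂ] ℂ,
      χ a = (symbolPoint χ : ℂ) ^ m * Complex.exp (g (symbolPoint χ)) := fun χ => by rw [hf, hg]
  refine ⟨g, ?_⟩
  obtain ⟨j, rfl | rfl⟩ := m.eq_nat_or_neg
  · have : j = 0 := eq_zero_of_symbol_eq_pow_mul_exp ha (g := g) fun χ => by
      rw [hfg, zpow_natCast]
    subst this
    intro χ
    rw [hfg]; simp
  · -- a negative winding number is that of the adjoint with the opposite sign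
    have : j = 0 := eq_zero_of_symbol_eq_pow_mul_exp (a := star a) (g := star g) ha.star
      fun χ => by
        have h1 : star ((symbolPoint χ : ℂ)) = (symbolPoint χ : ℂ)⁻¹ := by
          rw [← Circle.coe_inv, Circle.coe_inv_eq_conj]; rfl
        rw [map_star, hfg, star_mul', star_zpow₀, h1, inv_zpow', neg_neg, zpow_natCast]
        congr 1
        exact (Complex.exp_conj _).symm
    subst this
    intro χ
    rw [hfg]; simp

section

/-! ### Operators that commute with a compact operator -/

section

variable {E : Type*} [NormedAddCommGroup E] [InnerProductSpace ℂ E]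

theorem starProjection_mul_of_invariant {U : Submodule ℂ E} [U.HasOrthogonalProjection]
    {a : E →L[ℂ] E} (ha : ∀ x ∈ U, a x ∈ U) :
    U.starProjection * a * U.starProjection = a * U.starProjection := by
  ext x
  rw [mul_apply_eq_comp, mul_apply_eq_comp, mul_apply_eq_comp]
  exact Submodule.starProjection_eq_self_iff.2 (ha _ (Submodule.starProjection_apply_mem _ _))

variable [CompleteSpace E]

theorem commute_starProjection {U : Submodule ℂ E} [U.HasOrthogonalProjection]
    {a : E →L[ℂ] E} (ha : ∀ x ∈ U, a x ∈ U) (ha' : ∀ x ∈ U, (star a : E →L[ℂ] E) x ∈ U) :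
    U.starProjection * a = a * U.starProjection := by
  have hs : star U.starProjection = U.starProjection := isSelfAdjoint_starProjection U
  have h1 := congrArg star (starProjection_mul_of_invariant ha')
  rw [star_mul, star_mul, star_mul, star_star, hs, ← mul_assoc,
    starProjection_mul_of_invariant ha] at h1
  exact h1.symm

/-- Finite sums of eigenspaces of an injective compact selfadjoint operator are finite
dimensional, invariant under everything that commutes with the operator, and their projections
increase to `1`. -/
theorem exists_starProjection_near {D : E →L[ℂ] E} (hD : IsCompactOperator D)
    (hDs : IsSelfAdjoint D) (hDi : Function.Injective D) {k₁ k₂ : E →L[ℂ] E}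
    (hk₁ : IsCompactOperator k₁) (hk₂ : IsCompactOperator k₂) {ε : ℝ} (hε : 0 < ε) :
    ∃ P : E →L[ℂ] E, IsCompactOperator P ∧ IsSelfAdjoint P ∧ P * P = P ∧ ‖1 - P‖ ≤ 1 ∧
      (∀ a : E →L[ℂ] E, a * D = D * a → P * a = a * P) ∧
      ‖(1 - P) * k₁‖ < ε ∧ ‖(1 - P) * k₂‖ < ε := by
  classical
  let V : ℂ → Submodule ℂ E := fun μ => Module.End.eigenspace (D : Module.End ℂ E) μ
  have hV : ∀ μ, FiniteDimensional ℂ (V μ) := fun μ => by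
    rcases eq_or_ne μ 0 with rfl | hμ
    · have : V 0 = ⊥ := by
        rw [Submodule.eq_bot_iff]
        intro x hx
        rw [Module.End.mem_eigenspace_iff, zero_smul] at hx
        exact hDi (hx.trans (map_zero D).symm)
      rw [this]
      infer_instance
    · exact ContinuousLinearMap.finite_dimensional_eigenspace hD μ hμ
  let U : Finset ℂ → Submodule ℂ E := fun F => F.sup V
  have hUf : ∀ F, FiniteDimensional ℂ (U F) := fun F => by
    refine Submodule.finiteDimensional_finset_sup F V
  have hU : Monotone U := fun F F' h => Finset.sup_mono h
  have hd : ⊤ ≤ (⨆ i, U i).topologicalClosure := by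
    have h1 : ⨆ μ, V μ ≤ ⨆ i, U i := iSup_le fun μ =>
      le_trans (by simp [U]) (le_iSup U {μ})
    have h2 := ContinuousLinearMap.orthogonalComplement_iSup_eigenspaces_eq_bot hD
      hDs.isSymmetric
    rw [← Submodule.topologicalClosure_eq_top_iff] at h2
    rw [← h2]
    exact Submodule.topologicalClosure_mono h1
  have hclose : ∀ k : E →L[ℂ] E, IsCompactOperator k →
      ∀ᶠ F in atTop, ‖(1 - (U F).starProjection) * k‖ < ε := fun k hk => by
    have h1 := Metric.tendsto_nhds.1 (tendsto_starProjection_mul hU hd hk) ε hε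
    filter_upwards [h1] with F hF
    rwa [dist_eq_norm, norm_sub_rev, ← one_sub_mul] at hF
  obtain ⟨F, hF₁, hF₂⟩ := ((hclose k₁ hk₁).and (hclose k₂ hk₂)).exists
  have hinv : ∀ a : E →L[ℂ] E, a * D = D * a → ∀ x ∈ U F, a x ∈ U F := fun a ha => by
    have h1 : ∀ μ, V μ ≤ (V μ).comap (a : E →ₗ[ℂ] E) := fun μ x hx => by
      rw [Module.End.mem_eigenspace_iff] at hx
      rw [Submodule.mem_comap, Module.End.mem_eigenspace_iff]
      have h2 := DFunLike.congr_fun ha x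
      rw [mul_apply_eq_comp, mul_apply_eq_comp] at h2
      change D (a x) = μ • a x
      rw [← h2, ← map_smul]
      exact congrArg a hx
    have h2 : U F ≤ (U F).comap (a : E →ₗ[ℂ] E) := Finset.sup_le fun μ hμ =>
      (h1 μ).trans (Submodule.comap_mono (Finset.le_sup (f := V) hμ))
    exact h2
  refine ⟨(U F).starProjection, ?_, isSelfAdjoint_starProjection _, ?_, ?_, fun a ha => ?_,
    hF₁, hF₂⟩
  · rw [(stdOrthonormalBasis ℂ (U F)).starProjection_eq_sum_rankOne]
    exact sum_mem (S := compactOperator (RingHom.id ℂ) E E) fun i _ => isCompactOperator_rankOne _ _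
  · exact (Submodule.isIdempotentElem_starProjection (U F)).eq
  · have : 1 - (U F).starProjection = (U F)ᗮ.starProjection := by
      ext x; simp [Submodule.starProjection_orthogonal]
    rw [this]
    exact Submodule.starProjection_norm_le _
  · refine commute_starProjection (hinv a ha) (hinv _ ?_)
    have h1 := congrArg star ha
    rw [star_mul, star_mul, hDs.star_eq] at h1
    exact h1.symm

theorem isUnit_of_isUnit_mul {R : Type*} [Ring R] {x y : R} (h1 : IsUnit (y * x))
    (h2 : IsUnit (x * y)) : IsUnit x := by
  obtain ⟨s, hs⟩ := h1
  obtain ⟨t, ht⟩ := h2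
  exact isUnit_iff_exists_and_exists.2
    ⟨⟨y * (t⁻¹ : Rˣ), by rw [← mul_assoc, ← ht, Units.mul_inv]⟩,
      ⟨(s⁻¹ : Rˣ) * y, by rw [mul_assoc, ← hs, Units.inv_mul]⟩⟩

/-- An essentially unitary operator that commutes with an injective compact selfadjoint operator
is a compact perturbation of an invertible operator: on a large finite sum of eigenspaces it is
replaced by the identity. -/
theorem exists_isUnit_sub_isCompactOperator {D : E →L[ℂ] E} (hD : IsCompactOperator D)
    (hDs : IsSelfAdjoint D) (hDi : Function.Injective D) {a : E →L[ℂ] E} (ha : a * D = D * a)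
    (hk₁ : IsCompactOperator (star a * a - 1 : E →L[ℂ] E))
    (hk₂ : IsCompactOperator (a * star a - 1 : E →L[ℂ] E)) :
    ∃ a' : E →L[ℂ] E, IsUnit a' ∧ IsCompactOperator (a' - a : E →L[ℂ] E) := by
  obtain ⟨P, hPc, hPs, hPP, hP1, hcomm, h1, h2⟩ :=
    exists_starProjection_near hD hDs hDi hk₁ hk₂ one_pos
  have hPa := hcomm a ha
  have hPa' := hcomm (star a) (by
    have h1 := congrArg star ha
    rw [star_mul, star_mul, hDs.star_eq] at h1
    exact h1.symm)
  have hsmall : ∀ k : E →L[ℂ] E, ‖(1 - P) * k‖ < 1 → IsUnit (1 + (1 - P) * k * (1 - P)) :=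
    fun k hk => by
      have h3 : ‖-((1 - P) * k * (1 - P))‖ < 1 := by
        rw [norm_neg]
        calc _ ≤ ‖(1 - P) * k‖ * ‖1 - P‖ := norm_mul_le _ _
          _ ≤ ‖(1 - P) * k‖ * 1 := by gcongr
          _ < 1 := by rwa [mul_one]
      have := isUnit_one_sub_of_norm_lt_one h3
      rwa [sub_neg_eq_add] at this
  have hs : star (a * (1 - P) + P) = (1 - P) * star a + P := by
    rw [star_add, star_mul, star_sub, star_one, hPs.star_eq]
  have hQP : (1 - P) * P = 0 := by rw [sub_mul, one_mul, hPP, sub_self]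
  have hPQ : P * (1 - P) = 0 := by rw [mul_sub, mul_one, hPP, sub_self]
  have hQQ : (1 - P) * (1 - P) = 1 - P := by rw [mul_sub, mul_one, hQP, sub_zero]
  have hPaQ : P * a * (1 - P) = 0 := by rw [hPa, mul_assoc, hPQ, mul_zero]
  have hQaP : (1 - P) * star a * P = 0 := by rw [mul_assoc, ← hPa', ← mul_assoc, hQP, zero_mul]
  have hQa : (1 - P) * a = a * (1 - P) := by rw [sub_mul, mul_sub, hPa, one_mul, mul_one]
  have hQa' : (1 - P) * star a = star a * (1 - P) := by
    rw [sub_mul, mul_sub, hPa', one_mul, mul_one]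
  refine ⟨a * (1 - P) + P, isUnit_of_isUnit_mul (y := (1 - P) * star a + P) ?_ ?_, ?_⟩
  · have e : ((1 - P) * star a + P) * (a * (1 - P) + P) =
        1 + (1 - P) * (star a * a - 1) * (1 - P) := by
      calc _ = (1 - P) * (star a * a) * (1 - P) + (1 - P) * star a * P + P * a * (1 - P) +
            P * P := by noncomm_ring
        _ = (1 - P) * (star a * a) * (1 - P) - (1 - P) * (1 - P) + 1 := by
            rw [hQaP, hPaQ, hPP, hQQ]; noncomm_ring
        _ = _ := by noncomm_ring
    rw [e]
    exact hsmall _ h1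
  · have e : (a * (1 - P) + P) * ((1 - P) * star a + P) =
        1 + (1 - P) * (a * star a - 1) * (1 - P) := by
      calc _ = a * ((1 - P) * (1 - P)) * star a + a * ((1 - P) * P) + P * (1 - P) * star a +
            P * P := by noncomm_ring
        _ = (1 - P) * (a * star a) * (1 - P) - (1 - P) * (1 - P) + 1 := by
            have h3 : (1 - P) * (a * star a) * (1 - P) = a * (1 - P) * star a := by
              rw [← mul_assoc, hQa, mul_assoc, mul_assoc, ← hQa', ← mul_assoc (1 - P), hQQ]
              noncomm_ring
            rw [hQP, hPQ, hPP, hQQ, h3]; noncomm_ring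
        _ = _ := by noncomm_ring
    rw [e]
    exact hsmall _ h2
  · have e : a * (1 - P) + P - a = -(a * P) + P := by noncomm_ring
    rw [e]
    exact (hPc.clm_comp a).neg.add hPc

end

/-- The symbol of an essentially unitary element of the Toeplitz algebra that commutes with an
injective compact selfadjoint operator has a continuous logarithm. -/
theorem exists_log_symbol_of_commute {D : BEll} (hD : IsCompactOperator D)
    (hDs : IsSelfAdjoint D) (hDi : Function.Injective D) {a : toeplitzAlgebra}
    (ha : (a : BEll) * D = D * a)
    (h : ∀ χ : toeplitzAlgebra →⋆ₐ[ℂ] ℂ, star (χ a) * χ a = 1) :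
    ∃ g : C(Circle, ℂ), ∀ χ : toeplitzAlgebra →⋆ₐ[ℂ] ℂ,
      χ a = Complex.exp (g (symbolPoint χ)) := by
  obtain ⟨a', ha', hk⟩ := exists_isUnit_sub_isCompactOperator hD hDs hDi ha
    (isCompactOperator_of_forall_character (a := star a * a - 1) fun χ => by
      rw [map_sub, map_mul, map_star, h, map_one, sub_self])
    (isCompactOperator_of_forall_character (a := a * star a - 1) fun χ => by
      rw [map_sub, map_mul, map_star, mul_comm, h, map_one, sub_self])
  let k : toeplitzAlgebra := ⟨a' - a, mem_toeplitzAlgebra_of_isCompactOperator hk⟩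
  have hak : ((a + k : toeplitzAlgebra) : BEll) = a' := by
    change (a : BEll) + (a' - a) = a'
    abel
  obtain ⟨g, hg⟩ := exists_log_symbol (a := a + k) (by rw [hak]; exact ha')
  refine ⟨g, fun χ => ?_⟩
  have hk0 : χ k = 0 := character_eq_zero_of_isCompactOperator χ hk
  rw [← hg, map_add, hk0, add_zero]

end

section

namespace SliceSystem

variable {A B : Type*} [CStarAlgebra A] [CStarAlgebra B] (Q : SliceSystem A B)

/-! ### The group of characters -/

/-- The set of characters of `A`. Convolution turns it into a compact group, the maximal classical
subgroup of the quantum group. -/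
def CharGroup (_ : SliceSystem A B) : Type _ := WeakDual.characterSpace ℂ A

namespace CharGroup

instance : TopologicalSpace Q.CharGroup :=
  inferInstanceAs (TopologicalSpace (WeakDual.characterSpace ℂ A))

instance : T2Space Q.CharGroup := inferInstanceAs (T2Space (WeakDual.characterSpace ℂ A))

instance : CompactSpace Q.CharGroup := inferInstanceAs (CompactSpace (WeakDual.characterSpace ℂ A))

variable {Q}

/-- An element of the character group as a homomorphism. -/
def hom (s : Q.CharGroup) : A →⋆ₐ[ℂ] ℂ :=
  StarAlgHomClass.toStarAlgHom (show WeakDual.characterSpace ℂ A from s)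

/-- An element of the character group as a functional. -/
def clm (s : Q.CharGroup) : A →L[ℂ] ℂ :=
  WeakDual.CharacterSpace.toCLM (show WeakDual.characterSpace ℂ A from s)

@[simp] theorem clm_apply (s : Q.CharGroup) (a : A) : s.clm a = s.hom a := rfl

/-- The element of the character group given by a homomorphism. -/
def ofHom (Q : SliceSystem A B) (χ : A →ₐ[ℂ] ℂ) : Q.CharGroup :=
  WeakDual.CharacterSpace.equivAlgHom.symm χ

@[simp] theorem hom_ofHom (χ : A →ₐ[ℂ] ℂ) (a : A) : (ofHom Q χ).hom a = χ a := rfl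

theorem ext {s t : Q.CharGroup} (h : ∀ a, s.hom a = t.hom a) : s = t :=
  WeakDual.CharacterSpace.ext (φ := s) (ψ := t) h

theorem continuous_eval (a : A) : Continuous fun s : Q.CharGroup => s.hom a :=
  (WeakDual.gelfandTransform ℂ A a).continuous

theorem continuous_of_eval {X : Type*} [TopologicalSpace X] {f : X → Q.CharGroup}
    (h : ∀ a, Continuous fun x => (f x).hom a) : Continuous f :=
  Continuous.subtype_mk (f := fun x => ((show WeakDual.characterSpace ℂ A from f x) : WeakDual ℂ A))
    (WeakDual.continuous_of_continuous_eval h) _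

theorem norm_clm_le (s : Q.CharGroup) : ‖s.clm‖ ≤ 1 :=
  ContinuousLinearMap.opNorm_le_bound _ zero_le_one fun a => by
    rw [one_mul]; exact NonUnitalStarAlgHom.norm_apply_le s.hom a

/-- Slicing by a character is multiplicative. -/
theorem sliceR_mul_of_character (s : Q.CharGroup) (X Y : B) :
    Q.sliceR s.clm (X * Y) = Q.sliceR s.clm X * Q.sliceR s.clm Y := by
  have hsm : ∀ (c : ℂ) (X : B), Q.sliceR (c • s.clm) X = c • Q.sliceR s.clm X := fun c X => by
    have h : Q.sliceR (c • s.clm) = c • Q.sliceR s.clm := Q.ext_dense fun a b => by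
      rw [smul_apply, Q.sliceR_mul, Q.sliceR_mul, smul_smul]
      rfl
    rw [h, smul_apply]
  have h : (Q.sliceR s.clm).comp ((ContinuousLinearMap.mul ℂ B).flip Y) =
      ((ContinuousLinearMap.mul ℂ A).flip (Q.sliceR s.clm Y)).comp (Q.sliceR s.clm) := by
    refine Q.ext_dense fun a b => ?_
    have hm : mulL s.clm b = s.clm b • s.clm := by
      ext c; simp
    simp only [ContinuousLinearMap.comp_apply, ContinuousLinearMap.flip_apply,
      ContinuousLinearMap.mul_apply', mul_assoc, sliceR_inl_mul, sliceR_inr_mul, hm, hsm,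
      sliceR_inr, mul_one, mul_smul_comm, smul_mul_assoc]
  exact DFunLike.congr_fun h X

/-- The convolution of two characters is a character. -/
instance : Mul Q.CharGroup where
  mul s t := ofHom Q
    { toFun := Q.conv s.clm t.clm
      map_one' := by rw [conv_one]; simp
      map_mul' := fun a b => by
        simp only [conv_apply, map_mul, sliceR_mul_of_character, clm_apply]
      map_zero' := map_zero _
      map_add' := map_add _
      commutes' := fun c => by
        rw [Algebra.algebraMap_eq_smul_one, map_smul, conv_one]; simp }

theorem clm_mul (s t : Q.CharGroup) : (s * t).clm = Q.conv s.clm t.clm := rfl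

theorem hom_mul (s t : Q.CharGroup) (a : A) : (s * t).hom a = Q.conv s.clm t.clm a := rfl

theorem mul_assoc' (s t u : Q.CharGroup) : s * t * u = s * (t * u) := ext fun a => by
  rw [hom_mul, hom_mul, clm_mul, clm_mul, conv_assoc]

instance : Semigroup Q.CharGroup where
  mul_assoc := mul_assoc'

/-- Convolution with a character is injective on functionals, because of the density of
`(A ⊗ 1) Δ(A)`. -/
theorem eq_zero_of_conv (s : Q.CharGroup) {ψ : A →L[ℂ] ℂ} (h : Q.conv s.clm ψ = 0) : ψ = 0 := by
  have h1 : s.clm.comp (Q.sliceR ψ) = 0 := Q.ext_cancel_left fun a b => by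
    rw [ContinuousLinearMap.comp_apply, sliceR_inl_mul, clm_apply, map_mul, ← clm_apply s,
      ← clm_apply s, ← conv_apply, h]
    simp
  ext b
  have h2 := DFunLike.congr_fun h1 (Q.inr b)
  rw [ContinuousLinearMap.comp_apply, sliceR_inr, map_smul, clm_apply, map_one] at h2
  simpa using h2

theorem conv_sub_right (φ ψ ψ' : A →L[ℂ] ℂ) : Q.conv φ (ψ - ψ') = Q.conv φ ψ - Q.conv φ ψ' := by
  ext a
  rw [sub_apply, conv_apply', conv_apply', conv_apply', sub_apply]

theorem conv_clm_injective (s : Q.CharGroup) : Function.Injective (Q.conv s.clm) := fun ψ ψ' h =>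
  sub_eq_zero.1 (eq_zero_of_conv s (by rw [conv_sub_right, h, sub_self]))

theorem conv_clm_injective' (s : Q.CharGroup) : Function.Injective fun ψ => Q.conv ψ s.clm :=
  fun ψ ψ' h => conv_clm_injective (Q := Q.op) s (by rw [op_conv, op_conv]; exact h)

theorem clm_injective : Function.Injective (clm : Q.CharGroup → A →L[ℂ] ℂ) := fun _ _ h =>
  ext fun a => DFunLike.congr_fun h a

/-- The products of pairs of characters depend jointly continuously on the pair. -/
theorem continuous_pair (X : B) :
    Continuous fun p : Q.CharGroup × Q.CharGroup => p.1.hom (Q.sliceR p.2.clm X) := by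
  have hb : ∀ (p : Q.CharGroup × Q.CharGroup) (X : B),
      ‖p.1.hom (Q.sliceR p.2.clm X)‖ ≤ ‖X‖ := fun p X => by
    refine (NonUnitalStarAlgHom.norm_apply_le p.1.hom _).trans
      ((Q.norm_sliceR_le p.2.clm X).trans ?_)
    exact mul_le_of_le_one_left (norm_nonneg _) p.2.norm_clm_le
  have hspan : ∀ X ∈ Submodule.span ℂ (Set.range fun p : A × A => Q.inl p.1 * Q.inr p.2),
      Continuous fun p : Q.CharGroup × Q.CharGroup => p.1.hom (Q.sliceR p.2.clm X) := by
    intro X hX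
    induction hX using Submodule.span_induction with
    | mem X hX =>
      obtain ⟨⟨a, b⟩, rfl⟩ := hX
      simp only [Q.sliceR_mul, map_smul, smul_eq_mul, clm_apply]
      exact ((continuous_eval b).comp continuous_snd).mul ((continuous_eval a).comp continuous_fst)
    | zero => simp only [map_zero]; exact continuous_const
    | add X Y _ _ hX hY => simp only [map_add]; exact hX.add hY
    | smul c X _ hX => simp only [map_smul]; exact hX.const_smul c
  refine continuous_of_uniform_approx_of_continuous fun u hu => ?_
  obtain ⟨ε, hε, hεu⟩ := Metric.mem_uniformity_dist.1 hu
  have hX : X ∈ closure (Submodule.span ℂ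
      (Set.range fun p : A × A => Q.inl p.1 * Q.inr p.2) : Set B) := by
    have := Q.dense
    rw [← Submodule.dense_iff_topologicalClosure_eq_top] at this
    exact this X
  obtain ⟨Y, hY, hXY⟩ := Metric.mem_closure_iff.1 hX ε hε
  refine ⟨_, hspan Y hY, fun p => hεu ?_⟩
  rw [dist_eq_norm, ← map_sub, ← map_sub]
  exact (hb p _).trans_lt (by rwa [← dist_eq_norm])

instance : ContinuousMul Q.CharGroup where
  continuous_mul := continuous_of_eval fun a => continuous_pair (Q.comul a)

variable [Nonempty Q.CharGroup]

theorem exists_isIdempotent : ∃ e : Q.CharGroup, e * e = e :=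
  exists_idempotent_of_compact_t2_of_continuous_mul_left fun r => continuous_mul_const r

/-- The neutral element: a compact semigroup has an idempotent, and cancellation makes it
neutral. -/
instance : One Q.CharGroup where
  one := exists_isIdempotent.choose

theorem one_mul_one : (1 : Q.CharGroup) * 1 = 1 := exists_isIdempotent.choose_spec

theorem conv_one_left (ψ : A →L[ℂ] ℂ) : Q.conv (1 : Q.CharGroup).clm ψ = ψ :=
  conv_clm_injective (1 : Q.CharGroup) (by rw [← conv_assoc, ← clm_mul, one_mul_one])

theorem conv_one_right (ψ : A →L[ℂ] ℂ) : Q.conv ψ (1 : Q.CharGroup).clm = ψ :=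
  conv_clm_injective' (1 : Q.CharGroup) (by
    change Q.conv (Q.conv _ _) _ = Q.conv _ _
    rw [conv_assoc, ← clm_mul, one_mul_one])

theorem exists_mul_eq_one (s : Q.CharGroup) : ∃ t : Q.CharGroup, t * s = 1 := by
  -- the left ideal generated by `s` is a compact semigroup, so it contains an idempotent
  obtain ⟨_, ⟨t, rfl⟩, ht⟩ := exists_idempotent_in_compact_subsemigroup (M := Q.CharGroup)
    (fun r => continuous_mul_const r) (Set.range fun t => t * s) (Set.range_nonempty _)
    (isCompact_range (continuous_mul_const s)) (by
      rintro _ ⟨t, rfl⟩ _ ⟨t', rfl⟩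
      exact ⟨t * s * t', mul_assoc _ _ _⟩)
  refine ⟨t, clm_injective (conv_clm_injective (t * s) ?_)⟩
  rw [← clm_mul, ht, conv_one_right]

instance : Inv Q.CharGroup where
  inv s := (exists_mul_eq_one s).choose

instance : Group Q.CharGroup :=
  Group.ofLeftAxioms mul_assoc (fun s => clm_injective (conv_one_left s.clm))
    fun s => (exists_mul_eq_one s).choose_spec

instance : IsTopologicalGroup Q.CharGroup where
  -- `(s, t) ↦ (s, s t)` is a continuous bijection of a compact Hausdorff space, and its inverse
  -- gives the inversion
  continuous_inv := by
    let f : Q.CharGroup × Q.CharGroup ≃ Q.CharGroup × Q.CharGroup :=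
      ⟨fun p => (p.1, p.1 * p.2), fun p => (p.1, p.1⁻¹ * p.2), fun p => by simp, fun p => by simp⟩
    have hf : Continuous f := by
      change Continuous fun p : Q.CharGroup × Q.CharGroup => (p.1, p.1 * p.2)
      fun_prop
    have h := (hf.homeoOfEquivCompactToT2 (f := f)).symm.continuous
    have h2 : Continuous fun s : Q.CharGroup => (f.symm (s, 1)).2 :=
      continuous_snd.comp (h.comp (continuous_id.prodMk continuous_const))
    refine h2.congr fun s => ?_
    change s⁻¹ * 1 = s⁻¹
    exact mul_one _

end CharGroup
end SliceSystem

end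

section

/-! ### Compact connected groups embedded in the circle as spaces -/

section

open MeasureTheory

theorem integrable_continuousMap {X : Type*} [TopologicalSpace X] [CompactSpace X]
    [MeasurableSpace X] [BorelSpace X] {μ : Measure X} [IsFiniteMeasure μ] {E : Type*}
    [NormedAddCommGroup E] (g : C(X, E)) : Integrable g μ := by
  refine Integrable.of_bound (g.continuous.aestronglyMeasurable_of_compactSpace) ‖g‖
    (Eventually.of_forall fun y => g.norm_coe_le_norm y)

/-- A continuous real function of mean zero on a compact connected space has a zero. -/
theorem exists_eq_zero_of_integral_eq_zero {X : Type*} [TopologicalSpace X] [CompactSpace X]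
    [ConnectedSpace X] [MeasurableSpace X] [BorelSpace X] {μ : Measure X} [IsFiniteMeasure μ]
    [μ.IsOpenPosMeasure] (g : C(X, ℝ)) (hg : ∫ y, g y ∂μ = 0) : ∃ y, g y = 0 := by
  have key : ∀ g : C(X, ℝ), (∫ y, g y ∂μ = 0) → ∃ y, g y ≤ 0 := fun g hg => by
    by_contra! h
    have h1 := (integral_pos_iff_support_of_nonneg (μ := μ) (f := g) (fun y => (h y).le)
      (integrable_continuousMap g)).2
    have h2 : Function.support g = Set.univ := Set.eq_univ_of_forall fun y => (h y).ne'
    rw [h2] at h1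
    exact (h1 (isOpen_univ.measure_pos μ Set.univ_nonempty)).ne' hg
  obtain ⟨a, ha⟩ := key g hg
  obtain ⟨b, hb⟩ := key (-g) (by
    simp only [ContinuousMap.neg_apply]
    rw [integral_neg, hg, neg_zero])
  exact mem_range_of_exists_le_of_exists_ge g.continuous ⟨a, ha⟩ ⟨b, by simpa using hb⟩

variable {G : Type*} [Group G] [TopologicalSpace G] [IsTopologicalGroup G] [CompactSpace G]

/-- The translation `y ↦ z (s y)` of the circle-valued function `z` differs from `z` by the
exponential of a continuous real function of mean `m`. -/
def HasLift [MeasurableSpace G] (μ : Measure G) (z : G → Circle) (s : G) (m : ℝ) : Prop :=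
  ∃ g : C(G, ℝ), (∀ y, z (s * y) = z y * Circle.exp (g y)) ∧ ∫ y, g y ∂μ = m

variable [MeasurableSpace G] [BorelSpace G] {μ : Measure G} [μ.IsMulLeftInvariant]
  [IsFiniteMeasure μ] {z : G → Circle}

theorem HasLift.mul {s t : G} {m m' : ℝ} (hs : HasLift μ z s m) (ht : HasLift μ z t m') :
    HasLift μ z (s * t) (m + m') := by
  obtain ⟨g, hg, rfl⟩ := hs
  obtain ⟨g', hg', rfl⟩ := ht
  refine ⟨g.comp (ContinuousMap.mulLeft t) + g', fun y => ?_, ?_⟩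
  · rw [mul_assoc, hg, hg', ContinuousMap.add_apply, Circle.exp_add, mul_assoc,
      mul_comm (Circle.exp (g' y))]
    rfl
  · simp only [ContinuousMap.add_apply]
    rw [integral_add (integrable_continuousMap _) (integrable_continuousMap _)]
    congr 1
    exact integral_mul_left_eq_self (fun y => g y) t

theorem HasLift.inv {s : G} {m : ℝ} (hs : HasLift μ z s m) : HasLift μ z s⁻¹ (-m) := by
  obtain ⟨g, hg, rfl⟩ := hs
  refine ⟨-(g.comp (ContinuousMap.mulLeft s⁻¹)), fun y => ?_, ?_⟩
  · have := hg (s⁻¹ * y)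
    rw [mul_inv_cancel_left] at this
    rw [this, ContinuousMap.neg_apply, mul_assoc, ← Circle.exp_add]
    change _ = z (s⁻¹ * y) * Circle.exp (g (s⁻¹ * y) + -(g (s⁻¹ * y)))
    rw [add_neg_cancel, Circle.exp_zero, mul_one]
  · simp only [ContinuousMap.neg_apply]
    rw [integral_neg]
    congr 1
    exact integral_mul_left_eq_self (fun y => g y) s⁻¹

/-- On a connected group every translation has a lift: translations close to the identity have
one, through the principal value of the argument. -/
theorem exists_hasLift [ConnectedSpace G] (hz : Continuous z) (s : G) : ∃ m, HasLift μ z s m := by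
  let L : Subgroup G :=
    { carrier := {s | ∃ m, HasLift μ z s m}
      mul_mem' := fun ⟨m, hm⟩ ⟨m', hm'⟩ => ⟨_, hm.mul hm'⟩
      one_mem' := ⟨0, 0, fun y => by simp, by simp⟩
      inv_mem' := fun ⟨m, hm⟩ => ⟨_, hm.inv⟩ }
  have hnhds : (L : Set G) ∈ 𝓝 (1 : G) := by
    have hc : Continuous fun p : G × G => ((z (p.1 * p.2) / z p.2 : Circle) : ℂ) :=
      continuous_subtype_val.comp
        (show Continuous fun p : G × G => z (p.1 * p.2) / z p.2 by fun_prop)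
    have hopen : IsOpen {p : G × G | 0 < ((z (p.1 * p.2) / z p.2 : Circle) : ℂ).re} :=
      isOpen_lt continuous_const (Complex.continuous_re.comp hc)
    have hsub : ({1} : Set G) ×ˢ (Set.univ : Set G) ⊆
        {p : G × G | 0 < ((z (p.1 * p.2) / z p.2 : Circle) : ℂ).re} := by
      rintro ⟨s, y⟩ ⟨hs, -⟩
      rw [Set.mem_singleton_iff] at hs
      subst hs
      simp
    obtain ⟨u, v, hu, -, h1u, hv, huv⟩ :=
      generalized_tube_lemma isCompact_singleton isCompact_univ hopen hsub
    refine mem_of_superset (hu.mem_nhds (h1u rfl)) fun s hs => ?_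
    have hpos : ∀ y, 0 < ((z (s * y) / z y : Circle) : ℂ).re := fun y =>
      huv (Set.mk_mem_prod hs (hv (Set.mem_univ y)))
    have harg : Continuous fun y => Complex.arg ((z (s * y) / z y : Circle) : ℂ) := by
      rw [continuous_iff_continuousAt]
      intro y
      exact (Complex.continuousAt_arg (Or.inl (hpos y))).comp
        (f := fun y => ((z (s * y) / z y : Circle) : ℂ)) (continuous_subtype_val.comp
          (show Continuous fun y => z (s * y) / z y by fun_prop)).continuousAt
    refine ⟨_, ⟨_, harg⟩, fun y => ?_, rfl⟩
    change _ = z y * Circle.exp (Complex.arg ((z (s * y) / z y : Circle) : ℂ))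
    rw [Circle.exp_arg, mul_div_cancel]
  -- an open subgroup of a connected group is everything
  have hL : L = ⊤ := by
    have ho : IsOpen (L : Set G) := Subgroup.isOpen_of_mem_nhds L hnhds
    have hcl : IsClosed (L : Set G) := Subgroup.isClosed_of_isOpen L ho
    have := IsClopen.eq_univ ⟨hcl, ho⟩ ⟨1, L.one_mem⟩
    exact SetLike.coe_injective this
  have : s ∈ L := hL ▸ Subgroup.mem_top s
  exact this

end

section

open MeasureTheory

variable {G : Type*} [Group G] [TopologicalSpace G] [IsTopologicalGroup G] [CompactSpace G]
  [T2Space G] [ConnectedSpace G]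

/-- A compact connected group that admits a continuous injection into the circle is commutative:
the mean of the lift is additive, hence zero for a commutator, so that a commutator acts by
translation with a fixed point. -/
theorem mul_comm_of_injective_circle {z : G → Circle} (hz : Continuous z)
    (hinj : Function.Injective z) (s t : G) : s * t = t * s := by
  borelize G
  let μ : Measure G := Measure.haar
  obtain ⟨m, hs⟩ := exists_hasLift (μ := μ) hz s
  obtain ⟨m', ht⟩ := exists_hasLift (μ := μ) hz t
  obtain ⟨g, hg, hg0⟩ := ((hs.mul ht).mul hs.inv).mul ht.inv
  obtain ⟨y, hy⟩ := exists_eq_zero_of_integral_eq_zero (μ := μ) g (by rw [hg0]; ring)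
  have h1 := hg y
  rw [hy, Circle.exp_zero, mul_one] at h1
  have h2 := hinj h1
  rwa [mul_eq_right, mul_inv_eq_one, mul_inv_eq_iff_eq_mul] at h2

/-- A multiplicative function with a continuous logarithm is trivial: the logarithm of the
translate differs from it by a constant, which is zero by invariance of the mean. -/
theorem eq_one_of_eq_exp {f : G → ℂ} (hf : ∀ s t, f (s * t) = f s * f t) (g : C(G, ℂ))
    (hg : ∀ s, f s = Complex.exp (g s)) (s : G) : f s = 1 := by
  borelize G
  let μ : Measure G := Measure.haar
  have h1 : ∀ y, ∃ n : ℤ, g (s * y) = (g y + g s) + n * (2 * Real.pi * Complex.I) := fun y => by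
    rw [← Complex.exp_eq_exp_iff_exists_int, ← hg, hf, Complex.exp_add, ← hg, ← hg, mul_comm]
  choose n hn using h1
  have hcont : Continuous n := by
    rw [Int.isClosedEmbedding_coe_real.isEmbedding.continuous_iff]
    have : (fun t => (n t : ℝ)) = fun y =>
        ((g (s * y) - (g y + g s)) / (2 * Real.pi * Complex.I)).re := by
      ext y
      rw [hn, add_sub_cancel_left, mul_div_cancel_right₀ _ Complex.two_pi_I_ne_zero]
      simp
    change Continuous fun t => (n t : ℝ)
    rw [this]
    fun_prop
  have hconst : ∀ y, n y = n 1 := fun y => PreconnectedSpace.constant inferInstance hcont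
  have h2 : ∀ y, g (s * y) - g y = g s + n 1 * (2 * Real.pi * Complex.I) := fun y => by
    rw [hn, hconst]; ring
  have h3 : ∫ y, (g (s * y) - g y) ∂μ = 0 := by
    have h := integral_sub (μ := μ) (f := fun y => g (s * y)) (g := fun y => g y)
      (integrable_continuousMap (g.comp (ContinuousMap.mulLeft s))) (integrable_continuousMap g)
    rw [h, integral_mul_left_eq_self (fun y => g y) s, sub_self]
  simp only [h2, integral_const, smul_eq_zero] at h3
  have h4 : g s + n 1 * (2 * Real.pi * Complex.I) = 0 := by
    refine h3.resolve_left ?_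
    rw [Measure.real, ENNReal.toReal_eq_zero_iff]
    rintro (h | h)
    · exact (isOpen_univ.measure_pos μ Set.univ_nonempty).ne' h
    · exact (measure_lt_top μ _).ne h
  rw [hg, ← Complex.exp_zero, Complex.exp_eq_exp_iff_exists_int]
  refine ⟨-n 1, ?_⟩
  push_cast
  linear_combination h4

end

end

section

/-! ### Compact perturbations of the identity -/

/-- The span of the first `n` standard basis vectors. -/
def ellSpan (n : ℕ) : Submodule ℂ EllTwo := Submodule.span ℂ (ellBasis '' Set.Iio n)

instance (n : ℕ) : FiniteDimensional ℂ (ellSpan n) :=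
  FiniteDimensional.span_of_finite ℂ ((Set.finite_Iio n).image _)

theorem ellBasis_mem_ellSpan {m n : ℕ} (h : m < n) : ellBasis m ∈ ellSpan n :=
  Submodule.subset_span ⟨m, h, rfl⟩

theorem monotone_ellSpan : Monotone ellSpan := fun _ _ h =>
  Submodule.span_mono (Set.image_mono (Set.Iio_subset_Iio h))

theorem hasSum_ellBasis (x : EllTwo) : HasSum (fun i => x i • ellBasis i) x := by
  have := lp.hasSum_single (p := 2) (by norm_num) x
  refine this.congr_fun fun i => ?_
  rw [ellBasis, ← lp.single_smul, smul_eq_mul, mul_one]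

theorem le_topologicalClosure_iSup_ellSpan : ⊤ ≤ (⨆ n, ellSpan n).topologicalClosure := by
  intro x _
  refine mem_closure_of_tendsto (hasSum_ellBasis x) (Eventually.of_forall fun s => ?_)
  exact Submodule.sum_mem _ fun i _ => Submodule.smul_mem _ _
    (Submodule.mem_iSup_of_mem (i + 1) (ellBasis_mem_ellSpan (Nat.lt_succ_self i)))

/-- A compact perturbation of the identity is a finite rank perturbation of an invertible
operator. -/
theorem exists_isUnit_add_starProjection_mul {k : BEll} (hk : IsCompactOperator k) :
    ∃ (v : BEll) (n : ℕ), IsUnit v ∧ 1 + k = v + (ellSpan n).starProjection * k := by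
  have h1 := Metric.tendsto_nhds.1
    (tendsto_starProjection_mul monotone_ellSpan le_topologicalClosure_iSup_ellSpan hk) 1 one_pos
  obtain ⟨n, hn⟩ := h1.exists
  rw [dist_eq_norm] at hn
  refine ⟨1 - ((ellSpan n).starProjection * k - k), n, isUnit_one_sub_of_norm_lt_one hn, ?_⟩
  abel

theorem hasFiniteRange_starProjection_mul (n : ℕ) (k : BEll) :
    (((ellSpan n).starProjection * k : BEll) : EllTwo →ₗ[ℂ] EllTwo).HasFiniteRange := by
  rw [LinearMap.hasFiniteRange_iff_range]
  refine Submodule.FG.of_le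
    (Module.Finite.iff_fg.1 (inferInstance : FiniteDimensional ℂ (ellSpan n))) ?_
  rintro _ ⟨x, rfl⟩
  exact Submodule.starProjection_apply_mem _ _

open LinearMap.FiniteRangeSetoid in
/-- An operator that is invertible modulo the compact operators is a Fredholm operator. -/
theorem isFredholm_of_isCompactOperator {a b : BEll} (h₁ : IsCompactOperator (b * a - 1 : BEll))
    (h₂ : IsCompactOperator (a * b - 1 : BEll)) : ContinuousLinearMap.IsFredholm a := by
  obtain ⟨v, n, hv, hvn⟩ := exists_isUnit_add_starProjection_mul h₁
  obtain ⟨w, m, hw, hwm⟩ := exists_isUnit_add_starProjection_mul h₂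
  obtain ⟨v, rfl⟩ := hv
  obtain ⟨w, rfl⟩ := hw
  rw [add_sub_cancel] at hvn hwm
  let l : BEll := (v⁻¹ : BEllˣ) * b
  let r : BEll := b * (w⁻¹ : BEllˣ)
  have hl : (l : EllTwo →ₗ[ℂ] EllTwo) ∘ₗ (a : EllTwo →ₗ[ℂ] EllTwo) ≈ .id := by
    rw [equiv_iff_hasFiniteRange]
    have : (l : EllTwo →ₗ[ℂ] EllTwo) ∘ₗ (a : EllTwo →ₗ[ℂ] EllTwo) - .id =
      (((v⁻¹ : BEllˣ) : BEll) : EllTwo →ₗ[ℂ] EllTwo) ∘ₗ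
        ((ellSpan n).starProjection * (b * a - 1) : BEll) := by
      have h : l * a - 1 = ((v⁻¹ : BEllˣ) : BEll) * ((ellSpan n).starProjection * (b * a - 1)) := by
        rw [← sub_eq_iff_eq_add'.2 hvn, mul_sub, Units.inv_mul, ← mul_assoc]
      exact congrArg (fun x : BEll => (x : EllTwo →ₗ[ℂ] EllTwo)) h
    rw [this]
    exact (hasFiniteRange_starProjection_mul _ _).comp_left _
  have hr : (a : EllTwo →ₗ[ℂ] EllTwo) ∘ₗ (r : EllTwo →ₗ[ℂ] EllTwo) ≈ .id := by
    rw [equiv_iff_hasFiniteRange]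
    have : (a : EllTwo →ₗ[ℂ] EllTwo) ∘ₗ (r : EllTwo →ₗ[ℂ] EllTwo) - .id =
      ((ellSpan m).starProjection * (a * b - 1) : BEll) ∘ₗ
        (((w⁻¹ : BEllˣ) : BEll) : EllTwo →ₗ[ℂ] EllTwo) := by
      have h : a * r - 1 = ((ellSpan m).starProjection * (a * b - 1)) * ((w⁻¹ : BEllˣ) : BEll) := by
        rw [← sub_eq_iff_eq_add'.2 hwm, sub_mul, Units.mul_inv, mul_assoc]
      exact congrArg (fun x : BEll => (x : EllTwo →ₗ[ℂ] EllTwo)) h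
    rw [this]
    exact (hasFiniteRange_starProjection_mul _ _).comp_right _
  refine ContinuousLinearMap.IsFredholm.of_isQuasiInverse (v := r) ⟨?_, hr⟩
  -- the left and the right quasi-inverse agree modulo operators of finite rank
  have h3 : (l : EllTwo →ₗ[ℂ] EllTwo) ≈ r := by
    calc (l : EllTwo →ₗ[ℂ] EllTwo) = (l : EllTwo →ₗ[ℂ] EllTwo) ∘ₗ .id := by simp
      _ ≈ (l : EllTwo →ₗ[ℂ] EllTwo) ∘ₗ ((a : EllTwo →ₗ[ℂ] EllTwo) ∘ₗ r) := by grw [hr]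
      _ = ((l : EllTwo →ₗ[ℂ] EllTwo) ∘ₗ (a : EllTwo →ₗ[ℂ] EllTwo)) ∘ₗ r := by
        rw [LinearMap.comp_assoc]
      _ ≈ .id ∘ₗ r := by grw [hl]
      _ = r := by simp
  change _ ∘ₗ _ ≈ _
  grw [← h3]
  exact hl

/-- Compressing by a fixed operator of finite rank has finite rank. -/
theorem finiteDimensional_range_conj {V : Type*} [AddCommGroup V] [Module ℂ V]
    (σ : V →ₗ[ℂ] BEll) (v : BEll) (n : ℕ) (k : BEll) :
    FiniteDimensional ℂ (LinearMap.range
      ((LinearMap.mulLeft ℂ (star (v * ((ellSpan n).starProjection * k)))) ∘ₗ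
        (LinearMap.mulRight ℂ (v * ((ellSpan n).starProjection * k))) ∘ₗ σ)) := by
  let U := ellSpan n
  let R : V →ₗ[ℂ] (U →L[ℂ] U) :=
    { toFun := fun a => U.orthogonalProjectionOnto ∘L (star v * σ a * v) ∘L U.subtypeL
      map_add' := fun a b => by
        ext x; simp [mul_add, add_mul]
      map_smul' := fun c a => by
        ext x; simp }
  let L : (U →L[ℂ] U) →ₗ[ℂ] BEll :=
    { toFun := fun y => star k * ((U.subtypeL ∘L y ∘L U.orthogonalProjectionOnto) * k)
      map_add' := fun a b => by
        ext x; simp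
      map_smul' := fun c a => by
        ext x; simp }
  have : ((LinearMap.mulLeft ℂ (star (v * ((ellSpan n).starProjection * k)))) ∘ₗ
        (LinearMap.mulRight ℂ (v * ((ellSpan n).starProjection * k))) ∘ₗ σ) = L ∘ₗ R := by
    ext1 a
    have hs : star U.starProjection = U.starProjection := isSelfAdjoint_starProjection U
    change star (v * (U.starProjection * k)) * (σ a * (v * (U.starProjection * k))) =
      star k * ((U.starProjection * (star v * σ a * v) * U.starProjection) * k)
    rw [star_mul, star_mul, hs]
    simp only [mul_assoc]
  rw [this, LinearMap.range_comp]
  infer_instance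

/-- Otherwise the isometry `S` would be invertible in the Toeplitz algebra. -/
theorem not_finiteDimensional_toeplitzAlgebra : ¬ FiniteDimensional ℂ toeplitzAlgebra := by
  intro _
  have hS : star toeplitzShift * toeplitzShift = 1 := Subtype.ext star_shiftOp_mul
  have hinj : Function.Injective (LinearMap.mulLeft ℂ toeplitzShift) := fun a b h => by
    have := congrArg (fun x => star toeplitzShift * x) h
    simpa only [LinearMap.mulLeft_apply, ← mul_assoc, hS, one_mul] using this
  obtain ⟨a, ha⟩ := LinearMap.injective_iff_surjective.1 hinj 1
  rw [LinearMap.mulLeft_apply] at ha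
  have h1 : a = star toeplitzShift := by
    rw [← one_mul a, ← hS, mul_assoc, ha, mul_one]
  rw [h1] at ha
  have h2 : (1 : BEll) - shiftOp * star shiftOp = 0 :=
    sub_eq_zero.2 (congrArg (fun x : toeplitzAlgebra => (x : BEll)) ha).symm
  rw [one_sub_shiftOp_mul_star] at h2
  have h3 := DFunLike.congr_fun h2 (ellBasis 0)
  rw [InnerProductSpace.rankOne_apply, orthonormal_iff_ite.1 orthonormal_ellBasis, if_pos rfl,
    one_smul] at h3
  exact orthonormal_ellBasis.ne_zero 0 h3

/-! ### The Haar state of a quantum group with Toeplitz algebra of functions -/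

section

variable {A B : Type*} [CStarAlgebra A] [CStarAlgebra B]

/-- A C*-algebra that acts faithfully on `ℓ₂(ℤ₊)` has a faithful state, given by a density
operator that is diagonal with positive entries. -/
theorem exists_faithful_state (σ : A →⋆ₐ[ℂ] BEll) (hσ : Function.Injective σ) :
    ∃ ω : A →L[ℂ] ℂ, IsPos ω ∧ ω 1 = 1 ∧ ‖ω‖ ≤ 1 ∧ ∀ a, ω (star a * a) = 0 → a = 0 := by
  let p : ℕ → ℝ := fun n => 1 / 2 / 2 ^ n
  have hp : HasSum p 1 := hasSum_geometric_two' 1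
  have hp0 : ∀ n, 0 < p n := fun n => by positivity
  have hb1 : ∀ n, ‖ellBasis n‖ = 1 := fun n => orthonormal_ellBasis.1 n
  have hbound : ∀ n a, ‖(p n : ℂ) * inner ℂ (ellBasis n) (σ a (ellBasis n))‖ ≤ p n * ‖a‖ :=
    fun n a => by
      rw [norm_mul, Complex.norm_real, Real.norm_of_nonneg (hp0 n).le]
      refine mul_le_mul_of_nonneg_left ((norm_inner_le_norm _ _).trans ?_) (hp0 n).le
      rw [hb1, one_mul]
      refine ((σ a).le_opNorm _).trans ?_
      rw [hb1, mul_one]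
      exact NonUnitalStarAlgHom.norm_apply_le σ a
  have hsum : ∀ a, Summable fun n => (p n : ℂ) * inner ℂ (ellBasis n) (σ a (ellBasis n)) :=
    fun a => Summable.of_norm_bounded (hp.summable.mul_right _) (hbound · a)
  let ω : A →L[ℂ] ℂ := LinearMap.mkContinuous
    { toFun := fun a => ∑' n, (p n : ℂ) * inner ℂ (ellBasis n) (σ a (ellBasis n))
      map_add' := fun a b => by
        rw [← (hsum a).tsum_add (hsum b)]
        simp only [map_add, add_apply, inner_add_right, mul_add]
      map_smul' := fun c a => by
        rw [RingHom.id_apply, smul_eq_mul, ← tsum_mul_left]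
        simp only [map_smul, smul_apply, inner_smul_right, mul_left_comm] } 1 fun a => by
    rw [one_mul]
    exact tsum_of_norm_bounded (by simpa using hp.mul_right ‖a‖) (hbound · a)
  have hω : ∀ a, ω a = ∑' n, (p n : ℂ) * inner ℂ (ellBasis n) (σ a (ellBasis n)) := fun a => rfl
  have hsq : ∀ a n, (p n : ℂ) * inner ℂ (ellBasis n) (σ (star a * a) (ellBasis n)) =
      ((p n * ‖σ a (ellBasis n)‖ ^ 2 : ℝ) : ℂ) := fun a n => by
    rw [map_mul, map_star, mul_apply_eq_comp, ContinuousLinearMap.star_eq_adjoint,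
      ContinuousLinearMap.adjoint_inner_right, inner_self_eq_norm_sq_to_K]
    push_cast
    rfl
  have hpos : ∀ a, ω (star a * a) = ((∑' n, p n * ‖σ a (ellBasis n)‖ ^ 2 : ℝ) : ℂ) := fun a => by
    rw [hω, Complex.ofReal_tsum]
    exact tsum_congr (hsq a)
  refine ⟨ω, fun a => ?_, ?_, LinearMap.mkContinuous_norm_le _ zero_le_one _, fun a ha => ?_⟩
  · rw [hpos]
    exact_mod_cast tsum_nonneg fun n => mul_nonneg (hp0 n).le (sq_nonneg _)
  · have := hpos 1
    rw [star_one, one_mul] at this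
    rw [this]
    simp only [map_one, one_apply_eq_self, hb1, one_pow, mul_one]
    rw [hp.tsum_eq, Complex.ofReal_one]
  · have h1 : Summable fun n => p n * ‖σ a (ellBasis n)‖ ^ 2 := by
      have := hsum (star a * a)
      simp only [hsq] at this
      exact Complex.summable_ofReal.1 this
    rw [hpos, Complex.ofReal_eq_zero, ← h1.hasSum_iff,
      hasSum_zero_iff_of_nonneg fun n => mul_nonneg (hp0 n).le (sq_nonneg _)] at ha
    refine hσ ?_
    rw [map_zero]
    ext1 x
    have h2 := (hasSum_ellBasis x).mapL (σ a)
    have h3 : ∀ n, σ a (ellBasis n) = 0 := fun n => by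
      have := congrFun ha n
      simpa [(hp0 n).ne'] using this
    simp only [map_smul, h3, smul_zero] at h2
    exact h2.unique hasSum_zero

end

end

section

namespace SliceSystem

variable {A B : Type*} [CStarAlgebra A] [CStarAlgebra B] {Q : SliceSystem A B}

/-! ### Characters and the Haar state when the algebra is the Toeplitz algebra -/

/-- The character of the Toeplitz algebra that corresponds to a character of an isomorphic
algebra. -/
def CharGroup.toeplitzHom (π : A ≃⋆ₐ[ℂ] toeplitzAlgebra) (s : Q.CharGroup) :
    toeplitzAlgebra →⋆ₐ[ℂ] ℂ :=
  s.hom.comp (π.symm : toeplitzAlgebra →⋆ₐ[ℂ] A)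

@[simp] theorem CharGroup.toeplitzHom_apply (π : A ≃⋆ₐ[ℂ] toeplitzAlgebra) (s : Q.CharGroup)
    (a : A) : s.toeplitzHom π (π a) = s.hom a :=
  congrArg s.hom (π.symm_apply_apply a)

theorem CharGroup.exists_toeplitzHom_eq (Q : SliceSystem A B) (π : A ≃⋆ₐ[ℂ] toeplitzAlgebra)
    (χ : toeplitzAlgebra →⋆ₐ[ℂ] ℂ) : ∃ s : Q.CharGroup, s.toeplitzHom π = χ :=
  ⟨CharGroup.ofHom Q (χ.comp (π : A →⋆ₐ[ℂ] toeplitzAlgebra)).toAlgHom,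
    StarAlgHom.ext fun a => congrArg χ (π.apply_symm_apply a)⟩

theorem CharGroup.nonempty (Q : SliceSystem A B) (π : A ≃⋆ₐ[ℂ] toeplitzAlgebra) :
    Nonempty Q.CharGroup :=
  let ⟨χ, _⟩ := exists_character 1
  let ⟨s, _⟩ := CharGroup.exists_toeplitzHom_eq Q π χ
  ⟨s⟩

/-- The point of the circle that corresponds to a character. -/
def CharGroup.circle (π : A ≃⋆ₐ[ℂ] toeplitzAlgebra) (s : Q.CharGroup) : Circle :=
  symbolPoint (s.toeplitzHom π)

theorem CharGroup.continuous_circle (π : A ≃⋆ₐ[ℂ] toeplitzAlgebra) :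
    Continuous (CharGroup.circle (Q := Q) π) :=
  Continuous.subtype_mk (CharGroup.continuous_eval (π.symm toeplitzShift)) _

theorem CharGroup.circle_bijective (π : A ≃⋆ₐ[ℂ] toeplitzAlgebra) :
    Function.Bijective (CharGroup.circle (Q := Q) π) := by
  refine ⟨fun s t hst => CharGroup.ext fun a => ?_, fun c => ?_⟩
  · rw [← CharGroup.toeplitzHom_apply π, symbolPoint_injective hst, CharGroup.toeplitzHom_apply]
  · obtain ⟨χ, hχ⟩ := exists_character c
    obtain ⟨s, rfl⟩ := CharGroup.exists_toeplitzHom_eq Q π χ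
    exact ⟨s, Subtype.ext hχ⟩

theorem CharGroup.connectedSpace (Q : SliceSystem A B) (π : A ≃⋆ₐ[ℂ] toeplitzAlgebra) :
    ConnectedSpace Q.CharGroup := by
  let e : Q.CharGroup ≃ₜ Circle := Continuous.homeoOfEquivCompactToT2
    (f := Equiv.ofBijective _ (CharGroup.circle_bijective π)) (CharGroup.continuous_circle π)
  exact e.symm.surjective.connectedSpace e.symm.continuous

theorem exists_isHaar (Q : SliceSystem A B) (π : A ≃⋆ₐ[ℂ] toeplitzAlgebra) :
    ∃ h : A →L[ℂ] ℂ, Q.IsHaar h := by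
  obtain ⟨ω, h1, h2, h3, h4⟩ := exists_faithful_state
    (toeplitzAlgebra.subtype.comp (π : A →⋆ₐ[ℂ] toeplitzAlgebra))
    (Subtype.val_injective.comp π.injective)
  obtain ⟨h, hp, ho, hr, hl⟩ := Q.exists_haar h1 h2 h3 h4
  exact ⟨h, hp, ho, hr, hl, ω, h1, h4⟩

variable {h : A →L[ℂ] ℂ}

/-- A left ideal on which no character vanishes contains a compact perturbation of `1`. -/
theorem exists_isCompactOperator_add_one_mem (π : A ≃⋆ₐ[ℂ] toeplitzAlgebra)
    (hN : ∀ s : Q.CharGroup, ∃ b ∈ nullSpace h, s.hom b ≠ 0) :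
    ∃ k : A, IsCompactOperator (π k : BEll) ∧ 1 + k ∈ nullSpace h := by
  choose b hb hbs using hN
  obtain ⟨t, ht⟩ := isCompact_univ.elim_nhds_subcover (fun s : Q.CharGroup => {x | x.hom (b s) ≠ 0})
    fun s _ => (isOpen_ne_fun (CharGroup.continuous_eval (b s)) continuous_const).mem_nhds (hbs s)
  -- by compactness a finite sum of elements `b* b` has a symbol that vanishes nowhere
  let c : A := ∑ i ∈ t, star (b i) * b i
  have hc : c ∈ nullSpace h := fun x => by
    rw [Finset.mul_sum, map_sum]
    exact Finset.sum_eq_zero fun i _ => mul_mem_nullSpace (hb i) _ x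
  have hcs : ∀ s : Q.CharGroup, s.hom c ≠ 0 := fun s h0 => by
    rw [map_sum] at h0
    have h1 := (Finset.sum_eq_zero_iff_of_nonneg fun i _ => by
      rw [map_mul, map_star]; exact star_mul_self_nonneg _).1 h0
    obtain ⟨i, hi, his⟩ := Set.mem_iUnion₂.1 (ht.2 (Set.mem_univ s))
    have := h1 i hi
    rw [map_mul, map_star, CStarRing.star_mul_self_eq_zero_iff] at this
    exact his this
  obtain ⟨f, hf⟩ := exists_symbolFun (π c)
  have hf0 : ∀ z, f z ≠ 0 := fun z hz => by
    obtain ⟨s, rfl⟩ := (CharGroup.circle_bijective (Q := Q) π).2 z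
    refine hcs s ?_
    rw [← CharGroup.toeplitzHom_apply π, hf]
    exact hz
  -- multiplying by an element with the inverse symbol gives `1` modulo compact operators
  obtain ⟨d, hd⟩ := exists_symbol ⟨fun z => (f z)⁻¹, f.continuous.inv₀ hf0⟩
  refine ⟨π.symm d * c - 1, isCompactOperator_of_forall_character fun χ => ?_, ?_⟩
  · rw [map_sub, map_mul, map_one, π.apply_symm_apply, map_sub, map_mul, map_one, hd, hf]
    exact sub_eq_zero.2 (inv_mul_cancel₀ (hf0 _))
  · rw [add_sub_cancel]
    exact mul_mem_nullSpace hc _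

/-- The Haar state is faithful. Otherwise the co-unit, which is the identity of the character
group, does not vanish on the null space; translation shows that no character does, so that the
null space contains a compact, and then a finite rank perturbation of the identity. This forces the
algebra to have finite dimension. -/
theorem IsHaar.eq_zero_of_mem_nullSpace (hh : Q.IsHaar h) (π : A ≃⋆ₐ[ℂ] toeplitzAlgebra) {a : A}
    (ha : a ∈ nullSpace h) : a = 0 := by
  have := CharGroup.nonempty Q π
  by_cases h0 : ∀ a ∈ nullSpace h, (1 : Q.CharGroup).hom a = 0
  · refine eq_of_forall_functional fun φ => ?_
    rw [map_zero, ← CharGroup.conv_one_left (Q := Q) φ, conv_apply]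
    exact h0 _ (hh.sliceR_mem_nullSpace ha φ)
  exfalso
  push Not at h0
  obtain ⟨a, ha, ha1⟩ := h0
  obtain ⟨k, hk, hkN⟩ := exists_isCompactOperator_add_one_mem (Q := Q) (h := h) π fun s => by
    -- the translate of `a` by `s⁻¹` takes at `s` the value of `a` at `1`
    refine ⟨Q.sliceR (s⁻¹).clm (Q.comul a), hh.sliceR_mem_nullSpace ha _, ?_⟩
    have : s.hom (Q.sliceR (s⁻¹).clm (Q.comul a)) = (s * s⁻¹).hom a := by
      rw [CharGroup.hom_mul, conv_apply, CharGroup.clm_apply]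
    rw [this, mul_inv_cancel]
    exact ha1
  obtain ⟨v, n, hv, hvn⟩ := exists_isUnit_add_starProjection_mul hk
  let P : BEll := (ellSpan n).starProjection
  have hPk : P * (π k : BEll) ∈ toeplitzAlgebra := by
    refine mem_toeplitzAlgebra_of_isCompactOperator ?_
    exact hk.clm_comp P
  let y : A := π.symm ⟨P * (π k : BEll), hPk⟩
  have hy : (π y : BEll) = P * (π k : BEll) :=
    congrArg Subtype.val (π.apply_symm_apply _)
  have hvT : (π (1 + k - y) : BEll) = v := by
    have : (π (1 + k - y) : BEll) = 1 + (π k : BEll) - (π y : BEll) := by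
      rw [map_sub, map_add, map_one]; rfl
    rw [this, hy, hvn, add_sub_cancel_right]
  have hu : IsUnit (1 + k - y) := by
    rw [← hvT] at hv
    have := (StarSubalgebra.coe_isUnit toeplitzAlgebra).1 hv
    have h2 : IsUnit (π.symm (π (1 + k - y))) := this.map (π.symm : toeplitzAlgebra →⋆ₐ[ℂ] A)
    rwa [π.symm_apply_apply] at h2
  obtain ⟨u, hu⟩ := hu
  -- `1 + k = u + y` with `u` invertible and `y` of finite rank, so `f` has finite rank
  let f : A := (u⁻¹ : Aˣ) * y
  have hf : 1 + f ∈ nullSpace h := by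
    have : 1 + f = (u⁻¹ : Aˣ) * (1 + k) := by
      have h1 : (1 : A) + k = u + y := by rw [hu]; abel
      rw [h1, mul_add, Units.inv_mul]
    rw [this]
    exact mul_mem_nullSpace hkN _
  let C : A →ₗ[ℂ] A := LinearMap.mulLeft ℂ (star f) ∘ₗ LinearMap.mulRight ℂ f
  let σ : A →ₗ[ℂ] BEll :=
    (toeplitzAlgebra.subtype.comp (π : A →⋆ₐ[ℂ] toeplitzAlgebra)).toAlgHom.toLinearMap
  have hσ : Function.Injective σ := Subtype.val_injective.comp π.injective
  have hσmul : ∀ x y, σ (x * y) = σ x * σ y := fun x y =>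
    map_mul (toeplitzAlgebra.subtype.comp (π : A →⋆ₐ[ℂ] toeplitzAlgebra)) x y
  have hσstar : ∀ x, σ (star x) = star (σ x) := fun x =>
    map_star (toeplitzAlgebra.subtype.comp (π : A →⋆ₐ[ℂ] toeplitzAlgebra)) x
  have hfd : FiniteDimensional ℂ (LinearMap.range C) := by
    have h1 := finiteDimensional_range_conj σ (σ (u⁻¹ : Aˣ)) n (π k : BEll)
    have hσf : σ f = σ (u⁻¹ : Aˣ) * ((ellSpan n).starProjection * (π k : BEll)) := by
      rw [hσmul, ← hy]; rfl
    rw [← hσf] at h1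
    have h2 : LinearMap.mulLeft ℂ (star (σ f)) ∘ₗ LinearMap.mulRight ℂ (σ f) ∘ₗ σ = σ ∘ₗ C := by
      ext1 x
      change star (σ f) * (σ x * σ f) = σ (star f * (x * f))
      rw [hσmul (star f), hσmul x f, hσstar]
    rw [h2, LinearMap.range_comp] at h1
    exact (Submodule.equivMapOfInjective σ hσ _).symm.finiteDimensional
  -- a functional `i` that vanishes on `x (1 + f)` and on `(1 + f*) x` satisfies
  -- `i x = - i (x f) = i (f* x f)`
  have := hh.finiteDimensional C fun i hi hi' x => by
    have e1 := hi _ (mul_mem_nullSpace hf x)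
    have e2 := hi' ((1 + star f) * (x * f)) (by
      have := mul_mem_nullSpace hf (star (x * f))
      simpa using this)
    rw [mul_add, mul_one, map_add] at e1
    rw [add_mul, one_mul, map_add] at e2
    change i x = i (star f * (x * f))
    linear_combination e1 - e2
  exact not_finiteDimensional_toeplitzAlgebra
    ((π : A →⋆ₐ[ℂ] toeplitzAlgebra).toAlgHom.toLinearMap.finiteDimensional_of_surjective
      (LinearMap.range_eq_top.2 π.surjective))

end SliceSystem

end

section

/-! ### Positive operators with summable diagonal -/

theorem starProjection_ellSpan_apply (n j : ℕ) (y : EllTwo) :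
    (y - (ellSpan n).starProjection y : EllTwo) j = if j < n then 0 else y j := by
  split_ifs with h
  · rw [← inner_ellBasis]
    exact Submodule.inner_right_of_mem_orthogonal (ellBasis_mem_ellSpan h)
      (Submodule.sub_starProjection_mem_orthogonal y)
  · have h1 : (ellSpan n).starProjection y ∈ (ellSpan n) := Submodule.starProjection_apply_mem _ _
    have h2 : ∀ x ∈ ellSpan n, x j = 0 := fun x hx => by
      induction hx using Submodule.span_induction with
      | mem x hx =>
        obtain ⟨i, hi, rfl⟩ := hx
        rw [ellBasis, lp.single_apply, Pi.single_apply, if_neg]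
        rintro rfl
        exact h hi
      | zero => rfl
      | add x y _ _ hx hy => rw [lp.coeFn_add, Pi.add_apply, hx, hy, add_zero]
      | smul c x _ hx => rw [lp.coeFn_smul, Pi.smul_apply, hx, smul_zero]
    rw [lp.coeFn_sub, Pi.sub_apply, h2 _ h1, sub_zero]

theorem hasSum_norm_sq (x : EllTwo) : HasSum (fun j => ‖x j‖ ^ 2) (‖x‖ ^ 2) := by
  have := lp.hasSum_norm (p := 2) (by norm_num) x
  simpa using this

/-- A selfadjoint operator with square summable columns (a Hilbert–Schmidt operator) is compact. -/
theorem isCompactOperator_of_summable_sq {R : BEll} (hR : IsSelfAdjoint R)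
    (h : Summable fun j => ‖R (ellBasis j)‖ ^ 2) : IsCompactOperator R := by
  have hb : ∀ n, ‖R - (ellSpan n).starProjection * R‖ ≤ √(∑' j, ‖R (ellBasis (j + n))‖ ^ 2) :=
    fun n => by
      refine ContinuousLinearMap.opNorm_le_bound _ (Real.sqrt_nonneg _) fun x => ?_
      rw [← abs_of_nonneg (norm_nonneg x), ← Real.sqrt_sq_eq_abs, ← Real.sqrt_mul
        (tsum_nonneg fun j => sq_nonneg _)]
      refine Real.le_sqrt_of_sq_le ?_
      let y : EllTwo := R x - (ellSpan n).starProjection (R x)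
      have hy : HasSum (fun j => ‖y (j + n)‖ ^ 2) (‖y‖ ^ 2) := by
        have h1 := (hasSum_nat_add_iff' n).2 (hasSum_norm_sq y)
        rwa [Finset.sum_eq_zero, sub_zero] at h1
        intro j hj
        rw [starProjection_ellSpan_apply, if_pos (Finset.mem_range.1 hj)]
        simp
      have hs : Summable fun j => ‖R (ellBasis (j + n))‖ ^ 2 := (summable_nat_add_iff n).2 h
      rw [← tsum_mul_right]
      refine hasSum_le (fun j => ?_) hy (hs.mul_right _).hasSum
      have : y (j + n) = inner ℂ (R (ellBasis (j + n))) x := by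
        rw [starProjection_ellSpan_apply, if_neg (by omega), ← inner_ellBasis,
          ← ContinuousLinearMap.adjoint_inner_left, ← ContinuousLinearMap.star_eq_adjoint,
          hR.star_eq]
      rw [this, ← mul_pow]
      exact pow_le_pow_left₀ (norm_nonneg _) (norm_inner_le_norm _ _) 2
  have hlim : Tendsto (fun n => (ellSpan n).starProjection * R) atTop (𝓝 R) := by
    rw [tendsto_iff_norm_sub_tendsto_zero]
    have h1 := (tendsto_sum_nat_add fun j => ‖R (ellBasis j)‖ ^ 2).sqrt
    rw [Real.sqrt_zero] at h1
    refine squeeze_zero (fun n => norm_nonneg _) (fun n => ?_) h1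
    rw [norm_sub_rev]
    exact hb n
  refine isClosed_setOfPred_isCompactOperator.mem_of_tendsto hlim (Eventually.of_forall fun n => ?_)
  have h1 : IsCompactOperator (ellSpan n).starProjection := by
    rw [(stdOrthonormalBasis ℂ (ellSpan n)).starProjection_eq_sum_rankOne]
    exact sum_mem (S := compactOperator (RingHom.id ℂ) EllTwo EllTwo) fun i _ =>
      isCompactOperator_rankOne _ _
  exact h1.comp_clm R

theorem exists_isSelfAdjoint_mul_self {A : Type*} [CStarAlgebra A] [PartialOrder A]
    [StarOrderedRing A] {a : A} (ha : 0 ≤ a) : ∃ r : A, IsSelfAdjoint r ∧ r * r = a :=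
  ⟨CFC.sqrt a, IsSelfAdjoint.of_nonneg (CFC.sqrt_nonneg a), CFC.sqrt_mul_sqrt_self a ha⟩

/-- A positive operator with bounded partial sums of its diagonal is compact, because its square
root is a Hilbert–Schmidt operator. -/
theorem isCompactOperator_of_sum_inner_le {D : BEll} (hD : D.IsPositive) {M : ℝ}
    (hM : ∀ n, ∑ j ∈ Finset.range n, (inner ℂ (D (ellBasis j)) (ellBasis j)).re ≤ M) :
    IsCompactOperator D := by
  have h0 : 0 ≤ D := (ContinuousLinearMap.nonneg_iff_isPositive D).2 hD
  obtain ⟨R, hRs, hR⟩ := exists_isSelfAdjoint_mul_self h0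
  have h1 : ∀ j, ‖R (ellBasis j)‖ ^ 2 = (inner ℂ (D (ellBasis j)) (ellBasis j)).re :=
    fun j => by
      have h2 : inner ℂ (D (ellBasis j)) (ellBasis j) =
          inner ℂ (R (ellBasis j)) (R (ellBasis j)) := by
        rw [← ContinuousLinearMap.adjoint_inner_left, ← ContinuousLinearMap.star_eq_adjoint,
          hRs.star_eq, ← hR]
        rfl
      rw [h2, inner_self_eq_norm_sq_to_K]
      norm_cast
  have h2 := isCompactOperator_of_summable_sq hRs
    (summable_of_sum_range_le (c := M) (fun j => sq_nonneg _) fun n => by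
      simpa only [h1] using hM n)
  rw [← hR]
  exact h2.clm_comp R

namespace SliceSystem

variable {A B : Type*} [CStarAlgebra A] [CStarAlgebra B] {Q : SliceSystem A B} {h : A →L[ℂ] ℂ}

/-! ### The density operator of the Haar state -/

open InnerProductSpace (rankOne)

theorem rankOne_mem_toeplitzAlgebra (ξ η : EllTwo) :
    (rankOne ℂ ξ η : BEll) ∈ toeplitzAlgebra :=
  mem_toeplitzAlgebra_of_isCompactOperator (isCompactOperator_rankOne ξ η)

/-- The element of the algebra that acts on `ℓ₂(ℤ₊)` as the rank one operator `|ξ⟩⟨η|`. -/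
def ketBra (π : A ≃⋆ₐ[ℂ] toeplitzAlgebra) (ξ η : EllTwo) : A :=
  π.symm ⟨rankOne ℂ ξ η, rankOne_mem_toeplitzAlgebra ξ η⟩

theorem coe_ketBra (π : A ≃⋆ₐ[ℂ] toeplitzAlgebra) (ξ η : EllTwo) :
    (π (ketBra π ξ η) : BEll) = rankOne ℂ ξ η :=
  congrArg Subtype.val (π.apply_symm_apply _)

theorem ext_toeplitz (π : A ≃⋆ₐ[ℂ] toeplitzAlgebra) {a b : A}
    (hab : (π a : BEll) = (π b : BEll)) : a = b :=
  π.injective (Subtype.ext hab)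

theorem norm_ketBra_le (π : A ≃⋆ₐ[ℂ] toeplitzAlgebra) (ξ η : EllTwo) :
    ‖ketBra π ξ η‖ ≤ ‖ξ‖ * ‖η‖ := by
  refine (NonUnitalStarAlgHom.norm_apply_le (π.symm : toeplitzAlgebra →⋆ₐ[ℂ] A) _).trans ?_
  rw [← InnerProductSpace.norm_rankOne (𝕜 := ℂ)]
  rfl

theorem mul_ketBra (π : A ≃⋆ₐ[ℂ] toeplitzAlgebra) (a : A) (ξ η : EllTwo) :
    a * ketBra π ξ η = ketBra π ((π a : BEll) ξ) η := ext_toeplitz π <| by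
  rw [map_mul, MulMemClass.coe_mul, coe_ketBra, coe_ketBra]
  ext1 x
  simp [mul_apply_eq_comp]

theorem star_ketBra (π : A ≃⋆ₐ[ℂ] toeplitzAlgebra) (ξ η : EllTwo) :
    star (ketBra π ξ η) = ketBra π η ξ := ext_toeplitz π <| by
  rw [map_star, StarMemClass.coe_star, coe_ketBra, coe_ketBra, ContinuousLinearMap.star_eq_adjoint,
    InnerProductSpace.adjoint_rankOne]

theorem ketBra_mul (π : A ≃⋆ₐ[ℂ] toeplitzAlgebra) (a : A) (ξ η : EllTwo) :
    ketBra π ξ η * a = ketBra π ξ ((π (star a) : BEll) η) := by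
  rw [← star_star (ketBra π ξ η * a), star_mul, star_ketBra, mul_ketBra, star_ketBra]

theorem star_ketBra_mul (π : A ≃⋆ₐ[ℂ] toeplitzAlgebra) (v : EllTwo) :
    star (ketBra π (ellBasis 0) v) * ketBra π (ellBasis 0) v = ketBra π v v := by
  rw [star_ketBra, mul_ketBra, coe_ketBra, InnerProductSpace.rankOne_apply,
    orthonormal_iff_ite.1 orthonormal_ellBasis, if_pos rfl, one_smul]

/-- The form `(v, w) ↦ h |w⟩⟨v|`. -/
def haarForm (π : A ≃⋆ₐ[ℂ] toeplitzAlgebra) (h : A →L[ℂ] ℂ) : EllTwo →L⋆[ℂ] EllTwo →L[ℂ] ℂ :=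
  LinearMap.mkContinuous₂
    (LinearMap.mk₂'ₛₗ (starRingEnd ℂ) (RingHom.id ℂ) (fun v w => h (ketBra π w v))
      (fun v v' w => by
        rw [← map_add]; congr 1; exact ext_toeplitz π (by simp [coe_ketBra]))
      (fun c v w => by
        rw [← map_smul]; congr 1; exact ext_toeplitz π (by simp [coe_ketBra]))
      (fun v w w' => by
        rw [← map_add]; congr 1; exact ext_toeplitz π (by simp [coe_ketBra]))
      (fun c v w => by
        rw [← map_smul]; congr 1; exact ext_toeplitz π (by simp [coe_ketBra])))
    ‖h‖ fun v w => by
      refine (h.le_opNorm _).trans ?_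
      rw [mul_assoc, mul_comm ‖v‖]
      exact mul_le_mul_of_nonneg_left (norm_ketBra_le π w v) (norm_nonneg h)

/-- The density operator of the Haar state: `h a = Tr (D a)` for operators `a` of finite rank. -/
def density (π : A ≃⋆ₐ[ℂ] toeplitzAlgebra) (h : A →L[ℂ] ℂ) : BEll :=
  InnerProductSpace.continuousLinearMapOfBilin (haarForm π h)

theorem inner_density (π : A ≃⋆ₐ[ℂ] toeplitzAlgebra) (v w : EllTwo) :
    inner ℂ (density π h v) w = h (ketBra π w v) :=
  InnerProductSpace.continuousLinearMapOfBilin_apply _ _ _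

theorem IsHaar.inner_density_nonneg (hh : Q.IsHaar h) (π : A ≃⋆ₐ[ℂ] toeplitzAlgebra)
    (v : EllTwo) : 0 ≤ inner ℂ (density π h v) v := by
  rw [inner_density, ← star_ketBra_mul]
  exact hh.pos _

theorem IsHaar.isSelfAdjoint_density (hh : Q.IsHaar h) (π : A ≃⋆ₐ[ℂ] toeplitzAlgebra) :
    IsSelfAdjoint (density π h) := by
  rw [ContinuousLinearMap.isSelfAdjoint_iff_isSymmetric]
  intro v w
  change inner ℂ (density π h v) w = inner ℂ v (density π h w)
  rw [← inner_conj_symm v, inner_density, inner_density]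
  have := DFunLike.congr_fun hh.pos.star_eq (ketBra π w v)
  rw [conjMap_apply, star_ketBra] at this
  exact this.symm

theorem IsHaar.injective_density (hh : Q.IsHaar h) (π : A ≃⋆ₐ[ℂ] toeplitzAlgebra) :
    Function.Injective (density π h) := by
  rw [injective_iff_map_eq_zero]
  intro v hv
  have h1 : h (star (ketBra π (ellBasis 0) v) * ketBra π (ellBasis 0) v) = 0 := by
    rw [star_ketBra_mul, ← inner_density, hv, inner_zero_left]
  have h2 : ketBra π (ellBasis 0) v = 0 :=
    hh.eq_zero_of_mem_nullSpace π fun y => eq_zero_of_pos h.toLinearMap hh.pos h1 y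
  have h3 := coe_ketBra π (ellBasis 0) v
  rw [h2, map_zero] at h3
  have h4 := InnerProductSpace.rankOne_eq_zero.1 h3.symm
  exact h4.resolve_left (orthonormal_ellBasis.ne_zero 0)

theorem IsHaar.isCompactOperator_density (hh : Q.IsHaar h) (π : A ≃⋆ₐ[ℂ] toeplitzAlgebra) :
    IsCompactOperator (density π h) := by
  refine isCompactOperator_of_sum_inner_le (M := 1) ?_ fun n => ?_
  · rw [ContinuousLinearMap.isPositive_def']
    refine ⟨hh.isSelfAdjoint_density π, fun v => ?_⟩
    exact (Complex.nonneg_iff.1 (hh.inner_density_nonneg π v)).1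
  · -- the partial sums of the diagonal are the values of the state at projections
    let p : A := ∑ j ∈ Finset.range n, ketBra π (ellBasis j) (ellBasis j)
    have hps : star p = p := by simp only [p, star_sum, star_ketBra]
    have hpp : p * p = p := by
      simp only [p, Finset.sum_mul, Finset.mul_sum]
      refine Finset.sum_congr rfl fun i hi => ?_
      rw [Finset.sum_eq_single i]
      · rw [mul_ketBra, coe_ketBra, InnerProductSpace.rankOne_apply,
          orthonormal_iff_ite.1 orthonormal_ellBasis, if_pos rfl, one_smul]
      · intro j _ hj
        rw [mul_ketBra, coe_ketBra, InnerProductSpace.rankOne_apply,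
          orthonormal_iff_ite.1 orthonormal_ellBasis, if_neg (by tauto), zero_smul]
        exact ext_toeplitz π (by simp [coe_ketBra])
      · exact fun h => absurd hi h
    have h1 : 0 ≤ h (star (1 - p) * (1 - p)) := hh.pos _
    have h2 : star (1 - p) * (1 - p) = 1 - p := by
      rw [star_sub, star_one, hps, mul_sub, mul_one, sub_mul, one_mul, hpp, sub_self, sub_zero]
    rw [h2, map_sub, hh.one] at h1
    have h3 := (Complex.nonneg_iff.1 h1).1
    rw [Complex.sub_re, Complex.one_re, map_sum, Complex.re_sum] at h3
    simp only [inner_density]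
    linarith

/-- Elements with a modular relation for the Haar state have the same relation with its density
operator. -/
theorem IsHaar.density_mul (hh : Q.IsHaar h) (π : A ≃⋆ₐ[ℂ] toeplitzAlgebra) {w : A} {c : ℝ}
    (hw : ∀ b, h (w * b) = c * h (b * w)) :
    density π h * (π w : BEll) = (c : ℂ) • ((π w : BEll) * density π h) := by
  have hs : ∀ b, h (b * star w) = c * h (star w * b) := fun b => by
    have h1 := hw (star b)
    have h2 := DFunLike.congr_fun hh.pos.star_eq (b * star w)
    have h3 := DFunLike.congr_fun hh.pos.star_eq (star w * b)
    rw [conjMap_apply, star_mul, star_star] at h2 h3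
    rw [← h2, ← h3, h1]
    simp
  ext1 v
  refine ext_inner_right ℂ fun x => ?_
  rw [mul_apply_eq_comp, smul_apply, mul_apply_eq_comp, inner_smul_left, Complex.conj_ofReal,
    inner_density, ← ContinuousLinearMap.adjoint_inner_right,
    ← ContinuousLinearMap.star_eq_adjoint, inner_density]
  have h1 := hs (ketBra π x v)
  rw [ketBra_mul, mul_ketBra, star_star, map_star] at h1
  exact h1

end SliceSystem

end

section

/-! ### Commuting families of unitary matrices -/

section

open Matrix Module.End

variable {Γ : Type*} {n : ℕ} {V : Γ → Matrix (Fin n) (Fin n) ℂ} {r : Fin n → ℝ}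

theorem commute_toEuclideanLin {M N : Matrix (Fin n) (Fin n) ℂ} (h : Commute M N) :
    Commute (toEuclideanLin M : Module.End ℂ (EuclideanSpace ℂ (Fin n))) (toEuclideanLin N) := by
  ext1 x
  rw [Module.End.mul_apply, Module.End.mul_apply, toLpLin_apply, toLpLin_apply,
    toLpLin_apply, toLpLin_apply, mulVec_mulVec, mulVec_mulVec, h.eq]

/-- A vector on which the whole family, and the diagonal matrix `r`, act by scalars. -/
def IsJointEigenvector (V : Γ → Matrix (Fin n) (Fin n) ℂ) (r : Fin n → ℝ) (c : ℝ) (f : Γ → ℂ)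
    (ξ : Fin n → ℂ) : Prop :=
  (∀ i, ξ i ≠ 0 → r i = c) ∧ ∀ s, V s *ᵥ ξ = f s • ξ

/-- A commuting family of matrices that is closed under adjoints and commutes with a diagonal
matrix has a spanning set of joint eigenvectors; the real and imaginary parts are commuting
symmetric operators. -/
theorem span_jointEigenvector_eq_top (hstar : ∀ s, ∃ t, (V s)ᴴ = V t)
    (hcomm : ∀ s t, Commute (V s) (V t))
    (hr : ∀ s, Commute (V s) (diagonal fun i => (r i : ℂ))) :
    Submodule.span ℂ {ξ : EuclideanSpace ℂ (Fin n) |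
      ξ ≠ 0 ∧ ∃ c f, IsJointEigenvector V r c f ξ.ofLp} = ⊤ := by
  let M : Option (Γ × Bool) → Matrix (Fin n) (Fin n) ℂ
    | none => diagonal fun i => (r i : ℂ)
    | some (s, false) => V s + (V s)ᴴ
    | some (s, true) => Complex.I • (V s - (V s)ᴴ)
  have hMH : ∀ i, (M i).IsHermitian := by
    rintro (_ | ⟨s, _ | _⟩)
    · exact isHermitian_diagonal_of_self_adjoint _ (by ext i; simp)
    · exact isHermitian_add_transpose_self _
    · change (Complex.I • (V s - (V s)ᴴ))ᴴ = Complex.I • (V s - (V s)ᴴ)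
      rw [conjTranspose_smul, conjTranspose_sub, conjTranspose_conjTranspose]
      ext i j
      simp
      ring
  have hVs : ∀ s t, Commute (V s) (V t)ᴴ := fun s t => by
    obtain ⟨u, hu⟩ := hstar t
    rw [hu]; exact hcomm _ _
  have hsV : ∀ s t, Commute (V s)ᴴ (V t) := fun s t => (hVs t s).symm
  have hss : ∀ s t, Commute (V s)ᴴ (V t)ᴴ := fun s t => by
    obtain ⟨u, hu⟩ := hstar t
    rw [hu]; exact hsV _ _
  have hrs : ∀ s, Commute (V s)ᴴ (diagonal fun i => (r i : ℂ)) := fun s => by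
    obtain ⟨u, hu⟩ := hstar s
    rw [hu]; exact hr _
  have hVM : ∀ s i, Commute (V s) (M i) ∧ Commute (V s)ᴴ (M i) := by
    rintro s (_ | ⟨t, _ | _⟩)
    · exact ⟨hr s, hrs s⟩
    · exact ⟨(hcomm _ _).add_right (hVs _ _), (hsV _ _).add_right (hss _ _)⟩
    · exact ⟨((hcomm _ _).sub_right (hVs _ _)).smul_right _,
        ((hsV _ _).sub_right (hss _ _)).smul_right _⟩
  have hMM : ∀ i j, Commute (M i) (M j) := by
    rintro (_ | ⟨s, _ | _⟩) j
    · match j with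
      | none => exact Commute.refl _
      | some (t, false) => exact ((hr t).add_left (hrs t)).symm
      | some (t, true) => exact (((hr t).sub_left (hrs t)).smul_left _).symm
    · exact (hVM s j).1.add_left (hVM s j).2
    · exact ((hVM s j).1.sub_left (hVM s j).2).smul_left _
  rw [eq_top_iff, ← LinearMap.IsSymmetric.iSup_iInf_eq_top_of_commute
    (T := fun i => toEuclideanLin (M i)) (fun i => isSymmetric_toEuclideanLin_iff.2 (hMH i))
    fun i j _ => commute_toEuclideanLin (hMM i j)]
  refine iSup_le fun χ ξ hξ => ?_
  rcases eq_or_ne ξ 0 with rfl | h0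
  · exact Submodule.zero_mem _
  refine Submodule.subset_span ⟨h0, ?_⟩
  have h1 : ∀ i, M i *ᵥ ξ.ofLp = χ i • ξ.ofLp := fun i => by
    have := mem_eigenspace_iff.1 ((Submodule.mem_iInf _).1 hξ i)
    change (toEuclideanLin (M i) ξ).ofLp = _
    exact congrArg WithLp.ofLp this
  have h2 : ∀ i, (r i : ℂ) * ξ i = χ none * ξ i := fun i => by
    have := congrFun (h1 none) i
    rwa [mulVec_diagonal] at this
  have h3 : ∃ i₀, ξ i₀ ≠ 0 := by
    by_contra! h
    exact h0 (by ext i; exact h i)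
  obtain ⟨i₀, hi₀⟩ := h3
  refine ⟨r i₀, fun s => (χ (some (s, false)) - Complex.I * χ (some (s, true))) / 2,
    fun i hi => ?_, fun s => ?_⟩
  · have h4 := mul_right_cancel₀ hi (h2 i)
    rw [← mul_right_cancel₀ hi₀ (h2 i₀)] at h4
    exact_mod_cast h4
  · have e1 : (V s + (V s)ᴴ) *ᵥ ξ.ofLp = χ (some (s, false)) • ξ.ofLp := h1 (some (s, false))
    have e2 : (Complex.I • (V s - (V s)ᴴ)) *ᵥ ξ.ofLp = χ (some (s, true)) • ξ.ofLp :=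
      h1 (some (s, true))
    rw [add_mulVec] at e1
    rw [smul_mulVec, sub_mulVec] at e2
    ext i
    have e3 := congrFun e1 i
    have e4 := congrFun e2 i
    simp only [Pi.add_apply, Pi.smul_apply, Pi.sub_apply, smul_eq_mul] at e3 e4 ⊢
    linear_combination e3 / 2 - Complex.I / 2 * e4 +
      ((V s *ᵥ ξ.ofLp) i - ((V s)ᴴ *ᵥ ξ.ofLp) i) / 2 * Complex.I_sq

/-- If the eigenvalues of the family on a joint eigenvector depend only on the eigenvalue of the
diagonal matrix, then the family is diagonal. -/
theorem eq_zero_of_jointEigenvector (hstar : ∀ s, ∃ t, (V s)ᴴ = V t)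
    (hcomm : ∀ s t, Commute (V s) (V t))
    (hr : ∀ s, Commute (V s) (diagonal fun i => (r i : ℂ)))
    (h : ∀ c f g (ξ η : Fin n → ℂ), ξ ≠ 0 → η ≠ 0 → IsJointEigenvector V r c f ξ →
      IsJointEigenvector V r c g η → f = g) (s : Γ) {i j : Fin n} (hij : i ≠ j) : V s i j = 0 := by
  classical
  -- the common eigenvalues of the family on the eigenspace of `r` at `c`
  let φ : ℝ → Γ → ℂ := fun c =>
    if hc : ∃ f, ∃ ξ : Fin n → ℂ, ξ ≠ 0 ∧ IsJointEigenvector V r c f ξ then hc.choose else 0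
  have hφ : ∀ c f (ξ : Fin n → ℂ), ξ ≠ 0 → IsJointEigenvector V r c f ξ → φ c = f :=
    fun c f ξ h0 hξ => by
      have hc : ∃ f, ∃ ξ : Fin n → ℂ, ξ ≠ 0 ∧ IsJointEigenvector V r c f ξ := ⟨f, ξ, h0, hξ⟩
      obtain ⟨η, hη0, hη⟩ := hc.choose_spec
      simp only [φ, dif_pos hc]
      exact h c _ _ η ξ hη0 h0 hη hξ
  have key : toEuclideanLin (V s) = toEuclideanLin (diagonal fun i => φ (r i) s) := by
    refine LinearMap.ext_on (span_jointEigenvector_eq_top hstar hcomm hr) ?_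
    rintro ξ ⟨h0, c, f, hξ⟩
    have h0' : ξ.ofLp ≠ 0 := fun h => h0 (by ext i; exact congrFun h i)
    have hf := hφ c f _ h0' hξ
    rw [toLpLin_apply, toLpLin_apply, hξ.2]
    congr 1
    ext i
    rw [mulVec_diagonal, Pi.smul_apply, smul_eq_mul]
    rcases eq_or_ne (ξ.ofLp i) 0 with h | h
    · rw [h, mul_zero, mul_zero]
    · rw [hξ.1 i h, hf]
  rw [toEuclideanLin.injective key, diagonal_apply_ne _ hij]

end

end

section

namespace SliceSystem

section

open Matrix

variable {A B : Type*} [CStarAlgebra A] [CStarAlgebra B] {Q : SliceSystem A B} {h : A →L[ℂ] ℂ}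
  {n : ℕ} {w : Matrix (Fin n) (Fin n) A} {r : Fin n → ℝ}

/-! ### The restriction of a representation to the group of characters -/

/-- The value of a representation at a character, a unitary matrix. -/
def CharGroup.eval (w : Matrix (Fin n) (Fin n) A) (s : Q.CharGroup) : Matrix (Fin n) (Fin n) ℂ :=
  Matrix.of fun i j => s.hom (w i j)

theorem IsDiagRep.eval_mul (hw : Q.IsDiagRep w r) (s t : Q.CharGroup) :
    (s * t).eval w = s.eval w * t.eval w := by
  ext i j
  rw [Matrix.mul_apply]
  change (s * t).hom (w i j) = ∑ k, s.hom (w i k) * t.hom (w k j)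
  rw [CharGroup.hom_mul, conv_apply, hw.comul_apply, map_sum, map_sum]
  refine Finset.sum_congr rfl fun k _ => ?_
  rw [sliceR_mul, map_smul, smul_eq_mul, mul_comm]
  rfl

theorem IsDiagRep.eval_mul_conjTranspose (hw : Q.IsDiagRep w r) (s : Q.CharGroup) :
    s.eval w * (s.eval w)ᴴ = 1 := by
  ext i j
  rw [Matrix.mul_apply, Matrix.one_apply]
  have := congrArg s.hom (hw.row i j)
  rw [map_sum] at this
  simp only [map_mul, map_star] at this
  refine this.trans ?_
  split_ifs <;> simp

theorem IsDiagRep.conjTranspose_mul_eval (hw : Q.IsDiagRep w r) (s : Q.CharGroup) :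
    (s.eval w)ᴴ * s.eval w = 1 :=
  mul_eq_one_comm.1 (hw.eval_mul_conjTranspose s)

theorem IsDiagRep.commute_eval_diagonal (hw : Q.IsDiagRep w r) (s : Q.CharGroup) :
    Commute (s.eval w) (diagonal fun i => (r i : ℂ)) := by
  have h1 : (s.eval w)ᴴ * (diagonal fun i => (r i : ℂ)) * s.eval w =
      diagonal fun i => (r i : ℂ) := by
    ext i j
    rw [Matrix.mul_apply, diagonal_apply]
    have := congrArg s.hom (hw.weighted_col j i)
    rw [map_sum] at this
    simp only [map_smul, map_mul, map_star, smul_eq_mul] at this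
    simp only [mul_diagonal]
    refine (Finset.sum_congr rfl fun k _ => ?_).trans (this.trans ?_)
    · change star (s.hom (w k i)) * r k * s.hom (w k j) = _
      ring
    · rcases eq_or_ne i j with rfl | hij
      · rw [if_pos rfl, if_pos rfl, map_smul, map_one, smul_eq_mul, mul_one]
      · rw [if_neg hij, if_neg hij.symm, map_zero]
  have h2 := congrArg (fun X => s.eval w * X) h1
  simp only [← Matrix.mul_assoc, hw.eval_mul_conjTranspose, Matrix.one_mul] at h2
  exact h2.symm

/-- The diagonal matrix coefficient of a representation at the vector `ξ`. -/
def coeff (w : Matrix (Fin n) (Fin n) A) (ξ : Fin n → ℂ) : A :=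
  ∑ i, ∑ j, (star (ξ i) * ξ j) • w i j

theorem hom_coeff (s : Q.CharGroup) (ξ : Fin n → ℂ) :
    s.hom (coeff w ξ) = star ξ ⬝ᵥ (s.eval w *ᵥ ξ) := by
  simp only [coeff, map_sum, map_smul, smul_eq_mul, dotProduct, mulVec, Finset.mul_sum]
  refine Finset.sum_congr rfl fun i _ => Finset.sum_congr rfl fun j _ => ?_
  change star (ξ i) * ξ j * s.hom (w i j) = star (ξ i) * (s.hom (w i j) * ξ j)
  ring

/-- The coefficients at vectors in an eigenspace of the modular operator share one modular
relation. -/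
theorem IsDiagRep.exists_haar_coeff_mul (hh : Q.IsHaar h) (hw : Q.IsDiagRep w r) (c : ℝ)
    {i₀ : Fin n} (hc : r i₀ = c) :
    ∃ κ : ℝ, κ ≠ 0 ∧ ∀ ξ : Fin n → ℂ, (∀ i, ξ i ≠ 0 → r i = c) →
      ∀ b, h (coeff w ξ * b) = κ * h (b * coeff w ξ) := by
  refine ⟨(∑ k, (r k)⁻¹) / (∑ k, r k) * (c * c), ?_, fun ξ hξ b => ?_⟩
  · have h1 : 0 < ∑ k, r k := Finset.sum_pos (fun i _ => hw.r_pos i) ⟨i₀, Finset.mem_univ _⟩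
    have h2 : 0 < ∑ k, (r k)⁻¹ :=
      Finset.sum_pos (fun i _ => inv_pos.2 (hw.r_pos i)) ⟨i₀, Finset.mem_univ _⟩
    have h3 : 0 < c := hc ▸ hw.r_pos i₀
    positivity
  · simp only [coeff, Finset.sum_mul, Finset.mul_sum, map_sum, smul_mul_assoc, mul_smul_comm,
      map_smul, smul_eq_mul]
    refine Finset.sum_congr rfl fun i _ => Finset.sum_congr rfl fun j _ => ?_
    rcases eq_or_ne (ξ i) 0 with hi | hi
    · simp [hi]
    rcases eq_or_ne (ξ j) 0 with hj | hj
    · simp [hj]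
    rw [hw.haar_mul hh, hξ i hi, hξ j hj]
    ring

variable [Nonempty Q.CharGroup]

theorem IsDiagRep.eval_one (hw : Q.IsDiagRep w r) : (1 : Q.CharGroup).eval w = 1 := by
  have h1 := hw.eval_mul 1 1
  rw [mul_one] at h1
  have h2 := congrArg (fun X => ((1 : Q.CharGroup).eval w)ᴴ * X) h1
  simpa only [← Matrix.mul_assoc, hw.conjTranspose_mul_eval, Matrix.one_mul] using h2.symm

theorem IsDiagRep.conjTranspose_eval (hw : Q.IsDiagRep w r) (s : Q.CharGroup) :
    (s.eval w)ᴴ = s⁻¹.eval w := by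
  have h1 := hw.eval_mul s s⁻¹
  rw [mul_inv_cancel, hw.eval_one] at h1
  rw [← Matrix.mul_one (s.eval w)ᴴ, h1, ← Matrix.mul_assoc, hw.conjTranspose_mul_eval,
    Matrix.one_mul]

/-! ### Coefficients of joint eigenvectors -/

/-- Joint eigenvectors in one eigenspace of the modular operator have the same eigenvalues: the
product of the adjoint of one coefficient with the other commutes with the density operator of
the Haar state, so that its symbol, which is multiplicative on the character group, has a
logarithm. -/
theorem IsDiagRep.eq_of_isJointEigenvector [ConnectedSpace Q.CharGroup] (hh : Q.IsHaar h)
    (hw : Q.IsDiagRep w r) (π : A ≃⋆ₐ[ℂ] toeplitzAlgebra) {c : ℝ} {f g : Q.CharGroup → ℂ}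
    {ξ η : Fin n → ℂ} (hξ0 : ξ ≠ 0) (hη0 : η ≠ 0)
    (hξ : IsJointEigenvector (CharGroup.eval w) r c f ξ)
    (hη : IsJointEigenvector (CharGroup.eval w) r c g η) : f = g := by
  -- the eigenvalues form a unitary character of the group
  have hmul : ∀ {f : Q.CharGroup → ℂ} {ξ : Fin n → ℂ}, ξ ≠ 0 →
      IsJointEigenvector (CharGroup.eval w) r c f ξ →
      f 1 = 1 ∧ (∀ s t, f (s * t) = f s * f t) ∧ ∀ s, star (f s) = f s⁻¹ :=
    fun {f ξ} h0 hξ => by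
      have hinj := smul_left_injective ℂ h0
      refine ⟨hinj ?_, fun s t => hinj ?_, fun s => ?_⟩
      · change f 1 • ξ = (1 : ℂ) • ξ
        rw [← hξ.2, hw.eval_one, one_mulVec, one_smul]
      · change f (s * t) • ξ = (f s * f t) • ξ
        rw [← hξ.2, hw.eval_mul, ← mulVec_mulVec, hξ.2, mulVec_smul, hξ.2, smul_smul, mul_comm]
      · have h1 : star ξ ⬝ᵥ ξ ≠ 0 := fun h => h0 (dotProduct_star_self_eq_zero.1 h)
        have h2 : star ξ ⬝ᵥ (s⁻¹.eval w *ᵥ ξ) = star (f s) * (star ξ ⬝ᵥ ξ) := by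
          rw [← hw.conjTranspose_eval, dotProduct_mulVec, ← star_mulVec, hξ.2, star_smul,
            smul_dotProduct, smul_eq_mul]
        rw [hξ.2, dotProduct_smul, smul_eq_mul] at h2
        exact (mul_right_cancel₀ h1 h2).symm
  obtain ⟨hf1, hfm, hfs⟩ := hmul hξ0 hξ
  obtain ⟨hg1, hgm, hgs⟩ := hmul hη0 hη
  obtain ⟨i₀, hi₀⟩ := Function.ne_iff.1 hξ0
  obtain ⟨κ, hκ, hmod⟩ := hw.exists_haar_coeff_mul hh c (hξ.1 i₀ hi₀)
  have hx := hh.density_mul π (hmod ξ hξ.1)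
  have hy := hh.density_mul π (hmod η hη.1)
  have hNξ : star ξ ⬝ᵥ ξ ≠ 0 := fun h => hξ0 (dotProduct_star_self_eq_zero.1 h)
  have hNη : star η ⬝ᵥ η ≠ 0 := fun h => hη0 (dotProduct_star_self_eq_zero.1 h)
  -- normalised so that the symbol is `conj f · g`
  let N : ℂ := (star (star ξ ⬝ᵥ ξ) * (star η ⬝ᵥ η))⁻¹
  let a : A := N • (star (coeff w ξ) * coeff w η)
  have ha : ∀ s : Q.CharGroup, s.hom a = f s⁻¹ * g s := fun s => by
    have h1 : star (star ξ ⬝ᵥ ξ) ≠ 0 := star_ne_zero.2 hNξ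
    rw [map_smul, map_mul, map_star, hom_coeff, hom_coeff, hξ.2, hη.2, dotProduct_smul,
      dotProduct_smul, smul_eq_mul, smul_eq_mul, smul_eq_mul, star_mul', hfs]
    simp only [N]
    field_simp
  -- both coefficients multiply `D` by the same real factor, which cancels in the product
  have haD : (π a : BEll) * density π h = density π h * (π a : BEll) := by
    have hD := (hh.isSelfAdjoint_density π).star_eq
    have hx' : (π (star (coeff w ξ)) : BEll) * density π h =
        (κ : ℂ) • (density π h * (π (star (coeff w ξ)) : BEll)) := by
      have h1 := congrArg star hx
      have h2 : (π (star (coeff w ξ)) : BEll) = star (π (coeff w ξ) : BEll) := by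
        rw [map_star]; rfl
      rw [star_mul, star_smul, star_mul, hD, ← h2] at h1
      simpa using h1
    have e : (π a : BEll) = N • ((π (star (coeff w ξ)) : BEll) * (π (coeff w η) : BEll)) := by
      simp only [a, map_smul, map_mul]; rfl
    have hκ' : (κ : ℂ) ≠ 0 := by exact_mod_cast hκ
    have h1 : (κ : ℂ) • ((π (star (coeff w ξ)) : BEll) * (π (coeff w η) : BEll) * density π h) =
        (κ : ℂ) • (density π h * ((π (star (coeff w ξ)) : BEll) * (π (coeff w η) : BEll))) := by
      rw [mul_assoc, ← mul_smul_comm, ← hy, ← mul_assoc, hx', smul_mul_assoc, mul_assoc]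
    rw [e, smul_mul_assoc, mul_smul_comm, smul_right_injective _ hκ' h1]
  have hF : ∀ s : Q.CharGroup, star (s.hom a) * s.hom a = 1 := fun s => by
    rw [ha, star_mul', hfs, hgs, inv_inv]
    calc f s * g s⁻¹ * (f s⁻¹ * g s) = (f s * f s⁻¹) * (g s⁻¹ * g s) := by ring
      _ = 1 := by rw [← hfm, ← hgm, mul_inv_cancel, inv_mul_cancel, hf1, hg1, one_mul]
  obtain ⟨G, hG⟩ := exists_log_symbol_of_commute (hh.isCompactOperator_density π)
    (hh.isSelfAdjoint_density π) (hh.injective_density π) haD fun χ => by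
      obtain ⟨s, rfl⟩ := CharGroup.exists_toeplitzHom_eq Q π χ
      rw [CharGroup.toeplitzHom_apply]
      exact hF s
  have hone := eq_one_of_eq_exp (f := fun s : Q.CharGroup => s.hom a) (fun s t => by
      rw [ha, ha, ha, _root_.mul_inv_rev, hfm, hgm]
      ring)
    (G.comp ⟨_, CharGroup.continuous_circle π⟩) fun s => by
      rw [← CharGroup.toeplitzHom_apply π, hG]
      rfl
  funext s
  have h1 := hone s
  rw [ha] at h1
  calc f s = f s * (f s⁻¹ * g s) := by rw [h1, mul_one]
    _ = f (s * s⁻¹) * g s := by rw [hfm]; ring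
    _ = g s := by rw [mul_inv_cancel, hf1, one_mul]

end

section

variable {A B : Type*} [CStarAlgebra A] [CStarAlgebra B] {Q : SliceSystem A B} {h : A →L[ℂ] ℂ}
  {n : ℕ} {w : Matrix (Fin n) (Fin n) A} {r : Fin n → ℝ}

/-- In an eigenbasis of the modular operator, the off-diagonal matrix elements vanish at every
character. -/
theorem IsDiagRep.hom_eq_zero (hw : Q.IsDiagRep w r) (π : A ≃⋆ₐ[ℂ] toeplitzAlgebra)
    (s : Q.CharGroup) {i j : Fin n} (hij : i ≠ j) : s.hom (w i j) = 0 := by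
  have := CharGroup.nonempty Q π
  have := CharGroup.connectedSpace Q π
  obtain ⟨h, hh⟩ := exists_isHaar Q π
  refine eq_zero_of_jointEigenvector (V := CharGroup.eval (Q := Q) w)
    (fun s => ⟨s⁻¹, hw.conjTranspose_eval s⟩) (fun s t => ?_) hw.commute_eval_diagonal
    (fun c f g ξ η h1 h2 h3 h4 => hw.eq_of_isJointEigenvector hh π h1 h2 h3 h4) s hij
  rw [Commute, SemiconjBy, ← hw.eval_mul, ← hw.eval_mul, mul_comm_of_injective_circle
    (CharGroup.continuous_circle (Q := Q) π) (CharGroup.circle_bijective π).1]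

theorem IsDiagRep.star_hom_mul (hw : Q.IsDiagRep w r) (π : A ≃⋆ₐ[ℂ] toeplitzAlgebra)
    (s : Q.CharGroup) (i : Fin n) : star (s.hom (w i i)) * s.hom (w i i) = 1 := by
  have := congrArg s.hom (hw.col i i)
  rw [map_sum, Finset.sum_eq_single i, if_pos rfl, map_one, map_mul, map_star] at this
  · exact this
  · intro k _ hk
    rw [map_mul, hw.hom_eq_zero π s hk, mul_zero]
  · simp

theorem IsDiagRep.isCompactOperator_iff (hw : Q.IsDiagRep w r) (π : A ≃⋆ₐ[ℂ] toeplitzAlgebra)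
    (i j : Fin n) : IsCompactOperator (π (w i j) : BEll) ↔ i ≠ j := by
  refine ⟨?_, fun hij => isCompactOperator_of_forall_character fun χ => ?_⟩
  · rintro hc rfl
    obtain ⟨s⟩ := CharGroup.nonempty Q π
    have h1 := character_eq_zero_of_isCompactOperator (s.toeplitzHom π) hc
    have h2 := hw.star_hom_mul π s i
    rw [CharGroup.toeplitzHom_apply] at h1
    rw [h1, mul_zero] at h2
    exact zero_ne_one h2
  · obtain ⟨s, rfl⟩ := CharGroup.exists_toeplitzHom_eq Q π χ
    rw [CharGroup.toeplitzHom_apply, hw.hom_eq_zero π s hij]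

theorem IsDiagRep.isFredholm (hw : Q.IsDiagRep w r) (π : A ≃⋆ₐ[ℂ] toeplitzAlgebra)
    (i : Fin n) : ContinuousLinearMap.IsFredholm (π (w i i) : BEll) := by
  refine isFredholm_of_isCompactOperator (b := (star (π (w i i)) : toeplitzAlgebra))
    (isCompactOperator_of_forall_character (a := star (π (w i i)) * π (w i i) - 1) fun χ => ?_)
    (isCompactOperator_of_forall_character (a := π (w i i) * star (π (w i i)) - 1) fun χ => ?_)
  · obtain ⟨s, rfl⟩ := CharGroup.exists_toeplitzHom_eq Q π χ
    rw [map_sub, map_mul, map_star, CharGroup.toeplitzHom_apply, hw.star_hom_mul π, map_one,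
      sub_self]
  · obtain ⟨s, rfl⟩ := CharGroup.exists_toeplitzHom_eq Q π χ
    rw [map_sub, map_mul, map_star, mul_comm, CharGroup.toeplitzHom_apply, hw.star_hom_mul π,
      map_one, sub_self]

end

end SliceSystem

/-- A positive definite matrix whose off-diagonal matrix elements in an orthonormal basis vanish
has the basis vectors as eigenvectors, with positive eigenvalues. -/
theorem exists_eigenvalues_of_posDef {n : ℕ} {ρ : Matrix (Fin n) (Fin n) ℂ} (hρ : ρ.PosDef)
    (b : OrthonormalBasis (Fin n) ℂ (EuclideanSpace ℂ (Fin n)))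
    (hb : ∀ i j, i ≠ j → inner ℂ (b i) (Matrix.toEuclideanLin ρ (b j)) = 0) :
    ∃ r : Fin n → ℝ, (∀ i, 0 < r i) ∧
      ∀ j, Matrix.toEuclideanLin ρ (b j) = (r j : ℂ) • b j := by
  have hpos : ∀ j, 0 < inner ℂ (b j) (Matrix.toEuclideanLin ρ (b j)) := fun j => by
    have h0 : (b j).ofLp ≠ 0 := fun h => b.orthonormal.ne_zero j (by ext i; exact congrFun h i)
    have := hρ.dotProduct_mulVec_pos h0
    rw [Matrix.toLpLin_apply, EuclideanSpace.inner_eq_star_dotProduct, dotProduct_comm]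
    exact this
  refine ⟨fun j => (inner ℂ (b j) (Matrix.toEuclideanLin ρ (b j))).re,
    fun i => (Complex.pos_iff.1 (hpos i)).1, fun j => ?_⟩
  have h1 : (((inner ℂ (b j) (Matrix.toEuclideanLin ρ (b j))).re : ℝ) : ℂ) =
      inner ℂ (b j) (Matrix.toEuclideanLin ρ (b j)) :=
    Complex.ext rfl (by simpa using (Complex.pos_iff.1 (hpos j)).2)
  rw [h1]
  conv_lhs => rw [← b.sum_repr' (Matrix.toEuclideanLin ρ (b j))]
  rw [Finset.sum_eq_single j]
  · intro i _ hi
    rw [hb i j hi, zero_smul]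
  · simp

end

end CQG

end

theorem mainTheorem4 {A : Type*} [CStarAlgebra A] {H : Type*} [NormedAddCommGroup H]
    [InnerProductSpace ℂ H] [CompleteSpace H] (G : CQG.CompactQuantumGroup A H)
    (π : A ≃⋆ₐ[ℂ] CQG.toeplitzAlgebra) {n : ℕ} (u : Matrix (Fin n) (Fin n) A)
    (hu : G.IsIrreducibleUnitaryRep u) (ρ : Matrix (Fin n) (Fin n) ℂ)
    (hρ : CQG.IsModularOperator u ρ)
    (b : OrthonormalBasis (Fin n) ℂ (EuclideanSpace ℂ (Fin n)))
    (hb : ∀ i j, i ≠ j → inner ℂ (b i) (Matrix.toEuclideanLin ρ (b j)) = 0) :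
    (∀ i j, IsCompactOperator
      (π (CQG.matrixElement u b i j) : CQG.EllTwo →L[ℂ] CQG.EllTwo) ↔ i ≠ j) ∧
    ∀ i, ContinuousLinearMap.IsFredholm
      (π (CQG.matrixElement u b i i) : CQG.EllTwo →L[ℂ] CQG.EllTwo) := by
  obtain ⟨r, hr, hbr⟩ := CQG.exists_eigenvalues_of_posDef hρ.posDef b hb
  have hw := hu.isDiagRep hρ hr hbr
  exact ⟨fun i j => hw.isCompactOperator_iff π i j, fun i => hw.isFredholm π i⟩
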